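/- **Conventions.** Let $d\ge 4$ and let $S^3\subset\mathbb{RP}^4$ be the quadric $x_1^2+x_2^2+x_3^2+x_4^2=x_0^2$. Identify the hyperplane $H=\{x_0=0\}$, which is disjoint from $S^3$, with $\mathbb{RP}^3$ (coordinates $y_1,\dots,y_4$). A real rational curve of degree $e$ in $\mathbb{RP}^n$ is given by $n+1$ real binary forms of degree $e$ without common complex root, up to real projective changes of the parameter; the space of such curves carries the quotient of the topology of the space of coefficients. $\mathbb{C}C$ and $\mathbb{R}C$ denote the complex and real points of a curve $C$. The curve is a knot if its complexified parametrization $\mathbb{CP}^1\to\mathbb{CP}^n$ is an injective immersion. It has exactly one double point if the complexified parametrization is an immersion, exactly one unordered pair of distinct points of $\mathbb{CP}^1$ is identified by it, and the two branches through that double point have distinct tangent lines. The double point is solitary if its two preimages are not real. For $e\ge 2$ and $m\in\{0,2\}$ let $\mathcal P_{e,m}$ be the space of pairs $(C,X)$ of a knot $C$ of degree $e$ in $\mathbb{RP}^3$ and a real plane $X\subset\mathbb{RP}^3$ such that $\mathbb{R}C\cap X$ consists of exactly $m$ points, and let $\mathcal P'_{e,m}\subset\mathcal P_{e,m}$ be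 the subspace of pairs for which exactly $e-2$ of the $e$ points of $\mathbb{C}C\cap\mathbb{C}X$ lie on the empty conic $\{y\in X: y_1^2+y_2^2+y_3^2+y_4^2=0\}$. Points are counted with multiplicity, that is: if $X=\{\sum v_iy_i=0\}$ and $y(s,t)$ parametrizes $C$, then there are real binary forms $w,q,r$ of degrees $e-2$, $2$, $e+2$ with $\sum v_iy_i=wq$, $\sum y_i^2=wr$, and $q,r$ have no common complex root. Let $\mathcal D_d$ be the space of real rational curves of degree $d$ in $S^3$ with exactly one double point such that no complex line through the double point meets the complexified curve in more than three points, counted with multiplicity. **Theorem.** For every $d\ge4$, stereographic projection from the double point is a two-sheeted covering map $$\varphi:\mathcal D_d\to\mathcal P'_{d-2,0}\cup\mathcal P'_{d-2,2}.$$ It sends a curve $K$ with double point $p$ to $(C,X)$, where $C\subset H$ is the closure of the projection of $\mathbb{C}K$ from $p$ to $H$, and $X=T_pS^3\cap H$ is the blow-up of $p$. One has $\varphi(K)\in\mathcal P'_{d-2,0}$ if the double point is solitary and $\varphi(K)\in\mathcal P'_{d-2,2}$ if it is not. The two curves in each fibre of $\varphi$ are mirror images of each other in the hyperplane of projection $H$,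 i.e. they are interchanged by the reflection $[x_0:x_1:x_2:x_3:x_4]\mapsto[-x_0:x_1:x_2:x_3:x_4]$ of $\mathbb{RP}^4$, which preserves $S^3$. Moreover, for $d<8$ the condition on lines through the double point holds automatically, so that $\mathcal D_d$ is then the space of all real rational curves of degree $d$ in $S^3$ with exactly one double point. -/

import Mathlib

open scoped LinearAlgebra.Projectivization

noncomputable section

namespace RationalKnot

/-- Real binary forms of degree `d` in `(s, t)`, given by their coefficients
(`f j` is the coefficient of `s ^ j * t ^ (d - j)`). -/
abbrev BinForm (d : ℕ) : Type := Fin (d + 1) → ℝ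

/-- The homogeneous polynomial in two variables defined by a binary form. -/
def BinForm.toPoly {d : ℕ} (f : BinForm d) : MvPolynomial (Fin 2) ℝ :=
  ∑ j : Fin (d + 1), MvPolynomial.C (f j) * MvPolynomial.X 0 ^ (j : ℕ)
    * MvPolynomial.X 1 ^ (d - (j : ℕ))

/-- The value of a real binary form at a complex vector. -/
def BinForm.cval {d : ℕ} (f : BinForm d) (z : Fin 2 → ℂ) : ℂ :=
  MvPolynomial.aeval z f.toPoly

/-- The value of a real binary form at a real vector. -/
def BinForm.rval {d : ℕ} (f : BinForm d) (z : Fin 2 → ℝ) : ℝ :=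
  MvPolynomial.eval z f.toPoly

/-! ### Parametrizations and curves -/

/-- Parametrizations of degree `d` of real rational curves in real projective `n`-space:
`n + 1` real binary forms of degree `d` without a common (complex) root.
The topology is the one of the space of coefficients. -/
def Param (n d : ℕ) : Type :=
  {k : Fin (n + 1) → BinForm d // ∀ z : Fin 2 → ℂ, z ≠ 0 → ∃ i, (k i).cval z ≠ 0}

instance (n d : ℕ) : TopologicalSpace (Param n d) :=
  inferInstanceAs (TopologicalSpace {k : Fin (n + 1) → BinForm d //
    ∀ z : Fin 2 → ℂ, z ≠ 0 → ∃ i, (k i).cval z ≠ 0})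

variable {n d : ℕ}

/-- The homogeneous coordinates of the complexified parametrization. -/
def Param.cvec (k : Param n d) (z : Fin 2 → ℂ) : Fin (n + 1) → ℂ :=
  fun i => (k.1 i).cval z

/-- The homogeneous coordinates of the real parametrization. -/
def Param.rvec (k : Param n d) (z : Fin 2 → ℝ) : Fin (n + 1) → ℝ :=
  fun i => (k.1 i).rval z

theorem Param.cvec_ne_zero (k : Param n d) {z : Fin 2 → ℂ} (hz : z ≠ 0) : k.cvec z ≠ 0 := by
  obtain ⟨i, hi⟩ := k.2 z hz
  exact fun h => hi (congrFun h i)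

/-- The complexified parametrization, a map from the complex projective line to complex
projective `n`-space. -/
def Param.cmap (k : Param n d) (P : ℙ ℂ (Fin 2 → ℂ)) : ℙ ℂ (Fin (n + 1) → ℂ) :=
  Projectivization.mk ℂ (k.cvec P.rep) (k.cvec_ne_zero P.rep_nonzero)

/-- Two parametrizations define the same curve if they differ by a real projective
transformation of the source (and by a common factor of the homogeneous coordinates). -/
def Param.Reparam (k l : Param n d) : Prop :=
  ∃ (A : GL (Fin 2) ℝ) (c : ℝˣ), ∀ z : Fin 2 → ℝ,
    l.rvec z = (c : ℝ) • k.rvec ((A : Matrix (Fin 2) (Fin 2) ℝ).mulVec z)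

/-- Equality of curves, as an equivalence relation on parametrizations. -/
instance curveSetoid (n d : ℕ) : Setoid (Param n d) where
  r := Param.Reparam
  iseqv :=
    { refl := fun k => ⟨1, 1, fun z => by simp⟩
      symm := by
        rintro k l ⟨A, c, h⟩
        refine ⟨A⁻¹, c⁻¹, fun z => ?_⟩
        rw [h, Matrix.mulVec_mulVec, ← Units.val_mul, mul_inv_cancel, Units.val_one,
          Matrix.one_mulVec, smul_smul, ← Units.val_mul, inv_mul_cancel, Units.val_one, one_smul]
      trans := by
        rintro k l m ⟨A, c, h⟩ ⟨B, e, h'⟩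
        refine ⟨A * B, e * c, fun z => ?_⟩
        rw [h', h, Matrix.mulVec_mulVec, smul_smul, ← Units.val_mul, ← Units.val_mul] }

/-- The space of real rational curves of degree `d` in real projective `n`-space (parametrizations
up to reparametrization, with the quotient topology). -/
def Curve (n d : ℕ) : Type := Quotient (curveSetoid n d)

instance (n d : ℕ) : TopologicalSpace (Curve n d) :=
  inferInstanceAs (TopologicalSpace (Quotient (curveSetoid n d)))

/-- `k` is a parametrization of the curve `K`. -/
def Param.Parametrizes (k : Param n d) (K : Curve n d) : Prop :=
  (Quotient.mk (curveSetoid n d) k : Curve n d) = K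

/-! ### Singularities -/

/-- The linear subspace spanned by the two partial derivatives of the homogeneous coordinates at a
point of the complex projective line. If it is two-dimensional, then the parametrization is an
immersion at that point, and it is the tangent line of that branch of the complexified curve. -/
def Param.branchTangent (k : Param n d) (P : ℙ ℂ (Fin 2 → ℂ)) :
    Submodule ℂ (Fin (n + 1) → ℂ) :=
  Submodule.span ℂ (Set.range fun a : Fin 2 =>
    fun i => MvPolynomial.aeval P.rep (MvPolynomial.pderiv a (k.1 i).toPoly))

/-- The parametrization is an immersion of the complex projective line. -/
def Param.IsImmersion (k : Param n d) : Prop :=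
  ∀ P, Module.finrank ℂ (k.branchTangent P) = 2

/-- Real rational knots: the complexified curve has no singular points. -/
def Param.IsKnot (k : Param n d) : Prop :=
  Function.Injective k.cmap ∧ k.IsImmersion

/-- The only singular point of the complexified curve is one double point, at which two branches
with distinct tangent lines meet. -/
def Param.HasExactlyOneDoublePoint (k : Param n d) : Prop :=
  k.IsImmersion ∧ ∃ P Q : ℙ ℂ (Fin 2 → ℂ), P ≠ Q ∧ k.cmap P = k.cmap Q ∧
    k.branchTangent P ≠ k.branchTangent Q ∧
    ∀ P' Q', P' ≠ Q' → k.cmap P' = k.cmap Q' → s(P', Q') = s(P, Q)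

/-- Real points of the complex projective line. -/
def IsRealPoint (P : ℙ ℂ (Fin 2 → ℂ)) : Prop :=
  ∃ (z : Fin 2 → ℝ) (c : ℂ), P.rep = c • (fun i => (z i : ℂ))

/-- The double points of the curve are solitary: they have no real preimage. -/
def Param.IsSolitary (k : Param n d) : Prop :=
  ∀ P Q : ℙ ℂ (Fin 2 → ℂ), P ≠ Q → k.cmap P = k.cmap Q → ¬ IsRealPoint P ∧ ¬ IsRealPoint Q

/-- The real vector `p` represents a double point of the curve. -/
def Param.IsDoublePoint (k : Param n d) (p : Fin (n + 1) → ℝ) : Prop :=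
  p ≠ 0 ∧ ∃ P Q : ℙ ℂ (Fin 2 → ℂ), P ≠ Q ∧ k.cmap P = k.cmap Q ∧
    ∃ c : ℂ, k.cvec P.rep = c • (fun i => (p i : ℂ))

/-- The complex line of projective space given by the two-dimensional linear subspace `L` meets the
complexified curve in at least `m` points, counted with multiplicity: the pull-backs of the linear
forms vanishing on `L` have a common divisor of degree `m`. -/
def Param.MeetsLine (k : Param n d) (L : Submodule ℂ (Fin (n + 1) → ℂ)) (m : ℕ) : Prop :=
  ∃ g : MvPolynomial (Fin 2) ℂ, g ≠ 0 ∧ g.IsHomogeneous m ∧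
    ∀ l : (Fin (n + 1) → ℂ) →ₗ[ℂ] ℂ, (∀ x ∈ L, l x = 0) →
      g ∣ ∑ i, MvPolynomial.C (l (Pi.single i 1)) *
        MvPolynomial.map (algebraMap ℝ ℂ) (k.1 i).toPoly

/-- No complex line through a double point meets the complexified curve in more than three points,
counted with multiplicity. -/
def Param.NoFourSecant (k : Param n d) : Prop :=
  ∀ p, k.IsDoublePoint p → ∀ L : Submodule ℂ (Fin (n + 1) → ℂ), Module.finrank ℂ L = 2 →
    (fun i => (p i : ℂ)) ∈ L → ¬ k.MeetsLine L 4

/-! ### Curves in the 3-sphere -/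

/-- The curve lies in the sphere `x₁² + x₂² + x₃² + x₄² = x₀²`. -/
def Param.InSphere (k : Param 4 d) : Prop :=
  ∑ i : Fin 4, (k.1 i.succ).toPoly ^ 2 = (k.1 0).toPoly ^ 2

/-- The space of real rational curves of degree `d` in the sphere with exactly one double point. -/
def nodalSphereCurves (d : ℕ) : Set (Curve 4 d) :=
  {K | ∃ k : Param 4 d, k.Parametrizes K ∧ k.InSphere ∧ k.HasExactlyOneDoublePoint}

/-- The curves with exactly one double point such that no line through the double point meets the
curve in more than three points. -/
def generalNodalSphereCurves (d : ℕ) : Set (Curve 4 d) :=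
  {K | ∃ k : Param 4 d, k.Parametrizes K ∧ k.InSphere ∧ k.HasExactlyOneDoublePoint ∧
    k.NoFourSecant}

/-- The (unique) double point of the curve is solitary. -/
def Curve.IsSolitary (K : Curve n d) : Prop :=
  ∃ k : Param n d, k.Parametrizes K ∧ k.IsSolitary

/-- The reflection of projective 4-space in the hyperplane `x₀ = 0`. -/
def reflection (x : Fin 5 → ℝ) : Fin 5 → ℝ := fun i => if i = 0 then -x i else x i

/-- `K'` is the mirror image of `K` in the hyperplane `x₀ = 0`. -/
def IsMirrorImage (K K' : Curve 4 d) : Prop :=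
  ∃ k k' : Param 4 d, k.Parametrizes K ∧ k'.Parametrizes K' ∧
    ∀ z : Fin 2 → ℝ, k'.rvec z = reflection (k.rvec z)

/-! ### Pairs of a knot and a plane in projective 3-space -/

/-- Real planes in projective 3-space; the class of `v` is the plane `∑ vᵢ yᵢ = 0`. -/
def Plane : Type := ℙ ℝ (Fin 4 → ℝ)

instance : TopologicalSpace Plane :=
  inferInstanceAs (TopologicalSpace (Quotient (projectivizationSetoid ℝ (Fin 4 → ℝ))))

/-- The coefficients of an equation of the plane. -/
def Plane.normal (X : Plane) : Fin 4 → ℝ := Projectivization.rep X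

/-- The point with homogeneous coordinates `y` lies on the plane. -/
def Plane.Contains (X : Plane) (y : Fin 4 → ℝ) : Prop := ∑ i, X.normal i * y i = 0

/-- The points in which the real part of the curve meets the real plane. -/
def Param.realIntersection (k : Param 3 d) (X : Plane) : Set (ℙ ℝ (Fin 4 → ℝ)) :=
  {y | X.Contains y.rep ∧ ∃ z : Fin 2 → ℝ, z ≠ 0 ∧ ∃ c : ℝ, y.rep = c • k.rvec z}

/-- The complexified curve meets the plane `X` in `d` points (the roots of `w * q`), of which
`d - 2` (the roots of `w`) lie on the empty conic `y₁² + y₂² + y₃² + y₄² = 0` of `X`, while the two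
others (the roots of `q`) do not; all points are counted with multiplicity. -/
def Param.MeetsConic (k : Param 3 d) (X : Plane) : Prop :=
  ∃ (w : BinForm (d - 2)) (q : BinForm 2) (r : BinForm (d + 2)),
    ∑ i, MvPolynomial.C (X.normal i) * (k.1 i).toPoly = w.toPoly * q.toPoly ∧
    ∑ i, (k.1 i).toPoly ^ 2 = w.toPoly * r.toPoly ∧
    ∀ z : Fin 2 → ℂ, z ≠ 0 → ¬ (q.cval z = 0 ∧ r.cval z = 0)

/-- Pairs `(C, X)` of a real rational knot of degree `d` in projective 3-space and a real plane
which meet in exactly `m` real points. -/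
def pairSpace (d m : ℕ) : Set (Curve 3 d × Plane) :=
  {P | ∃ k : Param 3 d, k.Parametrizes P.1 ∧ k.IsKnot ∧ (k.realIntersection P.2).encard = m}

/-- The pairs in `pairSpace d m` such that `d - 2` of the `d` points of intersection lie on the
empty conic of the plane. -/
def conicPairSpace (d m : ℕ) : Set (Curve 3 d × Plane) :=
  {P | P ∈ pairSpace d m ∧ ∃ k : Param 3 d, k.Parametrizes P.1 ∧ k.MeetsConic P.2}

/-! ### Stereographic projection -/

/-- The projection from the point `p` to the hyperplane `x₀ = 0`: the point of that hyperplane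
on the line through `p` and `x` (it is zero if and only if `x` is a multiple of `p`, for `p 0 ≠ 0`).
-/
def stereo (p : Fin 5 → ℝ) (x : Fin 5 → ℂ) : Fin 4 → ℂ :=
  fun i => (p 0 : ℂ) * x i.succ - x 0 * (p i.succ : ℂ)

/-- `(C, X)` is the stereographic projection of `K` from its double point `p`: the curve `C` is the
closure of the projection of the complexification of `K`, and `X` is the intersection of the tangent
hyperplane of the sphere at `p` with the hyperplane `x₀ = 0`. -/
def IsStereographicProjection {d e : ℕ} (K : Curve 4 d) (P : Curve 3 e × Plane) : Prop :=
  ∃ (k : Param 4 d) (l : Param 3 e) (p : Fin 5 → ℝ),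
    k.Parametrizes K ∧ l.Parametrizes P.1 ∧ k.IsDoublePoint p ∧
    (∀ z : Fin 2 → ℂ, stereo p (k.cvec z) ≠ 0 → ∃ c : ℂ, l.cvec z = c • stereo p (k.cvec z)) ∧
    ∀ y : Fin 4 → ℝ, P.2.Contains y ↔ ∑ i : Fin 4, p i.succ * y i = 0

end RationalKnot

end

open RationalKnot

/-! Write the double point as p = (p_0, p_1, …, p_4). Its two preimages are the roots of a real
quadratic form q. Every coordinate of the projection from p vanishes at both of them, so the
projected coordinates are q l_i with l of degree e = d - 2. If p_0 = 1, the equation of the sphere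
becomes q Σ l_i² = -2 k_0 Σ p_i l_i. Since k_0 does not vanish at the roots of q, there is a form w
with Σ p_i l_i = w q, and then Σ l_i² = w r with r = -2 k_0. This is the condition on the conic.
Conversely k = (-(p_0/2) r, q l_i - (p_i/2) r) recovers the curve. The structure `Projects` records
this dictionary; `IsNode.exists_projects` and `exists_projects` are its two directions.

The plane determines (p_1, …, p_4) up to a factor, and the sphere then fixes p_0 up to sign. For
each choice of p, the forms q and r are unique up to a common factor, because they are coprime.
Hence there are exactly two curves over each pair, and they are mirror images. As Σ l_i² is positive
at real parameters, w has no real root. The real points of intersection with the plane therefore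
come from the real roots of q: there are none if the double point is solitary and two otherwise.

Singularities are expressed by divisibility. A pinch is a quadratic form g modulo which a
parametrization is proportional to a constant vector a: distinct roots of g mean a coincidence, a
double root means a failure of immersion. A knot has no pinch (`Param.isKnot_iff`). A curve with one
double point has a single pinch q, and its two tangent lines differ. A pinch of k other than q
projects to a pinch of l (`Projects.isNode`). A pinch g of l yields a line through p that cuts k in
the divisor of q g, of degree four. So the absence of four-secants through p is equivalent to l
being a knot (`Projects.isKnot_of_noFourSecant`, `Projects.noFourSecant`). For e < 6 a pinch of l at
a lifts to a second pinch of k or to equal tangent lines, unless a lies on the empty conic. In that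
case g and its conjugate are coprime divisors of w, which is impossible since deg w = e - 2 < 4
(`Projects.isKnot_of_lt`).

For the topology, continuity is tested on spaces of parametrizations together with a chosen
factorization. Forgetting the factorization is a closed map, because multiplication by a form of
norm one is proper; so these spaces are quotient presentations of both sides. The projection is then
a quotient map whose fibres are the orbits of the mirror involution. The affine position of the
double point is a continuous, odd, nowhere zero function, and this makes the quotient a covering
(`isCoveringMap_of_involution`). -/

noncomputable section

namespace RationalKnot

open MvPolynomial

/-! ### Binary forms over a field -/

section BinaryForms

variable {K : Type*} [Field K]

theorem aeval_smul_of_isHomogeneous {σ A : Type*} [CommRing A] [Algebra K A]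
    {f : MvPolynomial σ K} {n : ℕ} (hf : f.IsHomogeneous n) (c : A) (x : σ → A) :
    aeval (fun i => c * x i) f = c ^ n * aeval x f := by
  rw [aeval_def, aeval_def, eval₂_eq, eval₂_eq, Finset.mul_sum]
  refine Finset.sum_congr rfl fun m hm => ?_
  have h : ∑ i ∈ m.support, m i = n := (hf.degree_eq_sum_deg_support hm).symm
  simp_rw [mul_pow]
  rw [Finset.prod_mul_distrib, Finset.prod_pow_eq_pow_sum, h]
  ring

theorem eval_smul_of_isHomogeneous {σ : Type*} {f : MvPolynomial σ K} {n : ℕ}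
    (hf : f.IsHomogeneous n) (c : K) (x : σ → K) : eval (c • x) f = c ^ n * eval x f := by
  have := aeval_smul_of_isHomogeneous hf c x
  rwa [aeval_eq_eval] at this

/-- The linear form vanishing at `z`. -/
def lin (z : Fin 2 → K) : MvPolynomial (Fin 2) K := C (z 1) * X 0 - C (z 0) * X 1

@[simp] theorem eval_lin (z x : Fin 2 → K) : eval x (lin z) = z 1 * x 0 - z 0 * x 1 := by
  simp [lin]

theorem isHomogeneous_lin (z : Fin 2 → K) : (lin z).IsHomogeneous 1 :=
  (isHomogeneous_C_mul_X _ _).sub (isHomogeneous_C_mul_X _ _)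

theorem coeff_lin_zero (z : Fin 2 → K) : (lin z).coeff (Finsupp.single 0 1) = z 1 := by
  simp [lin, coeff_C_mul, coeff_X, Finsupp.single_left_inj]

theorem coeff_lin_one (z : Fin 2 → K) : (lin z).coeff (Finsupp.single 1 1) = -z 0 := by
  simp [lin, coeff_C_mul, coeff_X, Finsupp.single_left_inj]

theorem lin_ne_zero {z : Fin 2 → K} (hz : z ≠ 0) : lin z ≠ 0 := by
  intro h
  apply hz
  have h0 := coeff_lin_zero z
  have h1 := coeff_lin_one z
  rw [h, coeff_zero] at h0 h1
  ext i
  fin_cases i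
  · simpa using h1.symm
  · exact h0.symm

theorem lin_smul (c : K) (z : Fin 2 → K) : lin (c • z) = C c * lin z := by
  simp only [lin, Pi.smul_apply, smul_eq_mul, C_mul]; ring

theorem exists_smul_of_cross_eq_zero {z x : Fin 2 → K} (hz : z ≠ 0)
    (h : z 1 * x 0 - z 0 * x 1 = 0) : ∃ c : K, x = c • z := by
  by_cases h0 : z 0 = 0
  · have h1 : z 1 ≠ 0 := fun h1 => hz (by ext i; fin_cases i <;> simpa)
    refine ⟨x 1 / z 1, ?_⟩
    have hx : x 0 = 0 := by simpa [h0, h1] using h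
    ext i; fin_cases i
    · simp [h0, hx]
    · simp [h1]
  · refine ⟨x 0 / z 0, ?_⟩
    ext i; fin_cases i
    · simp [h0]
    · simp only [Fin.mk_one, Pi.smul_apply, smul_eq_mul]
      field_simp
      linear_combination -h

/-- Modulo `lin z` one has z_j X_i = X_j z_i for all i. Homogeneity gives z_j^n f(X) = X_j^n f(z) =
0 there, and z_j is a unit for a suitable j. -/
theorem lin_dvd {f : MvPolynomial (Fin 2) K} {n : ℕ} (hf : f.IsHomogeneous n) {z : Fin 2 → K}
    (hz : z ≠ 0) (h : eval z f = 0) : lin z ∣ f := by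
  obtain ⟨j, hj⟩ := Function.ne_iff.mp hz
  let π := Ideal.Quotient.mkₐ K (Ideal.span {lin z})
  have hlin : π (lin z) = 0 :=
    Ideal.Quotient.eq_zero_iff_mem.mpr (Ideal.mem_span_singleton_self _)
  have hX : ∀ i, π (C (z j)) * π (X i) = π (X j) * algebraMap K _ (z i) := by
    intro i
    have hC : ∀ a : K, π (C a) = algebraMap K _ a := fun a => π.commutes a
    have : π (C (z 1)) * π (X 0) = π (X 1) * π (C (z 0)) := by
      have h1 : π (C (z 1)) * π (X 0) - π (C (z 0)) * π (X 1) = 0 := by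
        rw [← map_mul, ← map_mul]
        exact (RingHom.map_sub π.toRingHom _ _).symm.trans hlin
      linear_combination h1
    rw [← hC]
    fin_cases i <;> fin_cases j
    · exact mul_comm _ _
    · exact this
    · simp only [Fin.zero_eta, Fin.mk_one]; linear_combination -this
    · exact mul_comm _ _
  have hf1 : aeval (fun i => π (X i)) f = π f := by
    have : aeval (fun i => π (X i)) = π := by ext i; simp
    rw [this]
  have key : (π (C (z j))) ^ n * π f = 0 := by
    rw [← hf1, ← aeval_smul_of_isHomogeneous hf]
    simp_rw [hX]
    rw [aeval_smul_of_isHomogeneous hf]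
    have : aeval (fun i => algebraMap K (MvPolynomial (Fin 2) K ⧸ Ideal.span {lin z}) (z i)) f
        = algebraMap K _ (eval z f) := by
      rw [← aeval_eq_eval]
      exact aeval_algebraMap_apply _ z f
    rw [this, h, map_zero, mul_zero]
  rw [← map_pow, ← map_mul] at key
  have h2 : lin z ∣ C (z j) ^ n * f := by
    rw [← Ideal.mem_span_singleton, ← Ideal.Quotient.eq_zero_iff_mem]
    exact key
  have hu : IsUnit (C (σ := Fin 2) (z j) ^ n) := ((isUnit_iff_ne_zero.mpr hj).map C).pow n
  exact (hu.dvd_mul_left).mp h2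

/-- The component of degree m + n of f g is f times the component of degree n of g; cancel f. -/
theorem IsHomogeneous.of_mul {f g : MvPolynomial (Fin 2) K} {m n : ℕ} (hf : f.IsHomogeneous m)
    (hf0 : f ≠ 0) (h : (f * g).IsHomogeneous (m + n)) : g.IsHomogeneous n := by
  have h1 : f * g = f * homogeneousComponent n g := by
    conv_lhs => rw [← homogeneousComponent_eq_self h, ← sum_homogeneousComponent g,
      Finset.mul_sum, map_sum]
    have : ∀ i, homogeneousComponent (m + n) (f * homogeneousComponent i g) =
        if i = n then f * homogeneousComponent n g else 0 := by
      intro i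
      rw [homogeneousComponent_of_mem (hf.mul (homogeneousComponent_isHomogeneous i g))]
      by_cases hi : i = n
      · subst hi; simp
      · rw [if_neg hi, if_neg (by omega)]
    simp_rw [this]
    rw [Finset.sum_ite_eq']
    split_ifs with hn
    · rfl
    · rw [homogeneousComponent_eq_zero _ _ (by simpa using hn), mul_zero]
  rw [mul_left_cancel₀ hf0 h1]
  exact homogeneousComponent_isHomogeneous _ _

theorem exists_eq_lin_mul {f : MvPolynomial (Fin 2) K} {n : ℕ} (hf : f.IsHomogeneous (n + 1))
    {z : Fin 2 → K} (hz : z ≠ 0) (h : eval z f = 0) :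
    ∃ g : MvPolynomial (Fin 2) K, g.IsHomogeneous n ∧ f = lin z * g := by
  obtain ⟨g, rfl⟩ := lin_dvd hf hz h
  exact ⟨g, IsHomogeneous.of_mul (isHomogeneous_lin z) (lin_ne_zero hz) (by rwa [add_comm 1]), rfl⟩

theorem prime_lin {z : Fin 2 → K} (hz : z ≠ 0) : Prime (lin z) := by
  refine Irreducible.prime (irreducible_of_totalDegree_eq_one
    ((isHomogeneous_lin z).totalDegree (lin_ne_zero hz)) fun x hx => ?_)
  rw [isUnit_iff_ne_zero]
  rintro rfl
  exact lin_ne_zero hz (by ext i; simpa using hx i)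

theorem eq_C_of_isHomogeneous_zero {f : MvPolynomial (Fin 2) K} (hf : f.IsHomogeneous 0) :
    ∃ c, f = C c :=
  ⟨_, totalDegree_eq_zero_iff_eq_C.mp ((totalDegree_zero_iff_isHomogeneous (Fin 2)).mpr hf)⟩

/-- Both affine charts are needed. Without a root in the chart (x, 1), f is a constant c there.
Homogeneity gives f(1, t) = c t^(n+1), which vanishes at t = 0 since the degree is positive. -/
theorem exists_root [IsAlgClosed K] {f : MvPolynomial (Fin 2) K} {n : ℕ}
    (hf : f.IsHomogeneous (n + 1)) : ∃ z : Fin 2 → K, z ≠ 0 ∧ eval z f = 0 := by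
  by_contra! hroot
  let p : Polynomial K := aeval ![Polynomial.X, 1] f
  have hp : ∀ x, p.eval x = eval ![x, 1] f := by
    intro x
    have : (Polynomial.aeval x).comp (aeval ![Polynomial.X, 1] : MvPolynomial (Fin 2) K →ₐ[K] _)
        = aeval ![x, 1] := by
      ext i; fin_cases i <;> simp
    have := DFunLike.congr_fun this f
    simpa [aeval_eq_eval] using this
  have hd : p.degree = 0 := by
    by_contra hd
    obtain ⟨x, hx⟩ := IsAlgClosed.exists_root p hd
    refine hroot ![x, 1] (fun h => by simpa using congrFun h 1) ?_
    rw [← hp]; exact hx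
  rw [Polynomial.eq_C_of_degree_eq_zero hd] at hp
  set c := p.coeff 0
  let p' : Polynomial K := aeval ![1, Polynomial.X] f
  have hp' : ∀ x, p'.eval x = eval ![1, x] f := by
    intro x
    have : (Polynomial.aeval x).comp (aeval ![1, Polynomial.X] : MvPolynomial (Fin 2) K →ₐ[K] _)
        = aeval ![1, x] := by
      ext i; fin_cases i <;> simp
    have := DFunLike.congr_fun this f
    simpa [aeval_eq_eval] using this
  have hq : p' = Polynomial.C c * Polynomial.X ^ (n + 1) := by
    have : Infinite K := IsAlgClosed.instInfinite
    refine Polynomial.eq_of_infinite_eval_eq _ _ (Set.Infinite.mono (s := {0}ᶜ) ?_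
      (Set.finite_singleton (0 : K)).infinite_compl)
    intro t ht
    have ht : t ≠ 0 := ht
    have h1 : ![(1 : K), t] = t • ![t⁻¹, 1] := by
      ext i; fin_cases i <;> simp [ht]
    simp only [Set.mem_ofPred_eq]
    rw [hp', h1, eval_smul_of_isHomogeneous hf, ← hp]
    rw [Polynomial.eval_C, Polynomial.eval_mul, Polynomial.eval_C, Polynomial.eval_pow,
      Polynomial.eval_X, mul_comm]
  refine hroot ![1, 0] (fun h => by simpa using congrFun h 0) ?_
  rw [← hp', hq]; simp

theorem not_lin_dvd {f : MvPolynomial (Fin 2) K} {z : Fin 2 → K} (h : eval z f ≠ 0) :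
    ¬ lin z ∣ f := by
  rintro ⟨g, rfl⟩
  simp [mul_comm] at h

/-- Over an algebraically closed field f splits into prime linear factors; remove them one by one.
-/
theorem isRelPrime_of_no_common_root [IsAlgClosed K] {f g : MvPolynomial (Fin 2) K} {m : ℕ}
    (hf : f.IsHomogeneous m) (hf0 : f ≠ 0)
    (h : ∀ z : Fin 2 → K, z ≠ 0 → eval z f = 0 → eval z g ≠ 0) : IsRelPrime f g := by
  induction m generalizing f with
  | zero =>
    obtain ⟨c, rfl⟩ := eq_C_of_isHomogeneous_zero hf
    have hc : c ≠ 0 := fun hc => hf0 (by simp [hc])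
    exact ((isUnit_iff_ne_zero.mpr hc).map C).isRelPrime_left
  | succ m ih =>
    obtain ⟨z, hz, hfz⟩ := exists_root hf
    obtain ⟨f₁, hf₁, rfl⟩ := exists_eq_lin_mul hf hz hfz
    refine IsRelPrime.mul_left ?_ (ih hf₁ (right_ne_zero_of_mul hf0)
      fun x hx hfx => h x hx (by simp [hfx]))
    exact ((prime_lin hz).irreducible.isRelPrime_iff_not_dvd).mpr (not_lin_dvd (h z hz hfz))

theorem lin_mul_lin_dvd {f : MvPolynomial (Fin 2) K} {n : ℕ} (hf : f.IsHomogeneous n)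
    {z z' : Fin 2 → K} (hz : z ≠ 0) (hz' : z' ≠ 0) (hzz : z 1 * z' 0 - z 0 * z' 1 ≠ 0)
    (h : eval z f = 0) (h' : eval z' f = 0) : lin z * lin z' ∣ f := by
  refine IsRelPrime.mul_dvd ?_ (lin_dvd hf hz h) (lin_dvd hf hz' h')
  refine ((prime_lin hz').irreducible.isRelPrime_iff_not_dvd.mpr (not_lin_dvd ?_)).symm
  simpa using hzz

theorem exists_eq_lin_mul_lin [IsAlgClosed K] {g : MvPolynomial (Fin 2) K}
    (hg : g.IsHomogeneous 2) (hg0 : g ≠ 0) : ∃ (c : K) (z z' : Fin 2 → K), c ≠ 0 ∧ z ≠ 0 ∧ z' ≠ 0 ∧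
      g = C c * (lin z * lin z') := by
  obtain ⟨z, hz, h⟩ := exists_root hg
  obtain ⟨f, hf, rfl⟩ := exists_eq_lin_mul hg hz h
  obtain ⟨z', hz', h'⟩ := exists_root hf
  obtain ⟨f', hf', rfl⟩ := exists_eq_lin_mul hf hz' h'
  obtain ⟨c, rfl⟩ := eq_C_of_isHomogeneous_zero hf'
  refine ⟨c, z, z', ?_, hz, hz', by ring⟩
  rintro rfl
  simp at hg0

/-- Removing a linear factor from a multiple of a common divisor. -/
theorem exists_dvd_of_dvd_lin_mul [IsAlgClosed K] {ι : Type*} {g : MvPolynomial (Fin 2) K} {m : ℕ}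
    (hg : g.IsHomogeneous (m + 1)) (hg0 : g ≠ 0) {z : Fin 2 → K} (hz : z ≠ 0)
    {f : ι → MvPolynomial (Fin 2) K} (h : ∀ i, g ∣ lin z * f i) :
    ∃ g' : MvPolynomial (Fin 2) K, g'.IsHomogeneous m ∧ g' ≠ 0 ∧ ∀ i, g' ∣ f i := by
  by_cases hgz : eval z g = 0
  · obtain ⟨g', hg', rfl⟩ := exists_eq_lin_mul hg hz hgz
    exact ⟨g', hg', right_ne_zero_of_mul hg0,
      fun i => (mul_dvd_mul_iff_left (lin_ne_zero hz)).mp (h i)⟩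
  -- Here g is coprime to `lin z` and already divides every f i. An arbitrary linear factor is
  -- dropped only to reach degree m.
  · obtain ⟨x, hx, hgx⟩ := exists_root hg
    have hr : IsRelPrime g (lin z) :=
      ((prime_lin hz).irreducible.isRelPrime_iff_not_dvd.mpr (not_lin_dvd hgz)).symm
    obtain ⟨g', hg', rfl⟩ := exists_eq_lin_mul hg hx hgx
    exact ⟨g', hg', right_ne_zero_of_mul hg0,
      fun i => (dvd_mul_left _ _).trans (hr.dvd_of_dvd_mul_left (h i))⟩

theorem exists_C_mul_of_dvd {f g : MvPolynomial (Fin 2) K} {n : ℕ} (hf : f.IsHomogeneous n)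
    (hf0 : f ≠ 0) (hg : g.IsHomogeneous n) (h : f ∣ g) : ∃ c, g = C c * f := by
  obtain ⟨a, rfl⟩ := h
  obtain ⟨c, rfl⟩ := eq_C_of_isHomogeneous_zero (IsHomogeneous.of_mul (n := 0) hf hf0 hg)
  exact ⟨c, mul_comm _ _⟩

end BinaryForms

/-! ### Real forms inside complex forms -/

/-- The complexification of a real polynomial. -/
abbrev cx {σ : Type*} (f : MvPolynomial σ ℝ) : MvPolynomial σ ℂ := map (algebraMap ℝ ℂ) f

theorem exists_eq_cx_add {σ : Type*} (h : MvPolynomial σ ℂ) :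
    ∃ a b : MvPolynomial σ ℝ, h = cx a + C Complex.I * cx b := by
  induction h using MvPolynomial.induction_on with
  | C c =>
    refine ⟨C c.re, C c.im, ?_⟩
    simp only [cx, map_C, Complex.coe_algebraMap, ← C_mul, ← C_add]
    rw [mul_comm, Complex.re_add_im]
  | add f g hf hg =>
    obtain ⟨a, b, rfl⟩ := hf
    obtain ⟨a', b', rfl⟩ := hg
    exact ⟨a + a', b + b', by simp only [cx, map_add]; ring⟩
  | mul_X f i hf =>
    obtain ⟨a, b, rfl⟩ := hf
    exact ⟨a * X i, b * X i, by simp only [cx, map_mul, map_X]; ring⟩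

theorem cx_injective {σ : Type*} : Function.Injective (cx (σ := σ)) :=
  map_injective _ (algebraMap ℝ ℂ).injective

theorem eq_of_cx_eq_cx_add {σ : Type*} {f a b : MvPolynomial σ ℝ}
    (h : cx f = cx a + C Complex.I * cx b) : f = a := by
  ext m
  have := congrArg (fun p => (coeff m p).re) h
  simpa only [cx, coeff_add, coeff_C_mul, coeff_map, Complex.coe_algebraMap, Complex.add_re,
    Complex.ofReal_re, Complex.I_mul_re, Complex.ofReal_im, neg_zero, add_zero] using this

/-- The real part of the complex quotient is a real quotient. -/
theorem dvd_of_cx_dvd_cx {σ : Type*} {f g : MvPolynomial σ ℝ} (h : cx f ∣ cx g) : f ∣ g := by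
  obtain ⟨u, hu⟩ := h
  obtain ⟨a, b, rfl⟩ := exists_eq_cx_add u
  refine ⟨a, eq_of_cx_eq_cx_add (b := f * b) ?_⟩
  rw [hu]; simp only [cx, map_mul]; ring

/-- A complex vector proportional to its conjugate is proportional to a real vector. -/
theorem exists_real_of_conj_smul {ι : Type*} {u : ι → ℂ} (hu : u ≠ 0) {c : ℂ}
    (h : ∀ i, starRingEnd ℂ (u i) = c * u i) :
    ∃ (a : ℂ) (x : ι → ℝ), a ≠ 0 ∧ x ≠ 0 ∧ u = a • fun i => (x i : ℂ) := by
  obtain ⟨j, hj⟩ := Function.ne_iff.mp hu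
  have hj : u j ≠ 0 := hj
  have hj' : starRingEnd ℂ (u j) ≠ 0 := by simpa using hj
  have key : u = u j • fun i => (((u i / u j).re : ℝ) : ℂ) := by
    funext i
    have : starRingEnd ℂ (u i / u j) = u i / u j := by
      rw [map_div₀, div_eq_div_iff hj' hj, h, h]; ring
    rw [Complex.conj_eq_iff_re] at this
    simp only [Pi.smul_apply, smul_eq_mul]
    rw [this]; field_simp
  refine ⟨u j, _, hj, ?_, key⟩
  intro h0
  apply hu
  rw [key]
  funext i
  have := congrFun h0 i
  simp only [Pi.zero_apply] at this
  simp [this]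

end RationalKnot
end

noncomputable section

namespace RationalKnot

open MvPolynomial
open scoped LinearAlgebra.Projectivization Pointwise

/-! ### Coefficient vectors and polynomials -/

section BinFormLemmas

variable {n d : ℕ}

theorem BinForm.isHomogeneous_toPoly (f : BinForm d) : f.toPoly.IsHomogeneous d := by
  refine IsHomogeneous.sum _ _ _ fun j _ => ?_
  have h := ((isHomogeneous_C (Fin 2) (f j)).mul (isHomogeneous_X_pow (R := ℝ) (0 : Fin 2) j)).mul
    (isHomogeneous_X_pow (R := ℝ) (1 : Fin 2) (d - j))
  have : 0 + (j : ℕ) + (d - j) = d := by have := j.2; omega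
  rwa [this] at h

/-- The exponent of the monomial `s ^ j * t ^ (d - j)`. -/
def expo (d j : ℕ) : Fin 2 →₀ ℕ := Finsupp.single 0 j + Finsupp.single 1 (d - j)

/-- The coefficient vector of the degree `d` part of a polynomial. -/
def ofPoly (d : ℕ) : MvPolynomial (Fin 2) ℝ →ₗ[ℝ] BinForm d :=
  LinearMap.pi fun j => lcoeff ℝ (expo d j)

theorem BinForm.toPoly_eq (f : BinForm d) : f.toPoly = ∑ j : Fin (d + 1), monomial (expo d j) (f j) := by
  refine Finset.sum_congr rfl fun j _ => ?_
  rw [expo, X_pow_eq_monomial, X_pow_eq_monomial, C_mul_monomial, monomial_mul]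
  simp

theorem expo_injective {i j : Fin (d + 1)} (h : expo d i = expo d j) : i = j := by
  have := DFunLike.congr_fun h 0
  simp [expo] at this
  exact Fin.ext this

@[simp] theorem ofPoly_toPoly (f : BinForm d) : ofPoly d f.toPoly = f := by
  funext j
  simp only [ofPoly, LinearMap.pi_apply, lcoeff_apply, BinForm.toPoly_eq, coeff_sum, coeff_monomial]
  rw [Finset.sum_eq_single j]
  · simp
  · intro i _ hij
    exact if_neg fun h => hij (expo_injective h)
  · simp

theorem toPoly_injective : Function.Injective (BinForm.toPoly (d := d)) :=
  Function.LeftInverse.injective ofPoly_toPoly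

theorem toPoly_ofPoly {f : MvPolynomial (Fin 2) ℝ} (hf : f.IsHomogeneous d) :
    (ofPoly d f).toPoly = f := by
  rw [BinForm.toPoly_eq]
  ext m
  simp only [coeff_sum, coeff_monomial]
  by_cases hm : m.degree = d
  · have hm2 : m 0 + m 1 = d := by
      rw [← hm, Finsupp.degree_eq_sum, Fin.sum_univ_two]
    have hj : expo d (m 0) = m := by
      ext i
      fin_cases i
      · simp [expo]
      · simp [expo]; omega
    rw [Finset.sum_eq_single (⟨m 0, by omega⟩ : Fin (d + 1))]
    · simp only [hj, if_true]
      simp [ofPoly, hj]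
    · intro i _ hi
      refine if_neg fun h => hi (expo_injective ?_)
      rw [h, hj]
    · simp
  · rw [hf.coeff_eq_zero hm]
    refine Finset.sum_eq_zero fun i _ => if_neg ?_
    rintro rfl
    apply hm
    have := i.2
    simp [expo, Finsupp.degree_eq_sum, Fin.sum_univ_two]
    omega

theorem toPoly_add (f g : BinForm d) : (f + g).toPoly = f.toPoly + g.toPoly := by
  simp only [BinForm.toPoly_eq, Pi.add_apply, map_add, Finset.sum_add_distrib]

theorem toPoly_smul (c : ℝ) (f : BinForm d) : (c • f).toPoly = C c * f.toPoly := by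
  simp only [BinForm.toPoly_eq, Pi.smul_apply, Finset.mul_sum, C_mul_monomial, smul_eq_mul]

theorem toPoly_eq_zero {f : BinForm d} : f.toPoly = 0 ↔ f = 0 := by
  rw [← toPoly_injective.eq_iff (b := 0)]
  simp [BinForm.toPoly_eq]

/-- The complexification of the polynomial of a binary form. -/
abbrev BinForm.cpoly (f : BinForm d) : MvPolynomial (Fin 2) ℂ := cx f.toPoly

theorem BinForm.isHomogeneous_cpoly (f : BinForm d) : f.cpoly.IsHomogeneous d :=
  f.isHomogeneous_toPoly.map _

theorem BinForm.cval_eq (f : BinForm d) (z : Fin 2 → ℂ) : f.cval z = eval z f.cpoly := by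
  rw [BinForm.cval, aeval_def, BinForm.cpoly, eval_map]

theorem eval_cx_ofReal {σ : Type*} (f : MvPolynomial σ ℝ) (x : σ → ℝ) :
    eval (fun i => (x i : ℂ)) (cx f) = ((eval x f : ℝ) : ℂ) := by
  rw [eval_map, ← Complex.coe_algebraMap]
  exact (eval₂_comp_left (algebraMap ℝ ℂ) (RingHom.id ℝ) x f).symm

theorem eval_cx_conj {σ : Type*} (f : MvPolynomial σ ℝ) (z : σ → ℂ) :
    eval (fun i => starRingEnd ℂ (z i)) (cx f) = starRingEnd ℂ (eval z (cx f)) := by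
  rw [eval_map, eval_map, eval₂_comp_left (starRingEnd ℂ)]
  congr 1
  ext x
  simp

end BinFormLemmas

/-! ### Complexified parametrizations -/

section ParamLemmas

variable {n d : ℕ}

/-- The complex polynomials of a parametrization. -/
def Param.cpoly (k : Param n d) (i : Fin (n + 1)) : MvPolynomial (Fin 2) ℂ := (k.1 i).cpoly

theorem Param.isHomogeneous_cpoly (k : Param n d) (i) : (k.cpoly i).IsHomogeneous d :=
  (k.1 i).isHomogeneous_cpoly

theorem Param.cvec_apply (k : Param n d) (z : Fin 2 → ℂ) (i) : k.cvec z i = eval z (k.cpoly i) :=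
  BinForm.cval_eq _ _

theorem Param.cvec_smul (k : Param n d) (c : ℂ) (z : Fin 2 → ℂ) :
    k.cvec (c • z) = c ^ d • k.cvec z := by
  funext i
  rw [Pi.smul_apply, cvec_apply, cvec_apply, eval_smul_of_isHomogeneous (k.isHomogeneous_cpoly i),
    smul_eq_mul]

theorem Param.cvec_conj (k : Param n d) (z : Fin 2 → ℂ) (i) :
    k.cvec (fun j => starRingEnd ℂ (z j)) i = starRingEnd ℂ (k.cvec z i) := by
  rw [cvec_apply, cvec_apply]; exact eval_cx_conj _ _

theorem Param.cvec_ofReal (k : Param n d) (z : Fin 2 → ℝ) (i) :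
    k.cvec (fun j => (z j : ℂ)) i = (k.rvec z i : ℂ) := by
  rw [cvec_apply]; exact eval_cx_ofReal _ _

theorem Param.rvec_apply (k : Param n d) (z : Fin 2 → ℝ) (i) :
    k.rvec z i = eval z (k.1 i).toPoly := rfl

/-- The partial derivatives of the homogeneous coordinates. -/
def Param.cderiv (k : Param n d) (z : Fin 2 → ℂ) (a : Fin 2) : Fin (n + 1) → ℂ :=
  fun i => eval z (pderiv a (k.cpoly i))

theorem Param.cderiv_smul (k : Param n d) (c : ℂ) (z : Fin 2 → ℂ) (a) :
    k.cderiv (c • z) a = c ^ (d - 1) • k.cderiv z a := by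
  funext i
  exact eval_smul_of_isHomogeneous (k.isHomogeneous_cpoly i).pderiv _ _

theorem Param.branchTangent_eq (k : Param n d) (P : ℙ ℂ (Fin 2 → ℂ)) :
    k.branchTangent P = Submodule.span ℂ (Set.range (k.cderiv P.rep)) := by
  unfold Param.branchTangent
  congr 2
  funext a i
  rw [Param.cderiv, Param.cpoly, BinForm.cpoly, cx, pderiv_map, eval_map, aeval_def]

theorem Param.branchTangent_mk (k : Param n d) {z : Fin 2 → ℂ} (hz : z ≠ 0) :
    k.branchTangent (Projectivization.mk ℂ z hz) = Submodule.span ℂ (Set.range (k.cderiv z)) := by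
  obtain ⟨a, ha⟩ := Projectivization.exists_smul_eq_mk_rep ℂ z hz
  rw [branchTangent_eq, ← ha]
  have : Set.range (k.cderiv (a • z)) = ((a ^ (d - 1) : ℂˣ) : ℂ) • Set.range (k.cderiv z) := by
    rw [← Set.image_smul, ← Set.range_comp]
    congr 1
    funext b
    rw [Units.smul_def, cderiv_smul]; simp
  rw [this, Submodule.span_smul_eq_of_isUnit _ _ (Units.isUnit _)]

theorem Param.euler (k : Param n d) (z : Fin 2 → ℂ) :
    z 0 • k.cderiv z 0 + z 1 • k.cderiv z 1 = (d : ℂ) • k.cvec z := by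
  funext i
  have := congrArg (eval z) (k.isHomogeneous_cpoly i).sum_X_mul_pderiv
  simp only [Fin.sum_univ_two, map_add, map_mul, eval_X, nsmul_eq_mul, map_natCast] at this
  simpa [Param.cderiv, Param.cvec_apply] using this

theorem mk_eq_mk_iff_cross {z z' : Fin 2 → ℂ} (hz : z ≠ 0) (hz' : z' ≠ 0) :
    Projectivization.mk ℂ z hz = Projectivization.mk ℂ z' hz' ↔ z 1 * z' 0 - z 0 * z' 1 = 0 := by
  rw [eq_comm, Projectivization.mk_eq_mk_iff']
  constructor
  · rintro ⟨a, rfl⟩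
    simp only [Pi.smul_apply, smul_eq_mul]; ring
  · intro h
    obtain ⟨c, hc⟩ := exists_smul_of_cross_eq_zero hz h
    exact ⟨c, hc.symm⟩

theorem Param.cmap_mk (k : Param n d) {z : Fin 2 → ℂ} (hz : z ≠ 0) :
    k.cmap (Projectivization.mk ℂ z hz) = Projectivization.mk ℂ (k.cvec z) (k.cvec_ne_zero hz) := by
  obtain ⟨a, ha⟩ := Projectivization.exists_smul_eq_mk_rep ℂ z hz
  rw [Param.cmap, Projectivization.mk_eq_mk_iff']
  refine ⟨(a : ℂ) ^ d, ?_⟩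
  rw [← ha, Units.smul_def, k.cvec_smul]

theorem Param.cmap_mk_eq_iff (k : Param n d) {z z' : Fin 2 → ℂ} (hz : z ≠ 0) (hz' : z' ≠ 0) :
    k.cmap (Projectivization.mk ℂ z hz) = k.cmap (Projectivization.mk ℂ z' hz') ↔
      ∃ c : ℂ, k.cvec z' = c • k.cvec z := by
  rw [cmap_mk, cmap_mk, eq_comm, Projectivization.mk_eq_mk_iff']
  simp only [eq_comm]

/-! ### Pinches: quadratic forms modulo which the curve is constant -/

/-- The `2 × 2` minors of `f` and `a` are divisible by `g`. -/
def Pinch {ι : Type*} (f : ι → MvPolynomial (Fin 2) ℂ) (g : MvPolynomial (Fin 2) ℂ) (a : ι → ℂ) :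
    Prop :=
  ∀ i j, g ∣ C (a i) * f j - C (a j) * f i

theorem Pinch.exists_smul {k : Param n d} {g : MvPolynomial (Fin 2) ℂ} {a : Fin (n + 1) → ℂ}
    (h : Pinch k.cpoly g a) (ha : a ≠ 0) {z : Fin 2 → ℂ} (hz : z ≠ 0) (hg : eval z g = 0) :
    ∃ c : ℂ, c ≠ 0 ∧ k.cvec z = c • a := by
  obtain ⟨i, hi⟩ := Function.ne_iff.mp ha
  have hi : a i ≠ 0 := hi
  have key : k.cvec z = (k.cvec z i / a i) • a := by
    funext j
    obtain ⟨u, hu⟩ := h i j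
    have := congrArg (eval z) hu
    simp only [map_sub, map_mul, eval_C, hg, zero_mul, ← k.cvec_apply] at this
    simp only [Pi.smul_apply, smul_eq_mul]
    field_simp
    linear_combination this
  refine ⟨_, ?_, key⟩
  intro h0
  rw [h0, zero_smul] at key
  exact k.cvec_ne_zero hz key

theorem Pinch.mono {ι : Type*} {f : ι → MvPolynomial (Fin 2) ℂ} {g g' : MvPolynomial (Fin 2) ℂ}
    {a : ι → ℂ} (h : Pinch f g a) (hg : g' ∣ g) : Pinch f g' a :=
  fun i j => hg.trans (h i j)

theorem Param.pinch_of_cvec_eq_smul (k : Param n d) {z z' : Fin 2 → ℂ} (hz : z ≠ 0) (hz' : z' ≠ 0)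
    (hzz : z 1 * z' 0 - z 0 * z' 1 ≠ 0) {a : Fin (n + 1) → ℂ} {c c' : ℂ} (h : k.cvec z = c • a)
    (h' : k.cvec z' = c' • a) : Pinch k.cpoly (lin z * lin z') a := by
  intro i j
  refine lin_mul_lin_dvd (((k.isHomogeneous_cpoly j).C_mul _).sub
    ((k.isHomogeneous_cpoly i).C_mul _)) hz hz' hzz ?_ ?_
  · simp only [map_sub, map_mul, eval_C, ← k.cvec_apply, h, Pi.smul_apply, smul_eq_mul]; ring
  · simp only [map_sub, map_mul, eval_C, ← k.cvec_apply, h', Pi.smul_apply, smul_eq_mul]; ring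

/-- By Euler's relation, which needs d ≠ 0, the span of the derivatives contains the point itself.
If it is at most one-dimensional, all derivatives are multiples of the point, and every minor
vanishes at z together with its derivatives. -/
theorem Param.pinch_of_not_immersion (k : Param n d) (hd : d ≠ 0) {z : Fin 2 → ℂ} (hz : z ≠ 0)
    (h : Module.finrank ℂ (Submodule.span ℂ (Set.range (k.cderiv z))) ≠ 2) :
    Pinch k.cpoly (lin z * lin z) (k.cvec z) := by
  set T := Submodule.span ℂ (Set.range (k.cderiv z)) with hT
  have hmem : ∀ a, k.cderiv z a ∈ T := fun a => Submodule.subset_span ⟨a, rfl⟩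
  have hv : k.cvec z ∈ T := by
    have hd' : (d : ℂ) ≠ 0 := by exact_mod_cast hd
    have := T.add_mem (T.smul_mem (z 0) (hmem 0)) (T.smul_mem (z 1) (hmem 1))
    rw [k.euler] at this
    exact (Submodule.smul_mem_iff _ hd').mp this
  have hle : Module.finrank ℂ T ≤ 1 := by
    have h2 : Set.finrank ℂ (Set.range (k.cderiv z)) ≤ 2 := by
      simpa using finrank_range_le_card (R := ℂ) (k.cderiv z)
    have h3 : Module.finrank ℂ T ≤ 2 := h2
    omega
  have hspan : Submodule.span ℂ {k.cvec z} = T := by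
    refine Submodule.eq_of_le_of_finrank_le ?_ ?_
    · rwa [Submodule.span_singleton_le_iff_mem]
    · rwa [finrank_span_singleton (k.cvec_ne_zero hz)]
  have hder : ∀ a, ∃ t : ℂ, t • k.cvec z = k.cderiv z a := fun a => by
    rw [← Submodule.mem_span_singleton, hspan]; exact hmem a
  intro i j
  set m := C (k.cvec z i) * k.cpoly j - C (k.cvec z j) * k.cpoly i with hm
  obtain ⟨d, rfl⟩ := Nat.exists_eq_succ_of_ne_zero hd
  have hmh : m.IsHomogeneous (d + 1) := ((k.isHomogeneous_cpoly j).C_mul _).sub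
    ((k.isHomogeneous_cpoly i).C_mul _)
  have hm0 : eval z m = 0 := by
    simp only [hm, map_sub, map_mul, eval_C, ← k.cvec_apply]; ring
  have hmd : ∀ a, eval z (pderiv a m) = 0 := by
    intro a
    obtain ⟨t, ht⟩ := hder a
    have hi : eval z (pderiv a (k.cpoly i)) = t * k.cvec z i := (congrFun ht i).symm
    have hj : eval z (pderiv a (k.cpoly j)) = t * k.cvec z j := (congrFun ht j).symm
    simp only [hm, map_sub, pderiv_C_mul, map_mul, eval_C, hi, hj]
    ring
  obtain ⟨u, hu, hmu⟩ := exists_eq_lin_mul hmh hz hm0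
  rw [hmu] at hmd ⊢
  refine mul_dvd_mul_left _ (lin_dvd hu hz ?_)
  -- At z the derivatives of `lin z * u` are z_1 u(z) and -z_0 u(z). Their vanishing with u(z) ≠ 0
  -- would force z = 0.
  by_contra hu0
  apply hz
  have h0 := hmd 0
  have h1 := hmd 1
  simp only [pderiv_mul, map_add, map_mul, eval_lin] at h0 h1
  have h0' : z 1 = 0 := by
    have : eval z (pderiv 0 (lin z)) = z 1 := by simp [lin, pderiv_X]
    rw [this] at h0
    have : z 1 * eval z u = 0 := by linear_combination h0
    exact (mul_eq_zero.mp this).resolve_right hu0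
  have h1' : z 0 = 0 := by
    have : eval z (pderiv 1 (lin z)) = -z 0 := by simp [lin, pderiv_X]
    rw [this] at h1
    have : z 0 * eval z u = 0 := by linear_combination -h1
    exact (mul_eq_zero.mp this).resolve_right hu0
  ext i; fin_cases i <;> simp [h0', h1']

/-- Differentiating minors with a double root at z shows that all derivatives there are multiples of
a. -/
theorem Param.not_immersion_of_pinch (k : Param n d) {z : Fin 2 → ℂ} {a : Fin (n + 1) → ℂ}
    (ha : a ≠ 0) (h : Pinch k.cpoly (lin z * lin z) a) :
    Module.finrank ℂ (Submodule.span ℂ (Set.range (k.cderiv z))) ≠ 2 := by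
  obtain ⟨i, hi⟩ := Function.ne_iff.mp ha
  have hi : a i ≠ 0 := hi
  have hle : Submodule.span ℂ (Set.range (k.cderiv z)) ≤ Submodule.span ℂ {a} := by
    rw [Submodule.span_le]
    rintro _ ⟨b, rfl⟩
    rw [SetLike.mem_coe, Submodule.mem_span_singleton]
    refine ⟨k.cderiv z b i / a i, ?_⟩
    funext j
    obtain ⟨u, hu⟩ := h i j
    have := congrArg (fun p => eval z (pderiv b p)) hu
    simp only [map_sub, map_mul, eval_C, pderiv_mul, pderiv_C, zero_mul, zero_add, map_add,
      eval_lin] at this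
    simp only [Pi.smul_apply, smul_eq_mul]
    field_simp
    unfold Param.cderiv
    linear_combination -this
  have := Submodule.finrank_mono hle
  rw [finrank_span_singleton ha] at this
  omega

theorem pinch_double {k : Param n d} {z z' : Fin 2 → ℂ} {a : Fin (n + 1) → ℂ}
    (hz : z ≠ 0) (h : Pinch k.cpoly (lin z * lin z') a)
    (hzz : z 1 * z' 0 - z 0 * z' 1 = 0) (hz' : z' ≠ 0) : Pinch k.cpoly (lin z * lin z) a := by
  obtain ⟨c, rfl⟩ := exists_smul_of_cross_eq_zero hz hzz
  refine h.mono ⟨C c, ?_⟩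
  rw [lin_smul]; ring

/-- A complex quadratic form is a product of two linear ones. Distinct factors correspond to a
failure of injectivity and equal ones to a failure of immersion, so a single divisibility condition
covers both. -/
theorem Param.isKnot_iff (k : Param n d) (hd : d ≠ 0) : k.IsKnot ↔
    ∀ (g : MvPolynomial (Fin 2) ℂ) (a : Fin (n + 1) → ℂ), g.IsHomogeneous 2 → g ≠ 0 → a ≠ 0 →
      ¬ Pinch k.cpoly g a := by
  constructor
  · rintro ⟨hinj, himm⟩ g a hg hg0 ha h
    obtain ⟨c, z, z', hc, hz, hz', rfl⟩ := exists_eq_lin_mul_lin hg hg0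
    replace h := h.mono (g' := lin z * lin z') (dvd_mul_left _ _)
    by_cases hzz : z 1 * z' 0 - z 0 * z' 1 = 0
    · refine k.not_immersion_of_pinch ha (pinch_double hz h hzz hz') ?_
      rw [← k.branchTangent_mk hz]
      exact himm _
    · obtain ⟨t, ht, h1⟩ := h.exists_smul ha hz (by simp [mul_comm])
      obtain ⟨t', ht', h2⟩ := h.exists_smul ha hz' (by simp [mul_comm])
      apply hzz
      rw [← mk_eq_mk_iff_cross hz hz']
      refine hinj ((k.cmap_mk_eq_iff hz hz').mpr ⟨t' / t, ?_⟩)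
      rw [h1, h2, smul_smul, div_mul_cancel₀ _ ht]
  · intro h
    constructor
    · intro P Q
      induction P with | h z hz
      induction Q with | h z' hz'
      rw [k.cmap_mk_eq_iff hz hz', mk_eq_mk_iff_cross hz hz']
      rintro ⟨c, hc⟩
      by_contra hzz
      exact h _ _ ((isHomogeneous_lin z).mul (isHomogeneous_lin z'))
        (mul_ne_zero (lin_ne_zero hz) (lin_ne_zero hz')) (k.cvec_ne_zero hz)
        (k.pinch_of_cvec_eq_smul hz hz' hzz (one_smul _ _).symm hc)
    · intro P
      induction P with | h z hz
      rw [k.branchTangent_mk hz]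
      by_contra h2
      exact h _ _ ((isHomogeneous_lin z).mul (isHomogeneous_lin z))
        (mul_ne_zero (lin_ne_zero hz) (lin_ne_zero hz)) (k.cvec_ne_zero hz)
        (k.pinch_of_not_immersion hd hz h2)

end ParamLemmas

end RationalKnot
end

noncomputable section

namespace RationalKnot

open MvPolynomial
open scoped LinearAlgebra.Projectivization

/-! ### Nodes in terms of pinches -/

theorem cross_eq_zero_trans {K : Type*} [Field K] {x z z' : Fin 2 → K} (hx : x ≠ 0)
    (h : x 1 * z 0 - x 0 * z 1 = 0) (h' : x 1 * z' 0 - x 0 * z' 1 = 0) :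
    z 1 * z' 0 - z 0 * z' 1 = 0 := by
  obtain ⟨c, rfl⟩ := exists_smul_of_cross_eq_zero hx h
  obtain ⟨c', rfl⟩ := exists_smul_of_cross_eq_zero hx h'
  simp only [Pi.smul_apply, smul_eq_mul]; ring

theorem cross_eq_zero_of_lin_mul_lin {x x' z z' : Fin 2 → ℂ} (hx : x ≠ 0) (hx' : x' ≠ 0)
    (hzz : z 1 * z' 0 - z 0 * z' 1 ≠ 0) {c : ℂ} (h : lin x * lin x' = C c * (lin z * lin z')) :
    (x 1 * z 0 - x 0 * z 1 = 0 ∧ x' 1 * z' 0 - x' 0 * z' 1 = 0) ∨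
      (x 1 * z' 0 - x 0 * z' 1 = 0 ∧ x' 1 * z 0 - x' 0 * z 1 = 0) := by
  have h1 : (x 1 * z 0 - x 0 * z 1) * (x' 1 * z 0 - x' 0 * z 1) = 0 := by
    have := congrArg (eval z) h
    simp only [map_mul, eval_lin, eval_C] at this
    linear_combination this
  have h2 : (x 1 * z' 0 - x 0 * z' 1) * (x' 1 * z' 0 - x' 0 * z' 1) = 0 := by
    have := congrArg (eval z') h
    simp only [map_mul, eval_lin, eval_C] at this
    linear_combination this
  rcases mul_eq_zero.mp h1 with h1 | h1
  · exact .inl ⟨h1, (mul_eq_zero.mp h2).resolve_left fun h2 => hzz (cross_eq_zero_trans hx h1 h2)⟩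
  · exact .inr ⟨(mul_eq_zero.mp h2).resolve_right fun h2 => hzz (cross_eq_zero_trans hx' h1 h2), h1⟩

variable {n d e : ℕ}

/-- The points `z` and `z'` are identified by the curve, and this is its only coincidence,
infinitesimal ones included. -/
structure IsNode (k : Param n d) (z z' : Fin 2 → ℂ) : Prop where
  left : z ≠ 0
  right : z' ≠ 0
  cross : z 1 * z' 0 - z 0 * z' 1 ≠ 0
  eq : ∃ c : ℂ, k.cvec z' = c • k.cvec z
  unique : ∀ (g : MvPolynomial (Fin 2) ℂ) (a : Fin (n + 1) → ℂ), g.IsHomogeneous 2 → g ≠ 0 →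
    a ≠ 0 → Pinch k.cpoly g a → ∃ c, g = C c * (lin z * lin z')

/-- The identified pair may be prescribed: by uniqueness it is the pair of the hypothesis. A pinch
with a double root contradicts immersion; one with distinct roots is this same pair. -/
theorem Param.HasExactlyOneDoublePoint.isNode {k : Param n d} (hk : k.HasExactlyOneDoublePoint)
    {z z' : Fin 2 → ℂ} (hz : z ≠ 0) (hz' : z' ≠ 0) (hzz : z 1 * z' 0 - z 0 * z' 1 ≠ 0)
    (heq : ∃ c : ℂ, k.cvec z' = c • k.cvec z) : IsNode k z z' ∧
      Submodule.span ℂ (Set.range (k.cderiv z)) ≠ Submodule.span ℂ (Set.range (k.cderiv z')) := by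
  obtain ⟨himm, P, Q, -, -, htan, huniq⟩ := hk
  have hs := huniq (.mk ℂ z hz) (.mk ℂ z' hz') (by rwa [ne_eq, mk_eq_mk_iff_cross])
    ((k.cmap_mk_eq_iff hz hz').mpr heq)
  rw [← hs] at huniq
  replace htan : k.branchTangent (.mk ℂ z hz) ≠ k.branchTangent (.mk ℂ z' hz') := by
    rcases Sym2.eq_iff.mp hs with ⟨h1, h2⟩ | ⟨h1, h2⟩
    · rwa [h1, h2]
    · rw [h1, h2]; exact htan.symm
  rw [k.branchTangent_mk, k.branchTangent_mk] at htan
  refine ⟨⟨hz, hz', hzz, heq, ?_⟩, htan⟩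
  intro g a hg hg0 ha h
  obtain ⟨c, x, x', hc, hx, hx', rfl⟩ := exists_eq_lin_mul_lin hg hg0
  replace h := h.mono (g' := lin x * lin x') (dvd_mul_left _ _)
  by_cases hxx : x 1 * x' 0 - x 0 * x' 1 = 0
  · refine absurd ?_ (k.not_immersion_of_pinch ha (pinch_double hx h hxx hx'))
    rw [← k.branchTangent_mk hx]
    exact himm _
  · obtain ⟨t, ht, h1⟩ := h.exists_smul ha hx (by simp [mul_comm])
    obtain ⟨t', ht', h2⟩ := h.exists_smul ha hx' (by simp [mul_comm])
    have := huniq (.mk ℂ x hx) (.mk ℂ x' hx') (by rwa [ne_eq, mk_eq_mk_iff_cross])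
      ((k.cmap_mk_eq_iff hx hx').mpr ⟨t' / t, by rw [h1, h2, smul_smul, div_mul_cancel₀ _ ht]⟩)
    rw [Sym2.eq_iff, mk_eq_mk_iff_cross, mk_eq_mk_iff_cross, mk_eq_mk_iff_cross,
      mk_eq_mk_iff_cross] at this
    rcases this with ⟨h3, h4⟩ | ⟨h3, h4⟩
    · obtain ⟨s, rfl⟩ := exists_smul_of_cross_eq_zero (x := x) hz (by linear_combination -h3)
      obtain ⟨s', rfl⟩ := exists_smul_of_cross_eq_zero (x := x') hz' (by linear_combination -h4)
      refine ⟨c * s * s', ?_⟩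
      simp only [lin_smul, C_mul]; ring
    · obtain ⟨s, rfl⟩ := exists_smul_of_cross_eq_zero (x := x) hz' (by linear_combination -h3)
      obtain ⟨s', rfl⟩ := exists_smul_of_cross_eq_zero (x := x') hz (by linear_combination -h4)
      refine ⟨c * s * s', ?_⟩
      simp only [lin_smul, C_mul]; ring

/-- For the converse, a point where immersion fails would give a pinch `lin x * lin x`. The square
cannot be a multiple of `lin z * lin z'`, as z and z' are different points. -/
theorem hasExactlyOneDoublePoint_iff (k : Param n d) (hd : d ≠ 0) :
    k.HasExactlyOneDoublePoint ↔ ∃ z z', IsNode k z z' ∧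
      Submodule.span ℂ (Set.range (k.cderiv z)) ≠ Submodule.span ℂ (Set.range (k.cderiv z')) := by
  constructor
  · intro hk
    obtain ⟨-, P, Q, hPQ, hmap, -⟩ := id hk
    induction P with | h z hz
    induction Q with | h z' hz'
    rw [k.cmap_mk_eq_iff] at hmap
    rw [ne_eq, mk_eq_mk_iff_cross] at hPQ
    exact ⟨z, z', hk.isNode hz hz' hPQ hmap⟩
  · rintro ⟨z, z', hn, htan⟩
    refine ⟨?_, .mk ℂ z hn.left, .mk ℂ z' hn.right, ?_, ?_, ?_, ?_⟩
    · intro P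
      induction P with | h x hx
      rw [k.branchTangent_mk hx]
      by_contra h2
      obtain ⟨c, hc⟩ := hn.unique _ _ ((isHomogeneous_lin x).mul (isHomogeneous_lin x))
        (mul_ne_zero (lin_ne_zero hx) (lin_ne_zero hx)) (k.cvec_ne_zero hx)
        (k.pinch_of_not_immersion hd hx h2)
      rcases cross_eq_zero_of_lin_mul_lin hx hx hn.cross hc with ⟨h3, h4⟩ | ⟨h3, h4⟩
      · exact hn.cross (cross_eq_zero_trans hx h3 h4)
      · exact hn.cross (cross_eq_zero_trans hx h4 h3)
    · rw [ne_eq, mk_eq_mk_iff_cross]; exact hn.cross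
    · rw [k.cmap_mk_eq_iff]; exact hn.eq
    · rwa [k.branchTangent_mk, k.branchTangent_mk]
    · intro P Q
      induction P with | h x hx
      induction Q with | h x' hx'
      rw [ne_eq, mk_eq_mk_iff_cross, k.cmap_mk_eq_iff]
      rintro hxx ⟨t, ht⟩
      obtain ⟨c, hc⟩ := hn.unique _ _ ((isHomogeneous_lin x).mul (isHomogeneous_lin x'))
        (mul_ne_zero (lin_ne_zero hx) (lin_ne_zero hx')) (k.cvec_ne_zero hx)
        (k.pinch_of_cvec_eq_smul hx hx' hxx (one_smul _ _).symm ht)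
      rw [Sym2.eq_iff, mk_eq_mk_iff_cross, mk_eq_mk_iff_cross, mk_eq_mk_iff_cross,
        mk_eq_mk_iff_cross]
      exact cross_eq_zero_of_lin_mul_lin hx hx' hn.cross hc

/-! ### Stereographic projection in terms of forms -/

/-- The curve `l` is the projection of `k` from its double point `p`: modulo `r`, the curve `k` is
`(0, q l)`, and the roots of `q` are the preimages of `p`. -/
structure Projects (k : Param 4 d) (l : Param 3 e) (p : Fin 5 → ℝ) (q : BinForm 2)
    (w : BinForm (e - 2)) (r : BinForm (e + 2)) : Prop where
  sphere : ∑ i : Fin 4, p i.succ ^ 2 = p 0 ^ 2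
  p_ne : p 0 ≠ 0
  plane : ∑ i, C (p (Fin.succ i)) * (l.1 i).toPoly = w.toPoly * q.toPoly
  conic : ∑ i, (l.1 i).toPoly ^ 2 = w.toPoly * r.toPoly
  zero : (k.1 0).toPoly = C (-(p 0 / 2)) * r.toPoly
  succ : ∀ i : Fin 4, (k.1 i.succ).toPoly = q.toPoly * (l.1 i).toPoly - C (p i.succ / 2) * r.toPoly
  coprime : ∀ z : Fin 2 → ℂ, z ≠ 0 → ¬ (q.cval z = 0 ∧ r.cval z = 0)
  roots : ∃ z z' : Fin 2 → ℂ, z ≠ 0 ∧ z' ≠ 0 ∧ z 1 * z' 0 - z 0 * z' 1 ≠ 0 ∧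
    q.cval z = 0 ∧ q.cval z' = 0

theorem exists_cx_eq_of_conj {σ : Type*} {h : MvPolynomial σ ℂ} (hh : map (starRingEnd ℂ) h = h) :
    ∃ q : MvPolynomial σ ℝ, cx q = h := by
  obtain ⟨a, b, rfl⟩ := exists_eq_cx_add h
  have hc : ∀ f : MvPolynomial σ ℝ, map (starRingEnd ℂ) (cx f) = cx f := by
    intro f
    have h : (starRingEnd ℂ).comp (algebraMap ℝ ℂ) = algebraMap ℝ ℂ := by ext x; simp
    rw [cx, map_map, h]
  simp only [map_add, map_mul, hc, map_C, Complex.conj_I, map_neg] at hh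
  have h2 : (2 : MvPolynomial σ ℂ) * (C Complex.I * cx b) = 0 := by linear_combination -hh
  refine ⟨a, ?_⟩
  rw [(mul_eq_zero.mp h2).resolve_left two_ne_zero, add_zero]

theorem map_conj_lin (z : Fin 2 → ℂ) :
    map (starRingEnd ℂ) (lin z) = lin fun i => starRingEnd ℂ (z i) := by
  simp [lin]

/-- Dividing by any nonzero coefficient makes the polynomial invariant under conjugation. -/
theorem exists_real_multiple {g : MvPolynomial (Fin 2) ℂ} (hg : g ≠ 0) {t : ℂ}
    (h : map (starRingEnd ℂ) g = C t * g) :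
    ∃ (c : ℂ) (q : MvPolynomial (Fin 2) ℝ), c ≠ 0 ∧ cx q = C c * g := by
  obtain ⟨m, hm⟩ := ne_zero_iff.mp hg
  have hm' : starRingEnd ℂ (coeff m g) = t * coeff m g := by
    rw [← coeff_map, h, coeff_C_mul]
  have ht : t ≠ 0 := by
    rintro rfl
    rw [zero_mul, map_eq_zero] at hm'
    exact hm hm'
  obtain ⟨q, hq⟩ := exists_cx_eq_of_conj (h := C (coeff m g)⁻¹ * g) (by
    rw [map_mul, map_C, h, map_inv₀, hm', ← mul_assoc, ← C_mul]
    congr 2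
    field_simp)
  exact ⟨_, q, inv_ne_zero hm, hq⟩

/-- The double point of a real curve is real, and so is the pair of its preimages. -/
theorem IsNode.exists_real {k : Param n d} {z z' : Fin 2 → ℂ} (hn : IsNode k z z') :
    (∃ (a : ℂ) (p : Fin (n + 1) → ℝ), a ≠ 0 ∧ p ≠ 0 ∧ k.cvec z = a • fun i => (p i : ℂ)) ∧
    ∃ (c : ℂ) (q : MvPolynomial (Fin 2) ℝ), c ≠ 0 ∧ cx q = C c * (lin z * lin z') := by
  obtain ⟨t, ht⟩ := hn.eq
  have hz := hn.left
  have hz' := hn.right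
  have conj_ne : ∀ {x : Fin 2 → ℂ}, x ≠ 0 → (fun i => starRingEnd ℂ (x i)) ≠ 0 := by
    intro x hx h
    apply hx
    funext i
    simpa using congrFun h i
  have hcross : starRingEnd ℂ (z 1) * starRingEnd ℂ (z' 0) -
      starRingEnd ℂ (z 0) * starRingEnd ℂ (z' 1) ≠ 0 := by
    intro h
    apply hn.cross
    rw [← map_mul, ← map_mul, ← map_sub, map_eq_zero] at h
    exact h
  have hconj : (fun i => starRingEnd ℂ (k.cvec z' i)) =
      starRingEnd ℂ t • fun i => starRingEnd ℂ (k.cvec z i) := by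
    funext i
    simp [ht]
  -- The curve is real, so it also identifies the conjugates of z and z'. By uniqueness of the pinch
  -- the two pairs agree.
  have hP := k.pinch_of_cvec_eq_smul (conj_ne hz) (conj_ne hz') hcross
    (a := fun i => starRingEnd ℂ (k.cvec z i)) (c := 1) (c' := starRingEnd ℂ t)
    (by funext i; rw [k.cvec_conj]; simp)
    (by rw [← hconj]; funext i; rw [k.cvec_conj])
  obtain ⟨c, hc⟩ := hn.unique _ _ ((isHomogeneous_lin _).mul (isHomogeneous_lin _))
    (mul_ne_zero (lin_ne_zero (conj_ne hz)) (lin_ne_zero (conj_ne hz')))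
    (by
      intro h
      apply k.cvec_ne_zero hz
      funext i
      simpa using congrFun h i) hP
  refine ⟨?_, exists_real_multiple (mul_ne_zero (lin_ne_zero hz) (lin_ne_zero hz'))
    (by rw [map_mul, map_conj_lin, map_conj_lin]; exact hc)⟩
  -- The conjugate of z represents the point z or the point z'. Both lie over the node, so the
  -- vector of the node is proportional to its conjugate.
  obtain ⟨s, hs⟩ : ∃ s : ℂ, k.cvec (fun i => starRingEnd ℂ (z i)) = s • k.cvec z := by
    rcases cross_eq_zero_of_lin_mul_lin (conj_ne hz) (conj_ne hz') hn.cross hc with ⟨h, -⟩ | ⟨h, -⟩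
    · obtain ⟨b, hb⟩ := exists_smul_of_cross_eq_zero (x := fun i => starRingEnd ℂ (z i)) hz
        (by linear_combination -h)
      exact ⟨b ^ d, by rw [hb, k.cvec_smul]⟩
    · obtain ⟨b, hb⟩ := exists_smul_of_cross_eq_zero (x := fun i => starRingEnd ℂ (z i)) hz'
        (by linear_combination -h)
      exact ⟨b ^ d * t, by rw [hb, k.cvec_smul, ht, smul_smul]⟩
  refine exists_real_of_conj_smul (k.cvec_ne_zero hz) (c := s) fun i => ?_
  rw [← k.cvec_conj, hs, Pi.smul_apply, smul_eq_mul]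

theorem sphere_of_cvec_eq {k : Param 4 d} (hs : k.InSphere) {z : Fin 2 → ℂ} {a : ℂ}
    {p : Fin 5 → ℝ} (ha : a ≠ 0) (h : k.cvec z = a • fun i => (p i : ℂ)) :
    ∑ i : Fin 4, p i.succ ^ 2 = p 0 ^ 2 := by
  have h1 := congrArg (fun f => eval z (cx f)) hs
  have h2 : ∀ i, eval z (cx (k.1 i).toPoly) = a * p i := fun i => by
    have := congrFun h i
    rwa [k.cvec_apply] at this
  simp only [cx, map_sum, map_pow] at h1
  simp only [cx] at h2
  simp only [h2, mul_pow, ← Finset.mul_sum] at h1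
  have h3 := mul_left_cancel₀ (pow_ne_zero 2 ha) h1
  exact_mod_cast h3

theorem ne_zero_of_sphere {p : Fin 5 → ℝ} (hs : ∑ i : Fin 4, p i.succ ^ 2 = p 0 ^ 2)
    (hp : p ≠ 0) :
    p 0 ≠ 0 := by
  intro h0
  apply hp
  rw [h0, zero_pow two_ne_zero, Finset.sum_eq_zero_iff_of_nonneg fun i _ => sq_nonneg _] at hs
  funext i
  refine Fin.cases h0 (fun j => ?_) i
  simpa using hs j (Finset.mem_univ j)

theorem pinch_of_dvd_sub {k : Param n d} {p : Fin (n + 1) → ℝ}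
    {g : MvPolynomial (Fin 2) ℂ}
    (h : ∀ j, g ∣ k.cpoly j - C (p j : ℂ) * k.cpoly 0) : Pinch k.cpoly g fun i => (p i : ℂ) := by
  intro i j
  have : C (p i : ℂ) * k.cpoly j - C (p j : ℂ) * k.cpoly i =
      C (p i : ℂ) * (k.cpoly j - C (p j : ℂ) * k.cpoly 0) -
      C (p j : ℂ) * (k.cpoly i - C (p i : ℂ) * k.cpoly 0) := by ring
  rw [this]
  exact dvd_sub ((h j).mul_left _) ((h i).mul_left _)

/-- Divide the projected coordinates by q, expand the equation of the sphere, and use that k_0 and q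
are coprime to split off w. -/
theorem IsNode.exists_projects (he : 2 ≤ e) (hd : d = e + 2) {k : Param 4 d} (hs : k.InSphere)
    {z z' : Fin 2 → ℂ} (hn : IsNode k z z') :
    ∃ (l : Param 3 e) (p : Fin 5 → ℝ) (q : BinForm 2) (w : BinForm (e - 2)) (r : BinForm (e + 2)),
      Projects k l p q w r ∧ p 0 = 1 := by
  subst hd
  have hz := hn.left
  have hz' := hn.right
  obtain ⟨t, ht⟩ := hn.eq
  obtain ⟨⟨a, p, ha, hp, hkp⟩, c, q, hc, hq⟩ := hn.exists_real
  have hp0 : p 0 ≠ 0 := ne_zero_of_sphere (sphere_of_cvec_eq hs ha hkp) hp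
  obtain ⟨a, p, ha, hp, hkp⟩ : ∃ (a : ℂ) (p : Fin 5 → ℝ), a ≠ 0 ∧ p 0 = 1 ∧
      k.cvec z = a • fun i => (p i : ℂ) := by
    have hp0' : (p 0 : ℂ) ≠ 0 := by exact_mod_cast hp0
    refine ⟨a * p 0, fun i => p i / p 0, mul_ne_zero ha hp0', div_self hp0, ?_⟩
    rw [hkp]
    funext i
    simp only [Pi.smul_apply, smul_eq_mul, Complex.ofReal_div]
    field_simp
  have hsph := sphere_of_cvec_eq hs ha hkp
  have hCc : IsUnit (C c : MvPolynomial (Fin 2) ℂ) := (isUnit_iff_ne_zero.mpr hc).map C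
  have hqz : ∀ x : Fin 2 → ℂ, eval x (cx q) = 0 →
      z 1 * x 0 - z 0 * x 1 = 0 ∨ z' 1 * x 0 - z' 0 * x 1 = 0 := by
    intro x hx
    rw [hq] at hx
    simpa [hc] using hx
  have hq0 : cx q ≠ 0 := by
    rw [hq]
    exact mul_ne_zero hCc.ne_zero (mul_ne_zero (lin_ne_zero hz) (lin_ne_zero hz'))
  have hq2 : q.IsHomogeneous 2 := by
    refine IsHomogeneous.of_map (algebraMap ℝ ℂ).injective (?_ : (cx q).IsHomogeneous 2)
    rw [hq]
    exact ((isHomogeneous_lin z).mul (isHomogeneous_lin z')).C_mul c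
  have hqR : q ≠ 0 := fun h => hq0 (by rw [h]; exact map_zero _)
  -- the projected coordinates are divisible by `q`
  have hy : ∀ i : Fin 4, ∃ m : MvPolynomial (Fin 2) ℝ, m.IsHomogeneous e ∧
      (k.1 i.succ).toPoly - C (p i.succ) * (k.1 0).toPoly = q * m := by
    intro i
    have hh : ((k.1 i.succ).toPoly - C (p i.succ) * (k.1 0).toPoly).IsHomogeneous (e + 2) :=
      (k.1 i.succ).isHomogeneous_toPoly.sub ((k.1 0).isHomogeneous_toPoly.C_mul _)
    have hev : ∀ x : Fin 2 → ℂ, (∃ b : ℂ, k.cvec x = b • fun i => (p i : ℂ)) →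
        eval x (cx ((k.1 i.succ).toPoly - C (p i.succ) * (k.1 0).toPoly)) = 0 := by
      rintro x ⟨b, hb⟩
      have h1 := congrFun hb i.succ
      have h2 := congrFun hb 0
      simp only [k.cvec_apply, Param.cpoly, BinForm.cpoly, Pi.smul_apply, smul_eq_mul, hp] at h1 h2
      simp only [cx, map_sub, map_mul, map_C, eval_C] at h1 h2 ⊢
      rw [h1, h2]
      simp only [Complex.coe_algebraMap, Complex.ofReal_one]
      ring
    have hdvd : q ∣ (k.1 i.succ).toPoly - C (p i.succ) * (k.1 0).toPoly := by
      apply dvd_of_cx_dvd_cx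
      rw [hq, hCc.mul_left_dvd]
      refine lin_mul_lin_dvd (hh.map _) hz hz' hn.cross (hev z ⟨a, hkp⟩)
        (hev z' ⟨t * a, ?_⟩)
      rw [ht, hkp, smul_smul]
    obtain ⟨m, hm⟩ := hdvd
    refine ⟨m, IsHomogeneous.of_mul hq2 hqR ?_, hm⟩
    rwa [← hm, add_comm 2]
  choose m hmh hm using hy
  have hsub : ∀ g : MvPolynomial (Fin 2) ℂ, (∀ i, g ∣ cx q * cx (m i)) →
      Pinch k.cpoly g fun i => (p i : ℂ) := by
    intro g hg
    refine pinch_of_dvd_sub fun j => ?_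
    refine Fin.cases ?_ (fun i => ?_) j
    · simp [hp]
    · have := congrArg cx (hm i)
      simp only [cx, map_sub, map_mul, map_C] at this hg
      simp only [Param.cpoly, BinForm.cpoly, cx]
      have h2 := hg i
      rw [← this] at h2
      exact h2
  have hpne : (fun i => (p i : ℂ)) ≠ 0 := fun h => by
    have := congrFun h 0
    simp [hp] at this
  -- At a common root x of the m_i, both `lin x * lin z` and `lin x * lin z'` would be pinches of k.
  -- Both would then be multiples of `lin z * lin z'`, so x would be z and z' at once.
  have hroot : ∀ x : Fin 2 → ℂ, x ≠ 0 → ∃ i, eval x (cx (m i)) ≠ 0 := by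
    intro x hx
    by_contra! h
    have hdvd : ∀ i, lin x ∣ cx (m i) := fun i => lin_dvd ((hmh i).map _) hx (h i)
    have h1 := hsub (lin x * lin z) fun i => by
      rw [mul_comm]
      refine mul_dvd_mul ?_ (hdvd i)
      rw [hq]
      exact ⟨C c * lin z', by ring⟩
    have h2 := hsub (lin x * lin z') fun i => by
      rw [mul_comm]
      refine mul_dvd_mul ?_ (hdvd i)
      rw [hq]
      exact ⟨C c * lin z, by ring⟩
    obtain ⟨c1, h1⟩ := hn.unique _ _ ((isHomogeneous_lin x).mul (isHomogeneous_lin z))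
      (mul_ne_zero (lin_ne_zero hx) (lin_ne_zero hz)) hpne h1
    obtain ⟨c2, h2⟩ := hn.unique _ _ ((isHomogeneous_lin x).mul (isHomogeneous_lin z'))
      (mul_ne_zero (lin_ne_zero hx) (lin_ne_zero hz')) hpne h2
    have h3 : x 1 * z' 0 - x 0 * z' 1 = 0 := by
      rcases cross_eq_zero_of_lin_mul_lin hx hz hn.cross h1 with ⟨-, h⟩ | ⟨h, -⟩
      · exact absurd h hn.cross
      · exact h
    have h4 : x 1 * z 0 - x 0 * z 1 = 0 := by
      rcases cross_eq_zero_of_lin_mul_lin hx hz' hn.cross h2 with ⟨h, -⟩ | ⟨-, h⟩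
      · exact h
      · exact absurd (by linear_combination -h) hn.cross
    exact hn.cross (cross_eq_zero_trans hx h4 h3)
  have hk0 : ∀ x : Fin 2 → ℂ, x ≠ 0 → eval x (cx q) = 0 → eval x (k.cpoly 0) ≠ 0 := by
    intro x hx hqx
    obtain ⟨b, hb, h⟩ : ∃ b : ℂ, b ≠ 0 ∧ k.cvec x = b • fun i => (p i : ℂ) := by
      obtain ⟨b, h⟩ : ∃ b : ℂ, k.cvec x = b • fun i => (p i : ℂ) := by
        rcases hqz x hqx with h | h
        · obtain ⟨s, rfl⟩ := exists_smul_of_cross_eq_zero hz h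
          exact ⟨s ^ (e + 2) * a, by rw [k.cvec_smul, hkp, smul_smul]⟩
        · obtain ⟨s, rfl⟩ := exists_smul_of_cross_eq_zero hz' h
          exact ⟨s ^ (e + 2) * t * a, by rw [k.cvec_smul, ht, hkp, smul_smul, smul_smul, mul_assoc]⟩
      refine ⟨b, ?_, h⟩
      rintro rfl
      exact k.cvec_ne_zero hx (by rw [h, zero_smul])
    rw [← k.cvec_apply, h]
    simpa [hp] using hb
  -- the identity between the forms
  have hid : q * ∑ i, m i ^ 2 = -(2 * (k.1 0).toPoly * ∑ i, C (p (Fin.succ i)) * m i) := by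
    apply mul_left_cancel₀ hqR
    have e1 : q * (q * ∑ i, m i ^ 2) =
        ∑ i, ((k.1 (Fin.succ i)).toPoly - C (p (Fin.succ i)) * (k.1 0).toPoly) ^ 2 := by
      simp_rw [hm, Finset.mul_sum]
      exact Finset.sum_congr rfl fun i _ => by ring
    have e2 : q * -(2 * (k.1 0).toPoly * ∑ i, C (p (Fin.succ i)) * m i) =
        -(2 * (k.1 0).toPoly * ∑ i, C (p (Fin.succ i)) *
          ((k.1 (Fin.succ i)).toPoly - C (p (Fin.succ i)) * (k.1 0).toPoly)) := by
      simp_rw [hm, Finset.mul_sum, mul_neg, Finset.mul_sum]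
      congr 1
      exact Finset.sum_congr rfl fun i _ => by ring
    rw [e1, e2]
    have h1 : ∑ i : Fin 4, (k.1 i.succ).toPoly ^ 2 = (k.1 0).toPoly ^ 2 := hs
    have h2 : ∑ i : Fin 4, C (σ := Fin 2) (p i.succ) ^ 2 = 1 := by
      simp_rw [← map_pow, ← map_sum, hsph, hp]
      simp
    simp only [Fin.sum_univ_four] at h1 h2 ⊢
    linear_combination h1 - (k.1 0).toPoly ^ 2 * h2
  have hrel : IsRelPrime (cx q) (k.cpoly 0) :=
    isRelPrime_of_no_common_root (hq2.map _) hq0 hk0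
  have hpm : (∑ i, C (p (Fin.succ i)) * m i).IsHomogeneous (2 + (e - 2)) := by
    rw [Nat.add_sub_cancel' he]
    exact IsHomogeneous.sum _ _ _ fun i _ => (hmh i).C_mul _
  -- By `hid`, q divides k_0 Σ p_i m_i, and q is coprime to k_0.
  obtain ⟨W, hW⟩ : q ∣ ∑ i, C (p (Fin.succ i)) * m i := by
    apply dvd_of_cx_dvd_cx
    refine hrel.dvd_of_dvd_mul_left (?_ : cx q ∣ k.cpoly 0 * _)
    have h2 : IsUnit (C (-2 : ℂ) : MvPolynomial (Fin 2) ℂ) := (by norm_num : IsUnit (-2 : ℂ)).map C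
    rw [← h2.dvd_mul_left]
    have := congrArg cx hid
    refine ⟨cx (∑ i, m i ^ 2), ?_⟩
    rw [cx, map_mul] at this
    rw [cx, this]
    simp only [Param.cpoly, BinForm.cpoly, cx, map_neg, map_mul, map_ofNat]
    ring
  have hWh : W.IsHomogeneous (e - 2) := IsHomogeneous.of_mul hq2 hqR (by rwa [← hW])
  have hrh : (C (-2) * (k.1 0).toPoly).IsHomogeneous (e + 2) :=
    (k.1 0).isHomogeneous_toPoly.C_mul _
  have hlp : ∀ i, (ofPoly e (m i)).toPoly = m i := fun i => toPoly_ofPoly (hmh i)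
  -- With p_0 = 1 the requirement k_0 = -(p_0/2) r forces r = -2 k_0.
  refine ⟨⟨fun i => ofPoly e (m i), fun x hx => ?_⟩, p, ofPoly 2 q, ofPoly (e - 2) W,
    ofPoly (e + 2) (C (-2) * (k.1 0).toPoly), ⟨hsph, by simp [hp], ?_, ?_, ?_, ?_, ?_, ?_⟩, hp⟩
  · obtain ⟨i, hi⟩ := hroot x hx
    exact ⟨i, by rwa [BinForm.cval_eq, BinForm.cpoly, hlp]⟩
  · simp only [hlp, toPoly_ofPoly hq2, toPoly_ofPoly hWh]
    rw [hW, mul_comm]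
  · simp only [hlp, toPoly_ofPoly hWh, toPoly_ofPoly hrh]
    apply mul_left_cancel₀ hqR
    rw [hid, hW]
    simp only [map_neg, map_ofNat]
    ring
  · rw [toPoly_ofPoly hrh, hp, ← mul_assoc, ← C_mul]
    norm_num
  · intro i
    simp only [hlp, toPoly_ofPoly hrh, toPoly_ofPoly hq2, ← hm]
    have : C (p i.succ) = C (σ := Fin 2) (p i.succ / 2) * C 2 := by rw [← C_mul]; congr 1; ring
    rw [this]
    simp only [map_neg, map_ofNat]
    ring
  · rintro x hx ⟨h1, h2⟩
    rw [BinForm.cval_eq, BinForm.cpoly, toPoly_ofPoly hq2] at h1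
    rw [BinForm.cval_eq, BinForm.cpoly, toPoly_ofPoly hrh] at h2
    refine hk0 x hx h1 ?_
    simp only [cx, map_mul, map_C, eval_C] at h2
    exact (mul_eq_zero.mp h2).resolve_left (by norm_num)
  · refine ⟨z, z', hz, hz', hn.cross, ?_, ?_⟩ <;>
    · rw [BinForm.cval_eq, BinForm.cpoly, toPoly_ofPoly hq2, hq]
      simp [mul_comm]

end RationalKnot
end

/-! ### The nodal curve attached to a knot -/

noncomputable section

namespace RationalKnot

open MvPolynomial
open scoped LinearAlgebra.Projectivization

variable {d e : ℕ}

/-- At a root x of g some coordinate of l is nonzero, so f vanishes at x. The common factor `lin x`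
is cancelled and the argument repeated. -/
theorem dvd_of_forall_dvd_mul {n m : ℕ} (l : Param n e) {g : MvPolynomial (Fin 2) ℂ}
    (hg : g.IsHomogeneous m) (hg0 : g ≠ 0) {N : ℕ} {f : MvPolynomial (Fin 2) ℂ}
    (hf : f.IsHomogeneous N) (h : ∀ i, g ∣ f * l.cpoly i) : g ∣ f := by
  induction m generalizing g f N with
  | zero =>
    obtain ⟨c, rfl⟩ := eq_C_of_isHomogeneous_zero hg
    have hc : c ≠ 0 := fun hc => hg0 (by simp [hc])
    exact ((isUnit_iff_ne_zero.mpr hc).map C).dvd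
  | succ m ih =>
    obtain ⟨x, hx, hgx⟩ := exists_root hg
    obtain ⟨g, hg', rfl⟩ := exists_eq_lin_mul hg hx hgx
    have hfx : eval x f = 0 := by
      obtain ⟨i, hi⟩ := Function.ne_iff.mp (l.cvec_ne_zero hx)
      obtain ⟨u, hu⟩ := h i
      have := congrArg (eval x) hu
      rw [map_mul, map_mul, map_mul, eval_lin, ← l.cvec_apply] at this
      have h2 : eval x f * l.cvec x i = 0 := by linear_combination this
      exact (mul_eq_zero.mp h2).resolve_right hi
    cases N with
    | zero =>
      obtain ⟨c, rfl⟩ := eq_C_of_isHomogeneous_zero hf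
      rw [eval_C] at hfx
      simp [hfx]
    | succ N =>
      obtain ⟨f, hf', rfl⟩ := exists_eq_lin_mul hf hx hfx
      refine mul_dvd_mul_left _ (ih hg' (right_ne_zero_of_mul hg0) hf' fun i => ?_)
      rw [← mul_dvd_mul_iff_left (lin_ne_zero hx), ← mul_assoc]
      exact h i

/-- The positive degree of r matters: r has a root, and q = 0 would vanish there too. -/
theorem cpoly_ne_zero_of_coprime {m : ℕ} {q : BinForm 2} {r : BinForm (m + 1)}
    (h : ∀ z : Fin 2 → ℂ, z ≠ 0 → ¬ (q.cval z = 0 ∧ r.cval z = 0)) : q.cpoly ≠ 0 := by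
  intro hq
  obtain ⟨z, hz, hr⟩ := exists_root r.isHomogeneous_cpoly
  exact h z hz ⟨by rw [BinForm.cval_eq, hq, map_zero], by rw [BinForm.cval_eq, hr]⟩

theorem Param.sum_sq_ne_zero {n : ℕ} (l : Param n e) {x : Fin 2 → ℝ} (hx : x ≠ 0) :
    ∑ i, l.rvec x i ^ 2 ≠ 0 := by
  intro h
  rw [Finset.sum_eq_zero_iff_of_nonneg fun i _ => sq_nonneg _] at h
  refine l.cvec_ne_zero (z := fun j => (x j : ℂ)) ?_ ?_
  · intro h0
    apply hx
    funext j
    simpa using congrFun h0 j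
  · funext i
    rw [l.cvec_ofReal]
    have := h i (Finset.mem_univ i)
    simpa using this

namespace Projects

variable {k : Param 4 d} {l : Param 3 e} {p : Fin 5 → ℝ} {q : BinForm 2}
  {w : BinForm (e - 2)} {r : BinForm (e + 2)}

theorem p_ne_zero (h : Projects k l p q w r) : (fun i => (p i : ℂ)) ≠ 0 := fun h0 => by
  have := congrFun h0 0
  simp [h.p_ne] at this

theorem q_ne_zero (h : Projects k l p q w r) : q.cpoly ≠ 0 := cpoly_ne_zero_of_coprime h.coprime

theorem cpoly_zero (h : Projects k l p q w r) : k.cpoly 0 = C (-(p 0 / 2 : ℂ)) * r.cpoly := by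
  have := congrArg cx h.zero
  simp only [cx, map_mul, map_C, Complex.coe_algebraMap, Complex.ofReal_neg, Complex.ofReal_div,
    Complex.ofReal_ofNat] at this
  exact this

theorem cpoly_succ (h : Projects k l p q w r) (i : Fin 4) :
    k.cpoly i.succ = q.cpoly * l.cpoly i - C (p i.succ / 2 : ℂ) * r.cpoly := by
  have := congrArg cx (h.succ i)
  simp only [cx, map_sub, map_mul, map_C, Complex.coe_algebraMap, Complex.ofReal_div,
    Complex.ofReal_ofNat] at this
  exact this

theorem cpoly_plane (h : Projects k l p q w r) :
    ∑ i, C (p (Fin.succ i) : ℂ) * l.cpoly i = w.cpoly * q.cpoly := by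
  have := congrArg cx h.plane
  simp only [cx, map_sum, map_mul, map_C, Complex.coe_algebraMap] at this
  exact this

theorem cpoly_conic (h : Projects k l p q w r) :
    ∑ i, l.cpoly i ^ 2 = w.cpoly * r.cpoly := by
  have := congrArg cx h.conic
  simp only [cx, map_sum, map_mul, map_pow] at this
  exact this

/-- The coordinates of the projection of `k` from `p`. -/
theorem project (h : Projects k l p q w r) (i : Fin 4) :
    C (p 0 : ℂ) * k.cpoly i.succ - C (p i.succ : ℂ) * k.cpoly 0 =
      C (p 0 : ℂ) * (q.cpoly * l.cpoly i) := by
  rw [h.cpoly_zero, h.cpoly_succ]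
  have : ∀ x y : ℂ, C (σ := Fin 2) x * C (y / 2) = C y * C (x / 2) := fun x y => by
    rw [← C_mul, ← C_mul]; congr 1; ring
  rw [map_neg]
  linear_combination -r.cpoly * this (p 0) (p i.succ)

/-- At a real parameter Σ l_i² is a nonzero sum of real squares. -/
theorem w_ne_zero (h : Projects k l p q w r) : w.cpoly ≠ 0 := by
  intro hw
  apply l.sum_sq_ne_zero (x := ![1, 0]) fun h0 => by simpa using congrFun h0 0
  have h1 := congrArg (eval fun i => ((![1, 0] i : ℝ) : ℂ)) h.cpoly_conic
  simp only [hw, zero_mul, map_zero, map_sum, map_pow, ← l.cvec_apply, l.cvec_ofReal] at h1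
  exact_mod_cast h1

theorem cvec_root (h : Projects k l p q w r) {z : Fin 2 → ℂ} (hq : q.cval z = 0) :
    k.cvec z = (-(r.cval z / 2)) • fun i => (p i : ℂ) := by
  rw [BinForm.cval_eq] at hq
  funext j
  rw [k.cvec_apply, BinForm.cval_eq]
  refine Fin.cases ?_ (fun i => ?_) j
  · rw [h.cpoly_zero]
    simp only [map_mul, eval_C, Pi.smul_apply, smul_eq_mul]; ring
  · rw [h.cpoly_succ]
    simp only [map_sub, map_mul, eval_C, hq, Pi.smul_apply, smul_eq_mul]; ring

theorem r_ne_zero (h : Projects k l p q w r) {z : Fin 2 → ℂ} (hz : z ≠ 0) (hq : q.cval z = 0) :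
    r.cval z ≠ 0 := fun hr => h.coprime z hz ⟨hq, hr⟩

theorem cvec_root_eq_smul (h : Projects k l p q w r) {z z' : Fin 2 → ℂ} (hz : z ≠ 0)
    (hq : q.cval z = 0) (hq' : q.cval z' = 0) : ∃ c : ℂ, k.cvec z' = c • k.cvec z := by
  have := h.r_ne_zero hz hq
  refine ⟨r.cval z' / r.cval z, ?_⟩
  rw [h.cvec_root hq, h.cvec_root hq', smul_smul]
  congr 1
  field_simp

theorem q_eq (h : Projects k l p q w r) {z z' : Fin 2 → ℂ} (hz : z ≠ 0) (hz' : z' ≠ 0)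
    (hzz : z 1 * z' 0 - z 0 * z' 1 ≠ 0) (hq : q.cval z = 0) (hq' : q.cval z' = 0) :
    ∃ c : ℂ, c ≠ 0 ∧ q.cpoly = C c * (lin z * lin z') := by
  rw [BinForm.cval_eq] at hq hq'
  obtain ⟨c, hc⟩ := exists_C_mul_of_dvd ((isHomogeneous_lin z).mul (isHomogeneous_lin z'))
    (mul_ne_zero (lin_ne_zero hz) (lin_ne_zero hz')) q.isHomogeneous_cpoly
    (lin_mul_lin_dvd q.isHomogeneous_cpoly hz hz' hzz hq hq')
  refine ⟨c, ?_, hc⟩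
  rintro rfl
  exact h.q_ne_zero (by rw [hc]; simp)

theorem isDoublePoint (h : Projects k l p q w r) : k.IsDoublePoint p := by
  obtain ⟨z, z', hz, hz', hzz, hq, hq'⟩ := h.roots
  refine ⟨fun h0 => h.p_ne (by rw [h0]; rfl), .mk ℂ z hz, .mk ℂ z' hz', ?_, ?_, ?_⟩
  · rwa [ne_eq, mk_eq_mk_iff_cross]
  · rw [k.cmap_mk_eq_iff]; exact h.cvec_root_eq_smul hz hq hq'
  · obtain ⟨a, ha⟩ := Projectivization.exists_smul_eq_mk_rep ℂ z hz
    refine ⟨(a : ℂ) ^ d * (-(r.cval z / 2)), ?_⟩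
    rw [← ha, Units.smul_def, k.cvec_smul, h.cvec_root hq, smul_smul]

/-- Let g be a pinch of k at a, and project from p: the curve q l is proportional to the image of a
modulo g. If a is a multiple of p, this image is zero, so g divides all q l_i and hence q. Otherwise
g is coprime to q and would be a pinch of the knot l. -/
theorem isNode (h : Projects k l p q w r) (he : e ≠ 0) (hl : l.IsKnot) {z z' : Fin 2 → ℂ}
    (hz : z ≠ 0) (hz' : z' ≠ 0) (hzz : z 1 * z' 0 - z 0 * z' 1 ≠ 0) (hq : q.cval z = 0)
    (hq' : q.cval z' = 0) : IsNode k z z' := by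
  refine ⟨hz, hz', hzz, h.cvec_root_eq_smul hz hq hq', fun g a hg hg0 ha hP => ?_⟩
  obtain ⟨c, hc, hqc⟩ := h.q_eq hz hz' hzz hq hq'
  have hCp : IsUnit (C (p 0 : ℂ) : MvPolynomial (Fin 2) ℂ) :=
    (isUnit_iff_ne_zero.mpr (by exact_mod_cast h.p_ne)).map C
  -- The minors of the projected curve are combinations of minors of k.
  have hcomb : ∀ i j : Fin 4, g ∣ C (p 0 : ℂ) *
      ((C ((p 0 : ℂ) * a i.succ - a 0 * p i.succ) * (q.cpoly * l.cpoly j)) -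
        C ((p 0 : ℂ) * a j.succ - a 0 * p j.succ) * (q.cpoly * l.cpoly i)) := by
    intro i j
    have : C (p 0 : ℂ) *
      ((C ((p 0 : ℂ) * a i.succ - a 0 * p i.succ) * (q.cpoly * l.cpoly j)) -
        C ((p 0 : ℂ) * a j.succ - a 0 * p j.succ) * (q.cpoly * l.cpoly i)) =
      C (p 0 : ℂ) * (C (p 0 : ℂ) * (C (a i.succ) * k.cpoly j.succ - C (a j.succ) * k.cpoly i.succ)
        - C (p j.succ : ℂ) * (C (a i.succ) * k.cpoly 0 - C (a 0) * k.cpoly i.succ)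
        + C (p i.succ : ℂ) * (C (a j.succ) * k.cpoly 0 - C (a 0) * k.cpoly j.succ)) := by
      simp only [map_sub, map_mul]
      linear_combination (-(C (p 0 : ℂ) * C (a i.succ) - C (a 0) * C (p i.succ : ℂ))) * h.project j
        + (C (p 0 : ℂ) * C (a j.succ) - C (a 0) * C (p j.succ : ℂ)) * h.project i
    rw [this]
    exact (((hP _ _).mul_left _).sub ((hP _ _).mul_left _)).add ((hP _ _).mul_left _)
      |>.mul_left _
  by_cases hpa : ∀ i : Fin 4, (p 0 : ℂ) * a i.succ - a 0 * p i.succ = 0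
  · have ha0 : a 0 ≠ 0 := by
      intro h0
      apply ha
      funext j
      refine Fin.cases h0 (fun i => ?_) j
      have := hpa i
      rw [h0, zero_mul, sub_zero] at this
      exact (mul_eq_zero.mp this).resolve_left (by exact_mod_cast h.p_ne)
    have hdvd : g ∣ q.cpoly := by
      refine dvd_of_forall_dvd_mul l hg hg0 q.isHomogeneous_cpoly fun i => ?_
      have hu : IsUnit (C (a 0) * C (p 0 : ℂ) : MvPolynomial (Fin 2) ℂ) :=
        ((isUnit_iff_ne_zero.mpr ha0).map C).mul hCp
      rw [← hu.dvd_mul_left]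
      have : C (a 0) * C (p 0 : ℂ) * (q.cpoly * l.cpoly i) =
          C (p 0 : ℂ) * (C (a 0) * k.cpoly i.succ - C (a i.succ) * k.cpoly 0) := by
        have h1 : C (p 0 : ℂ) * C (a i.succ) - C (a 0) * C (p i.succ : ℂ) =
            (0 : MvPolynomial (Fin 2) ℂ) := by
          rw [← C_mul, ← C_mul, ← C_sub, hpa i, C_0]
        linear_combination k.cpoly 0 * h1 - C (a 0) * h.project i
      rw [this]
      exact (hP _ _).mul_left _
    obtain ⟨t, ht⟩ := exists_C_mul_of_dvd hg hg0 q.isHomogeneous_cpoly hdvd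
    have ht0 : t ≠ 0 := by
      rintro rfl
      exact h.q_ne_zero (by rw [ht]; simp)
    refine ⟨t⁻¹ * c, ?_⟩
    rw [C_mul, mul_assoc, ← hqc, ht, ← mul_assoc, ← C_mul, inv_mul_cancel₀ ht0, C_1, one_mul]
  · exfalso
    -- A common root of g and q is sent both to a and to p, which would make a proportional to p.
    have hrel : IsRelPrime g q.cpoly := by
      refine isRelPrime_of_no_common_root hg hg0 fun x hx hgx hqx => hpa fun i => ?_
      obtain ⟨s, hs, hs'⟩ := hP.exists_smul ha hx hgx
      have h2 := h.cvec_root (by rwa [BinForm.cval_eq])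
      rw [hs'] at h2
      have h3 := congrFun h2 0
      have h4 := congrFun h2 i.succ
      simp only [Pi.smul_apply, smul_eq_mul] at h3 h4
      apply mul_left_cancel₀ hs
      linear_combination (p 0 : ℂ) * h4 - (p i.succ : ℂ) * h3
    refine (l.isKnot_iff he).mp hl g (fun i => (p 0 : ℂ) * a i.succ - a 0 * p i.succ) hg hg0 ?_ ?_
    · intro h0
      exact hpa fun i => congrFun h0 i
    · intro i j
      refine hrel.dvd_of_dvd_mul_left ?_
      have := (hCp.dvd_mul_left).mp (hcomb i j)
      convert this using 1
      ring

/-- At a root of q the product rule gives dk = dq · (0, l) - (dr/2) p. The vector p itself comes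
from Euler's relation, since r does not vanish there. -/
theorem span_cderiv (h : Projects k l p q w r) (hd : d ≠ 0) {z z' : Fin 2 → ℂ}
    (hz : z ≠ 0) (hz' : z' ≠ 0) (hzz : z 1 * z' 0 - z 0 * z' 1 ≠ 0) (hq : q.cval z = 0)
    (hq' : q.cval z' = 0) : Submodule.span ℂ (Set.range (k.cderiv z)) =
      Submodule.span ℂ {Fin.cons 0 (l.cvec z), fun i => (p i : ℂ)} := by
  obtain ⟨c, hc, hqc⟩ := h.q_eq hz hz' hzz hq hq'
  have hq0 := hq
  rw [BinForm.cval_eq] at hq0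
  have hder : ∀ b, k.cderiv z b = eval z (pderiv b q.cpoly) • Fin.cons 0 (l.cvec z) +
      (-(eval z (pderiv b r.cpoly) / 2)) • fun i => (p i : ℂ) := by
    intro b
    funext j
    unfold Param.cderiv
    refine Fin.cases ?_ (fun i => ?_) j
    · rw [h.cpoly_zero]
      simp only [pderiv_C_mul, map_mul, eval_C, Pi.add_apply, Pi.smul_apply, Fin.cons_zero,
        smul_eq_mul]
      ring
    · rw [h.cpoly_succ]
      simp only [map_sub, pderiv_mul, pderiv_C, map_mul, map_add, eval_C, Pi.add_apply, hq0,
        Pi.smul_apply, Fin.cons_succ, smul_eq_mul, ← l.cvec_apply, map_zero]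
      ring
  apply le_antisymm
  · rw [Submodule.span_le]
    rintro _ ⟨b, rfl⟩
    rw [SetLike.mem_coe, Submodule.mem_span_pair, hder]
    exact ⟨_, _, rfl⟩
  · set T := Submodule.span ℂ (Set.range (k.cderiv z))
    have hmem : ∀ b, k.cderiv z b ∈ T := fun b => Submodule.subset_span ⟨b, rfl⟩
    have hp : (fun i => (p i : ℂ)) ∈ T := by
      have h1 := T.add_mem (T.smul_mem (z 0) (hmem 0)) (T.smul_mem (z 1) (hmem 1))
      rw [k.euler, h.cvec_root hq, smul_smul] at h1
      refine (Submodule.smul_mem_iff _ (mul_ne_zero (by exact_mod_cast hd) ?_)).mp h1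
      exact neg_ne_zero.mpr (div_ne_zero (h.r_ne_zero hz hq) two_ne_zero)
    rw [Submodule.span_le, Set.insert_subset_iff, Set.singleton_subset_iff]
    refine ⟨?_, hp⟩
    -- The two roots of q are different, so z is a simple root and q has a nonzero derivative there.
    obtain ⟨b, hb⟩ : ∃ b, eval z (pderiv b q.cpoly) ≠ 0 := by
      by_contra! h0
      have h1 := h0 0
      have h2 := h0 1
      have e0 : eval z (pderiv 0 (lin z)) = z 1 := by simp [lin, pderiv_X]
      have e1 : eval z (pderiv 1 (lin z)) = -z 0 := by simp [lin, pderiv_X]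
      rw [hqc, pderiv_C_mul, map_mul, eval_C, pderiv_mul, map_add, map_mul, map_mul, eval_lin,
        eval_lin] at h1 h2
      rw [e0] at h1
      rw [e1] at h2
      have h1' : z 1 * (c * (z' 1 * z 0 - z' 0 * z 1)) = 0 := by linear_combination h1
      have h2' : z 0 * (c * (z' 1 * z 0 - z' 0 * z 1)) = 0 := by linear_combination -h2
      have hne : c * (z' 1 * z 0 - z' 0 * z 1) ≠ 0 :=
        mul_ne_zero hc fun h => hzz (by linear_combination -h)
      apply hz
      ext i; fin_cases i
      · exact (mul_eq_zero.mp h2').resolve_right hne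
      · exact (mul_eq_zero.mp h1').resolve_right hne
    rw [SetLike.mem_coe, ← Submodule.smul_mem_iff _ hb]
    have := T.sub_mem (hmem b) (T.smul_mem (-(eval z (pderiv b r.cpoly) / 2)) hp)
    rwa [hder, add_sub_cancel_right] at this

/-- The tangent lines at the node are spanned by p and by (0, l(z)), (0, l(z')) respectively. As p_0
≠ 0, their equality would make l(z) and l(z') proportional. -/
theorem span_cderiv_ne (h : Projects k l p q w r) (hd : d ≠ 0) (hl : l.IsKnot) {z z' : Fin 2 → ℂ}
    (hz : z ≠ 0) (hz' : z' ≠ 0) (hzz : z 1 * z' 0 - z 0 * z' 1 ≠ 0) (hq : q.cval z = 0)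
    (hq' : q.cval z' = 0) :
    Submodule.span ℂ (Set.range (k.cderiv z)) ≠ Submodule.span ℂ (Set.range (k.cderiv z')) := by
  rw [h.span_cderiv hd hz hz' hzz hq hq',
    h.span_cderiv hd hz' hz (fun h => hzz (by linear_combination -h)) hq' hq]
  intro heq
  have hm : Fin.cons 0 (l.cvec z') ∈
      Submodule.span ℂ {Fin.cons 0 (l.cvec z), fun i => (p i : ℂ)} := by
    rw [heq]; exact Submodule.subset_span (by simp)
  obtain ⟨a, b, hab⟩ := Submodule.mem_span_pair.mp hm
  have hb : b = 0 := by
    have := congrFun hab 0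
    simp only [Pi.add_apply, Pi.smul_apply, Fin.cons_zero, smul_eq_mul, mul_zero, zero_add] at this
    exact (mul_eq_zero.mp this).resolve_right (by exact_mod_cast h.p_ne)
  refine hzz ((mk_eq_mk_iff_cross hz hz').mp (hl.1 ((l.cmap_mk_eq_iff hz hz').mpr ⟨a, ?_⟩)))
  funext i
  have := congrFun hab i.succ
  simp only [hb, zero_smul, add_zero, Pi.smul_apply, Fin.cons_succ] at this
  exact this.symm

theorem hasExactlyOneDoublePoint (h : Projects k l p q w r) (he : e ≠ 0) (hd : d ≠ 0)
    (hl : l.IsKnot) : k.HasExactlyOneDoublePoint := by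
  obtain ⟨z, z', hz, hz', hzz, hq, hq'⟩ := h.roots
  exact (hasExactlyOneDoublePoint_iff k hd).mpr
    ⟨z, z', h.isNode he hl hz hz' hzz hq hq', h.span_cderiv_ne hd hl hz hz' hzz hq hq'⟩

/-- Expanding Σ (q l_i - (p_i/2) r)², the terms q² w r and -q r (w q) cancel, and (p_0²/4) r²
remains. -/
theorem inSphere (h : Projects k l p q w r) : k.InSphere := by
  unfold Param.InSphere
  have h1 := h.plane
  have h2 : ∑ i : Fin 4, (l.1 i).toPoly ^ 2 = w.toPoly * r.toPoly := h.conic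
  have h3 : ∑ i : Fin 4, (p i.succ / 2) ^ 2 = (p 0 / 2) ^ 2 := by
    simp only [div_pow, ← Finset.sum_div, h.sphere]
  replace h3 := congrArg (C (σ := Fin 2)) h3
  have h4 : ∀ x : ℝ, C (σ := Fin 2) x = 2 * C (x / 2) := fun x => by
    rw [show (2 : MvPolynomial (Fin 2) ℝ) = C 2 from (map_ofNat C 2).symm, ← C_mul]; congr 1; ring
  simp only [h4 (p _)] at h1
  simp only [map_sum, map_pow] at h3
  simp only [h.succ, h.zero, Fin.sum_univ_four] at h1 h2 h3 ⊢
  rw [map_neg]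
  linear_combination q.toPoly ^ 2 * h2 - q.toPoly * r.toPoly * h1 + r.toPoly ^ 2 * h3

end Projects
end RationalKnot
end

/-! ### Lines through the double point and the knot condition -/

noncomputable section

namespace RationalKnot

open MvPolynomial
open scoped LinearAlgebra.Projectivization

variable {d e : ℕ}

theorem Pinch.dvd_sum {n : ℕ} {f : Fin n → MvPolynomial (Fin 2) ℂ}
    {g : MvPolynomial (Fin 2) ℂ} {a : Fin n → ℂ} (h : Pinch f g a) (ha : a ≠ 0) {c : Fin n → ℂ}
    (hc : ∑ i, c i * a i = 0) : g ∣ ∑ i, C (c i) * f i := by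
  obtain ⟨m, hm⟩ := Function.ne_iff.mp ha
  have hu : IsUnit (C (a m) : MvPolynomial (Fin 2) ℂ) := (isUnit_iff_ne_zero.mpr hm).map C
  rw [← hu.dvd_mul_left]
  have h1 : ∑ i, C (c i) * C (a i) = (0 : MvPolynomial (Fin 2) ℂ) := by
    simp_rw [← C_mul]
    rw [← map_sum, hc, C_0]
  have : C (a m) * ∑ i, C (c i) * f i =
      (∑ i, C (c i) * (C (a m) * f i - C (a i) * f m)) + (∑ i, C (c i) * C (a i)) * f m := by
    rw [Finset.mul_sum, Finset.sum_mul, ← Finset.sum_add_distrib]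
    exact Finset.sum_congr rfl fun i _ => by ring
  rw [this, h1, zero_mul, add_zero]
  exact Finset.dvd_sum fun i _ => (h m i).mul_left _

theorem linearMap_apply_eq_sum {n : ℕ} (f : (Fin n → ℂ) →ₗ[ℂ] ℂ) (x : Fin n → ℂ) :
    f x = ∑ i, f (Pi.single i 1) * x i := by
  rw [LinearMap.pi_apply_eq_sum_univ f x]
  refine Finset.sum_congr rfl fun i _ => ?_
  rw [smul_eq_mul, mul_comm]
  congr 2
  funext j
  simp [Pi.single_apply, eq_comm]

namespace Projects

variable {k : Param 4 d} {l : Param 3 e} {p : Fin 5 → ℝ} {q : BinForm 2}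
  {w : BinForm (e - 2)} {r : BinForm (e + 2)}

/-- For a hyperplane through p the multiples of r cancel, so its pull-back to k is q times a
pull-back to l. -/
theorem sum_cpoly (h : Projects k l p q w r) (c : Fin 5 → ℂ) (hc : ∑ i, c i * p i = 0) :
    ∑ i, C (c i) * k.cpoly i = q.cpoly * ∑ i : Fin 4, C (c i.succ) * l.cpoly i := by
  rw [Fin.sum_univ_succ] at hc ⊢
  simp_rw [h.cpoly_zero, h.cpoly_succ]
  have h1 : C (c 0) * C (p 0 / 2 : ℂ) + ∑ i : Fin 4, C (c i.succ) * C (p i.succ / 2 : ℂ) =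
      (0 : MvPolynomial (Fin 2) ℂ) := by
    simp_rw [← C_mul]
    rw [← map_sum, ← C_add, ← C_0]
    congr 1
    have : ∑ i : Fin 4, c i.succ * (p i.succ / 2 : ℂ) = (∑ i : Fin 4, c i.succ * p i.succ) / 2 := by
      rw [Finset.sum_div]
      exact Finset.sum_congr rfl fun i _ => by ring
    rw [this]
    linear_combination hc / 2
  have h2 : ∑ i : Fin 4, C (c i.succ) * (q.cpoly * l.cpoly i - C (p i.succ / 2 : ℂ) * r.cpoly) =
      q.cpoly * (∑ i : Fin 4, C (c i.succ) * l.cpoly i) -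
        (∑ i : Fin 4, C (c i.succ) * C (p i.succ / 2 : ℂ)) * r.cpoly := by
    rw [Finset.mul_sum, Finset.sum_mul, ← Finset.sum_sub_distrib]
    exact Finset.sum_congr rfl fun i _ => by ring
  rw [h2, map_neg]
  linear_combination -r.cpoly * h1

/-- A pinch g of l at a makes the line through p and (0, a) meet k in the divisor of q g, of degree
2 + 2. -/
theorem isKnot_of_noFourSecant (h : Projects k l p q w r) (he : e ≠ 0) (hk : k.NoFourSecant) :
    l.IsKnot := by
  rw [l.isKnot_iff he]
  intro g a hg hg0 ha hP
  let u : Fin 5 → ℂ := Fin.cons 0 a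
  refine hk p h.isDoublePoint (Submodule.span ℂ {u, fun i => (p i : ℂ)}) ?_
    (Submodule.subset_span (by simp)) ⟨q.cpoly * g, mul_ne_zero h.q_ne_zero hg0,
      q.isHomogeneous_cpoly.mul hg, fun f hf => ?_⟩
  · have hli : LinearIndependent ℂ ![u, fun i => (p i : ℂ)] := by
      rw [LinearIndependent.pair_iff]
      intro s t hst
      have ht : t = 0 := by
        have := congrFun hst 0
        simp only [u, Pi.add_apply, Pi.smul_apply, Fin.cons_zero, smul_eq_mul, mul_zero, zero_add,
          Pi.zero_apply] at this
        exact (mul_eq_zero.mp this).resolve_right (by exact_mod_cast h.p_ne)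
      obtain ⟨i, hi⟩ := Function.ne_iff.mp ha
      have := congrFun hst i.succ
      simp only [u, ht, zero_smul, add_zero, Pi.smul_apply, Fin.cons_succ, smul_eq_mul,
        Pi.zero_apply] at this
      exact ⟨(mul_eq_zero.mp this).resolve_right hi, ht⟩
    have := finrank_span_eq_card hli
    rwa [Matrix.range_cons_cons_empty, Fintype.card_fin] at this
  · have hfp := hf _ (Submodule.subset_span (Set.mem_insert_of_mem _ rfl))
    have hfu := hf _ (Submodule.subset_span (Set.mem_insert u _))
    rw [linearMap_apply_eq_sum] at hfp hfu
    have key := h.sum_cpoly (fun i => f (Pi.single i 1)) hfp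
    have e1 : ∑ i, C (f (Pi.single i 1)) * map (algebraMap ℝ ℂ) (k.1 i).toPoly =
        ∑ i, C (f (Pi.single i 1)) * k.cpoly i := rfl
    rw [e1, key]
    refine mul_dvd_mul_left _ (hP.dvd_sum ha ?_)
    rw [Fin.sum_univ_succ] at hfu
    simpa [u] using hfu

/-- Pull-backs of forms vanishing on a line through p are q times minors of l. A common divisor of
degree four thus leaves a pinch of l after removal of the two factors of q. -/
theorem noFourSecant (h : Projects k l p q w r) (he : e ≠ 0) (hl : l.IsKnot) :
    k.NoFourSecant := by
  intro p₂ hp₂ L hL hpL ⟨G, hG0, hG, hdvd⟩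
  obtain ⟨z, z', hz, hz', hzz, hq, hq'⟩ := h.roots
  obtain ⟨c, hc, hqc⟩ := h.q_eq hz hz' hzz hq hq'
  have hn := h.isNode he hl hz hz' hzz hq hq'
  -- the two double points agree
  obtain ⟨t, ht⟩ : ∃ t : ℂ, (fun i => (p i : ℂ)) = t • fun i => (p₂ i : ℂ) := by
    obtain ⟨hp0, P, Q, hPQ, hmap, b, hb⟩ := hp₂
    have hp0' : (fun i => (p₂ i : ℂ)) ≠ 0 := fun h0 => hp0 (by
      funext i
      simpa using congrFun h0 i)
    have hP := P.rep_nonzero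
    have hQ := Q.rep_nonzero
    rw [← P.mk_rep, ← Q.mk_rep] at hmap hPQ
    rw [k.cmap_mk_eq_iff] at hmap
    rw [ne_eq, mk_eq_mk_iff_cross] at hPQ
    obtain ⟨s, hs⟩ := hmap
    have hpin := k.pinch_of_cvec_eq_smul hP hQ hPQ hb (by rw [hs, hb, smul_smul])
    obtain ⟨c', hc'⟩ := hn.unique _ _ ((isHomogeneous_lin _).mul (isHomogeneous_lin _))
      (mul_ne_zero (lin_ne_zero hP) (lin_ne_zero hQ)) hp0' hpin
    obtain ⟨v, hv, hv'⟩ := hpin.exists_smul hp0' hz (by rw [hc']; simp [mul_comm])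
    rw [h.cvec_root hq] at hv'
    have hr := h.r_ne_zero hz hq
    refine ⟨(-(r.cval z / 2))⁻¹ * v, ?_⟩
    rw [← smul_smul, ← hv', smul_smul, inv_mul_cancel₀, one_smul]
    exact neg_ne_zero.mpr (div_ne_zero hr two_ne_zero)
  have hpL' : (fun i => (p i : ℂ)) ∈ L := by rw [ht]; exact L.smul_mem _ hpL
  obtain ⟨x, hx, hxp⟩ : ∃ x ∈ L, x ∉ Submodule.span ℂ {fun i => (p i : ℂ)} := by
    by_contra! hle
    have h1 := Submodule.finrank_mono (show L ≤ Submodule.span ℂ {fun i => (p i : ℂ)} from hle)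
    rw [hL, finrank_span_singleton h.p_ne_zero] at h1
    omega
  have hspan : ∀ y ∈ L, ∃ s t : ℂ, y = s • x + t • fun i => (p i : ℂ) := by
    have hli : LinearIndependent ℂ ![fun i => (p i : ℂ), x] := by
      rw [LinearIndependent.pair_iff' h.p_ne_zero]
      intro a ha
      exact hxp (Submodule.mem_span_singleton.mpr ⟨a, ha⟩)
    have h2 := finrank_span_eq_card hli
    rw [Matrix.range_cons_cons_empty, Set.pair_comm] at h2
    have h3 : Submodule.span ℂ {x, fun i => (p i : ℂ)} = L := by
      refine Submodule.eq_of_le_of_finrank_le ?_ (by rw [hL, h2]; simp)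
      rw [Submodule.span_le, Set.insert_subset_iff, Set.singleton_subset_iff]
      exact ⟨hx, hpL'⟩
    intro y hy
    rw [← h3, Submodule.mem_span_pair] at hy
    obtain ⟨s, t, hst⟩ := hy
    exact ⟨s, t, hst.symm⟩
  -- The point to which the line L projects from p; it is nonzero since x is not a multiple of p.
  let a : Fin 4 → ℂ := fun i => p 0 * x i.succ - x 0 * p i.succ
  have hp0 : (p 0 : ℂ) ≠ 0 := by exact_mod_cast h.p_ne
  have ha : a ≠ 0 := by
    intro h0
    refine hxp (Submodule.mem_span_singleton.mpr ⟨x 0 / p 0, ?_⟩)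
    funext j
    simp only [Pi.smul_apply, smul_eq_mul]
    refine Fin.cases ?_ (fun i => ?_) j
    · field_simp
    · have : p 0 * x i.succ - x 0 * p i.succ = 0 := congrFun h0 i
      field_simp
      linear_combination -this
  have hCp : IsUnit (C (p 0 : ℂ) : MvPolynomial (Fin 2) ℂ) := (isUnit_iff_ne_zero.mpr hp0).map C
  have hG1 : ∀ ij : Fin 4 × Fin 4, G ∣ lin z * (lin z' *
      (C (a ij.1) * l.cpoly ij.2 - C (a ij.2) * l.cpoly ij.1)) := by
    rintro ⟨i, j⟩
    let pr : Fin 4 → (Fin 5 → ℂ) →ₗ[ℂ] ℂ := fun i =>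
      (p 0 : ℂ) • LinearMap.proj i.succ - (p i.succ : ℂ) • LinearMap.proj 0
    have hpr : ∀ i y, pr i y = p 0 * y i.succ - p i.succ * y 0 := fun i y => rfl
    let f : (Fin 5 → ℂ) →ₗ[ℂ] ℂ := a i • pr j - a j • pr i
    have hf : ∀ y, f y = a i * pr j y - a j * pr i y := fun y => rfl
    have h1 := hdvd f (by
      intro y hy
      obtain ⟨s, t, rfl⟩ := hspan y hy
      simp only [hf, hpr, a, Pi.add_apply, Pi.smul_apply, smul_eq_mul]
      ring)
    have e1 : ∑ i, C (f (Pi.single i 1)) * map (algebraMap ℝ ℂ) (k.1 i).toPoly =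
        ∑ i, C (f (Pi.single i 1)) * k.cpoly i := rfl
    have e2 : ∑ m, C (f (Pi.single m 1)) * k.cpoly m = C (a i) * (C (p 0 : ℂ) * k.cpoly j.succ -
        C (p j.succ : ℂ) * k.cpoly 0) - C (a j) * (C (p 0 : ℂ) * k.cpoly i.succ -
        C (p i.succ : ℂ) * k.cpoly 0) := by
      have hs : ∀ m : Fin 5, ∑ x, C (if m = x then (1 : ℂ) else 0) * k.cpoly x = k.cpoly m := by
        intro m
        simp_rw [apply_ite (C (σ := Fin 2)), C_1, C_0, ite_mul, one_mul, zero_mul]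
        simp
      simp_rw [hf, hpr, Pi.single_apply]
      rw [← hs j.succ, ← hs i.succ, ← hs 0]
      simp only [Finset.mul_sum, ← Finset.sum_sub_distrib, map_sub, map_mul]
      exact Finset.sum_congr rfl fun x _ => by ring
    rw [e1, e2, h.project, h.project] at h1
    have e3 : C (a i) * (C (p 0 : ℂ) * (q.cpoly * l.cpoly j)) -
        C (a j) * (C (p 0 : ℂ) * (q.cpoly * l.cpoly i)) = (C (p 0 : ℂ) * C c) * (lin z * (lin z' *
          (C (a i) * l.cpoly j - C (a j) * l.cpoly i))) := by
      rw [hqc]; ring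
    rw [e3] at h1
    exact ((hCp.mul ((isUnit_iff_ne_zero.mpr hc).map C)).dvd_mul_left).mp h1
  -- It is not known that q divides G, so its linear factors are removed separately. Each removal
  -- lowers the degree by one, from four to two.
  obtain ⟨G', hG', hG0', hG1'⟩ := exists_dvd_of_dvd_lin_mul hG hG0 hz hG1
  obtain ⟨g, hg, hg0, hg1⟩ := exists_dvd_of_dvd_lin_mul hG' hG0' hz' hG1'
  exact (l.isKnot_iff he).mp hl g a hg hg0 ha fun i j => hg1 (i, j)

/-- Below degree eight the projection of a nodal curve is automatically a knot. -/
theorem isKnot_of_lt (h : Projects k l p q w r) (he2 : 2 ≤ e) (he : e < 6) (hd : d ≠ 0)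
    (hk : k.HasExactlyOneDoublePoint) : l.IsKnot := by
  have he0 : e ≠ 0 := by omega
  obtain ⟨z, z', hz, hz', hzz, hq, hq'⟩ := h.roots
  obtain ⟨c, hc, hqc⟩ := h.q_eq hz hz' hzz hq hq'
  obtain ⟨hn, htan⟩ := hk.isNode hz hz' hzz (h.cvec_root_eq_smul hz hq hq')
  rw [l.isKnot_iff he0]
  intro g a hg hg0 ha hP
  -- evaluate the forms at `a`
  set A := ∑ i, a i ^ 2 with hA
  set B := ∑ i : Fin 4, (p i.succ : ℂ) * a i with hB
  obtain ⟨m, hm⟩ := Function.ne_iff.mp ha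
  have hm : a m ≠ 0 := hm
  have hum : IsUnit (C (a m) : MvPolynomial (Fin 2) ℂ) := (isUnit_iff_ne_zero.mpr hm).map C
  -- Modulo g one has a_m l_i = a_i l_m. Hence the pull-backs of the plane and of the quadric become
  -- multiples of their values B and A at a.
  have hlin : g ∣ C (a m) * (w.cpoly * q.cpoly) - C B * l.cpoly m := by
    rw [← h.cpoly_plane, hB, map_sum, Finset.mul_sum, Finset.sum_mul, ← Finset.sum_sub_distrib]
    refine Finset.dvd_sum fun i _ => ?_
    have : C (a m) * (C (p i.succ : ℂ) * l.cpoly i) - C (p i.succ * a i) * l.cpoly m =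
        C (p i.succ : ℂ) * (C (a m) * l.cpoly i - C (a i) * l.cpoly m) := by
      rw [C_mul]; ring
    rw [this]
    exact (hP m i).mul_left _
  have hquad : g ∣ C (a m) ^ 2 * (w.cpoly * r.cpoly) - C A * l.cpoly m ^ 2 := by
    rw [← h.cpoly_conic, hA, map_sum, Finset.mul_sum, Finset.sum_mul, ← Finset.sum_sub_distrib]
    refine Finset.dvd_sum fun i _ => ?_
    have : C (a m) ^ 2 * l.cpoly i ^ 2 - C (a i ^ 2) * l.cpoly m ^ 2 =
        (C (a m) * l.cpoly i + C (a i) * l.cpoly m) *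
          (C (a m) * l.cpoly i - C (a i) * l.cpoly m) := by
      rw [C_pow]; ring
    rw [this]
    exact (hP m i).mul_left _
  -- The inverse of the stereographic projection is undefined exactly at the points of the plane
  -- that lie on the empty conic.
  by_cases hAB : A = 0 ∧ B = 0
  · obtain ⟨hA0, hB0⟩ := hAB
    rw [hB0, C_0, zero_mul, sub_zero, hum.dvd_mul_left] at hlin
    rw [hA0, C_0, zero_mul, sub_zero, (hum.pow 2).dvd_mul_left] at hquad
    -- g divides w q and w r. Each linear factor of g must divide w, since it cannot divide both q
    -- and r.
    have hgw : g ∣ w.cpoly := by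
      obtain ⟨b, x, x', hb, hx, hx', rfl⟩ := exists_eq_lin_mul_lin hg hg0
      have hub : IsUnit (C b : MvPolynomial (Fin 2) ℂ) := (isUnit_iff_ne_zero.mpr hb).map C
      rw [hub.mul_left_dvd] at hlin hquad ⊢
      have step : ∀ {y : Fin 2 → ℂ} {v : MvPolynomial (Fin 2) ℂ}, y ≠ 0 → lin y ∣ v * q.cpoly →
          lin y ∣ v * r.cpoly → lin y ∣ v := by
        intro y v hy h1 h2
        rcases (prime_lin hy).dvd_or_dvd h1 with h1 | h1
        · exact h1
        · rcases (prime_lin hy).dvd_or_dvd h2 with h2 | h2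
          · exact h2
          · exfalso
            refine h.coprime y hy ⟨?_, ?_⟩
            · rw [BinForm.cval_eq]
              by_contra h0
              exact not_lin_dvd h0 h1
            · rw [BinForm.cval_eq]
              by_contra h0
              exact not_lin_dvd h0 h2
      obtain ⟨v, hv⟩ := step hx ((dvd_mul_right _ _).trans hlin) ((dvd_mul_right _ _).trans hquad)
      rw [hv, mul_assoc, mul_dvd_mul_iff_left (lin_ne_zero hx)] at hlin hquad
      rw [hv]
      exact mul_dvd_mul_left _ (step hx' hlin hquad)
    have hgw' : map (starRingEnd ℂ) g ∣ w.cpoly := by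
      have h1 := map_dvd (map (starRingEnd ℂ)) hgw
      have h2 : (starRingEnd ℂ).comp (algebraMap ℝ ℂ) = algebraMap ℝ ℂ := by ext x; simp
      rwa [BinForm.cpoly, cx, map_map, h2] at h1
    -- At a common root of g and its conjugate, l takes values proportional to a at x and at its
    -- conjugate. Then a is a multiple of a nonzero real vector, contradicting Σ a_i² = 0.
    have hrel : IsRelPrime g (map (starRingEnd ℂ) g) := by
      refine isRelPrime_of_no_common_root hg hg0 fun x hx hgx hgx' => ?_
      have hxc : (fun i => starRingEnd ℂ (x i)) ≠ 0 := fun h0 => hx (by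
        funext i
        simpa using congrFun h0 i)
      have hgx2 : eval (fun i => starRingEnd ℂ (x i)) g = 0 := by
        have h1 := congrArg (starRingEnd ℂ) hgx'
        rw [eval_map, map_zero, eval₂_comp_left (starRingEnd ℂ)] at h1
        have h2 : (starRingEnd ℂ).comp (starRingEnd ℂ) = RingHom.id ℂ := by ext x; simp
        rw [h2] at h1
        exact h1
      obtain ⟨s, hs, hs'⟩ := hP.exists_smul ha hx hgx
      obtain ⟨t, ht, ht'⟩ := hP.exists_smul ha hxc hgx2
      have hconj : ∀ i, starRingEnd ℂ (a i) = (t / starRingEnd ℂ s) * a i := by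
        intro i
        have h1 := congrFun ht' i
        rw [l.cvec_conj, hs'] at h1
        simp only [Pi.smul_apply, smul_eq_mul, map_mul] at h1
        have : starRingEnd ℂ s ≠ 0 := by simpa using hs
        field_simp
        linear_combination h1
      obtain ⟨b, y, hb, hy, hay⟩ := exists_real_of_conj_smul ha hconj
      rw [hA, hay] at hA0
      simp only [Pi.smul_apply, smul_eq_mul, mul_pow, ← Finset.mul_sum] at hA0
      have h1 := (mul_eq_zero.mp hA0).resolve_left (pow_ne_zero 2 hb)
      have h2 : ∑ i, y i ^ 2 = 0 := by exact_mod_cast h1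
      rw [Finset.sum_eq_zero_iff_of_nonneg fun i _ => sq_nonneg _] at h2
      apply hy
      funext i
      simpa using h2 i (Finset.mem_univ i)
    have hdvd := hrel.mul_dvd hgw hgw'
    have hg' : (map (starRingEnd ℂ) g).IsHomogeneous 2 := hg.map _
    have hg0' : map (starRingEnd ℂ) g ≠ 0 := by
      rw [ne_eq, map_eq_zero_iff _ (map_injective _ (starRingEnd ℂ).injective)]
      exact hg0
    obtain ⟨v, hv⟩ := hdvd
    have hv0 : v ≠ 0 := by
      rintro rfl
      exact h.w_ne_zero (by rw [hv, mul_zero])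
    -- The product of g and its conjugate has degree four, but w is nonzero of degree e - 2 < 4.
    have h1 := w.isHomogeneous_cpoly.totalDegree h.w_ne_zero
    rw [hv, totalDegree_mul_of_isDomain (mul_ne_zero hg0 hg0') hv0,
      (hg.mul hg').totalDegree (mul_ne_zero hg0 hg0')] at h1
    omega
  · -- the curve `k` is constant modulo `g` as well
    -- The preimage of a under the stereographic projection. It arises by substituting A for w r and
    -- B for w q in w k = (-(p_0/2) w r, w q l_i - (p_i/2) w r).
    let b : Fin 5 → ℂ := Fin.cons (-(p 0 / 2) * A) fun i => B * a i - p i.succ / 2 * A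
    have hp0 : (p 0 : ℂ) ≠ 0 := by exact_mod_cast h.p_ne
    have hb : b ≠ 0 := by
      intro h0
      have hA0 : A = 0 := by
        have := congrFun h0 0
        simp only [b, Fin.cons_zero, Pi.zero_apply] at this
        exact (mul_eq_zero.mp this).resolve_left (neg_ne_zero.mpr (div_ne_zero hp0 two_ne_zero))
      refine hAB ⟨hA0, ?_⟩
      have := congrFun h0 m.succ
      simp only [b, Fin.cons_succ, hA0, mul_zero, sub_zero, Pi.zero_apply] at this
      exact (mul_eq_zero.mp this).resolve_right hm
    have hF : ∀ j, g ∣ C (a m) ^ 2 * (w.cpoly * k.cpoly j) - C (b j) * l.cpoly m ^ 2 := by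
      intro j
      refine Fin.cases ?_ (fun i => ?_) j
      · have : C (a m) ^ 2 * (w.cpoly * k.cpoly 0) - C (b 0) * l.cpoly m ^ 2 =
            C (-(p 0 / 2 : ℂ)) * (C (a m) ^ 2 * (w.cpoly * r.cpoly) - C A * l.cpoly m ^ 2) := by
          rw [h.cpoly_zero]
          simp only [b, Fin.cons_zero, C_mul]
          ring
        rw [this]
        exact hquad.mul_left _
      · have : C (a m) ^ 2 * (w.cpoly * k.cpoly i.succ) - C (b i.succ) * l.cpoly m ^ 2 =
            C (a m) * l.cpoly i * (C (a m) * (w.cpoly * q.cpoly) - C B * l.cpoly m)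
            + C B * l.cpoly m * (C (a m) * l.cpoly i - C (a i) * l.cpoly m)
            - C (p i.succ / 2 : ℂ) *
              (C (a m) ^ 2 * (w.cpoly * r.cpoly) - C A * l.cpoly m ^ 2) := by
          rw [h.cpoly_succ]
          simp only [b, Fin.cons_succ, C_mul, C_sub]
          ring
        rw [this]
        exact ((hlin.mul_left _).add ((hP m i).mul_left _)).sub (hquad.mul_left _)
    -- At a common root the equations of plane and conic would give A = B = 0.
    have hrel : IsRelPrime g w.cpoly := by
      refine isRelPrime_of_no_common_root hg hg0 fun x hx hgx hwx => hAB ?_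
      obtain ⟨s, hs, hs'⟩ := hP.exists_smul ha hx hgx
      have h1 := congrArg (eval x) h.cpoly_plane
      have h2 := congrArg (eval x) h.cpoly_conic
      simp only [map_sum, map_mul, map_pow, eval_C, hwx, zero_mul, ← l.cvec_apply, hs',
        Pi.smul_apply, smul_eq_mul, mul_pow, ← Finset.mul_sum] at h1 h2
      refine ⟨(mul_eq_zero.mp h2).resolve_left (pow_ne_zero 2 hs), ?_⟩
      apply mul_left_cancel₀ hs
      rw [mul_zero, ← h1, hB, Finset.mul_sum]
      exact Finset.sum_congr rfl fun i _ => by ring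
    have hPk : Pinch k.cpoly g b := by
      intro i j
      refine hrel.dvd_of_dvd_mul_left ?_
      rw [← (hum.pow 2).dvd_mul_left]
      have : C (a m) ^ 2 * (w.cpoly * (C (b i) * k.cpoly j - C (b j) * k.cpoly i)) =
          C (b i) * (C (a m) ^ 2 * (w.cpoly * k.cpoly j) - C (b j) * l.cpoly m ^ 2) -
          C (b j) * (C (a m) ^ 2 * (w.cpoly * k.cpoly i) - C (b i) * l.cpoly m ^ 2) := by ring
      rw [this]
      exact ((hF j).mul_left _).sub ((hF i).mul_left _)
    -- As q is the only pinch of k, the form g has the roots z and z'. Then l(z) and l(z') are both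
    -- multiples of a, and the two tangent lines at the node coincide.
    obtain ⟨t, ht⟩ := hn.unique g b hg hg0 hb hPk
    obtain ⟨s, hs, hs'⟩ := hP.exists_smul ha hz (by rw [ht]; simp [mul_comm])
    obtain ⟨s', hs0, hs''⟩ := hP.exists_smul ha hz' (by rw [ht]; simp [mul_comm])
    apply htan
    rw [h.span_cderiv hd hz hz' hzz hq hq',
      h.span_cderiv hd hz' hz (fun h => hzz (by linear_combination -h)) hq' hq]
    have hcons : ∀ t : ℂ, (Fin.cons 0 (t • a) : Fin 5 → ℂ) = t • Fin.cons 0 a := by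
      intro t
      funext j
      refine Fin.cases ?_ (fun i => ?_) j <;> simp
    rw [hs', hs'', hcons, hcons, Submodule.span_insert, Submodule.span_insert,
      Submodule.span_singleton_smul_eq (isUnit_iff_ne_zero.mpr hs),
      Submodule.span_singleton_smul_eq (isUnit_iff_ne_zero.mpr hs0)]

end Projects
end RationalKnot
end

noncomputable section

namespace RationalKnot

open MvPolynomial Matrix
open scoped LinearAlgebra.Projectivization

/-! ### Linear substitutions and reparametrizations -/

section Subst

variable {K : Type*} [Field K]

/-- Substitution of the linear forms given by the rows of a matrix. -/
def subst (A : Matrix (Fin 2) (Fin 2) K) : MvPolynomial (Fin 2) K →ₐ[K] MvPolynomial (Fin 2) K :=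
  aeval fun i => ∑ j, C (A i j) * X j

theorem eval_subst (A : Matrix (Fin 2) (Fin 2) K) (f : MvPolynomial (Fin 2) K) (z : Fin 2 → K) :
    eval z (subst A f) = eval (A *ᵥ z) f := by
  have : (aeval z : MvPolynomial (Fin 2) K →ₐ[K] K).comp (subst A) = aeval (A *ᵥ z) := by
    refine MvPolynomial.algHom_ext fun i => ?_
    fin_cases i <;> simp [subst]
  simpa [aeval_eq_eval] using DFunLike.congr_fun this f

theorem subst_subst (A B : Matrix (Fin 2) (Fin 2) K) (f : MvPolynomial (Fin 2) K) :
    subst A (subst B f) = subst (B * A) f := by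
  have : (subst A).comp (subst B) = subst (B * A) := by
    refine MvPolynomial.algHom_ext fun i => ?_
    simp only [AlgHom.comp_apply, subst, aeval_X, map_mul, algHom_C, algebraMap_eq,
      Matrix.mul_apply, Fin.sum_univ_two, map_add]
    ring
  exact DFunLike.congr_fun this f

theorem subst_one (f : MvPolynomial (Fin 2) K) : subst 1 f = f := by
  have : subst (1 : Matrix (Fin 2) (Fin 2) K) = AlgHom.id K _ := by
    refine MvPolynomial.algHom_ext fun i => ?_
    fin_cases i <;> simp [subst]
  exact DFunLike.congr_fun this f

theorem isHomogeneous_subst (A : Matrix (Fin 2) (Fin 2) K) {f : MvPolynomial (Fin 2) K} {n : ℕ}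
    (hf : f.IsHomogeneous n) : (subst A f).IsHomogeneous n := by
  have := hf.aeval (fun i => ∑ j, C (A i j) * X j) (n := 1)
    fun i => IsHomogeneous.sum _ _ _ fun j _ => isHomogeneous_C_mul_X _ _
  rwa [one_mul] at this

theorem subst_C (A : Matrix (Fin 2) (Fin 2) K) (c : K) : subst A (C c) = C c :=
  (subst A).commutes c

end Subst

theorem cx_subst (A : Matrix (Fin 2) (Fin 2) ℝ) (f : MvPolynomial (Fin 2) ℝ) :
    cx (subst A f) = subst (A.map (algebraMap ℝ ℂ)) (cx f) := by
  induction f using MvPolynomial.induction_on with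
  | C a => simp [cx]
  | add f g hf hg =>
    simp only [cx, map_add] at hf hg ⊢
    rw [hf, hg]
  | mul_X f i hf =>
    simp only [cx, map_mul] at hf ⊢
    rw [hf]
    fin_cases i <;> simp [subst]

variable {n d e : ℕ}

/-- The form `c f(A z)`. -/
def BinForm.act (A : Matrix (Fin 2) (Fin 2) ℝ) (c : ℝ) (f : BinForm d) : BinForm d :=
  ofPoly d (C c * subst A f.toPoly)

theorem BinForm.toPoly_act (A : Matrix (Fin 2) (Fin 2) ℝ) (c : ℝ) (f : BinForm d) :
    (f.act A c).toPoly = C c * subst A f.toPoly :=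
  toPoly_ofPoly ((isHomogeneous_subst A f.isHomogeneous_toPoly).C_mul c)

theorem BinForm.cval_act (A : Matrix (Fin 2) (Fin 2) ℝ) (c : ℝ) (f : BinForm d) (z : Fin 2 → ℂ) :
    (f.act A c).cval z = c * f.cval (A.map (algebraMap ℝ ℂ) *ᵥ z) := by
  rw [BinForm.cval_eq, BinForm.cval_eq, BinForm.cpoly, BinForm.toPoly_act, cx, map_mul]
  rw [← cx, ← cx, cx_subst, map_mul, eval_subst]
  simp

/-- The complex matrix of a real invertible matrix. -/
def cmat (A : GL (Fin 2) ℝ) : Matrix (Fin 2) (Fin 2) ℂ :=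
  (A : Matrix (Fin 2) (Fin 2) ℝ).map (algebraMap ℝ ℂ)

theorem cmat_mul (A B : GL (Fin 2) ℝ) : cmat (A * B) = cmat A * cmat B := by
  rw [cmat, Units.val_mul, Matrix.map_mul]; rfl

theorem cmat_one : cmat 1 = 1 := by
  rw [cmat, Units.val_one, Matrix.map_one _ (map_zero _) (map_one _)]

theorem cmat_mul_inv (A : GL (Fin 2) ℝ) : cmat A * cmat A⁻¹ = 1 := by
  rw [← cmat_mul, mul_inv_cancel, cmat_one]

theorem cmat_inv_mul (A : GL (Fin 2) ℝ) : cmat A⁻¹ * cmat A = 1 := by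
  rw [← cmat_mul, inv_mul_cancel, cmat_one]

theorem cmat_mulVec_ne_zero (A : GL (Fin 2) ℝ) {z : Fin 2 → ℂ} (hz : z ≠ 0) :
    cmat A *ᵥ z ≠ 0 := by
  intro h
  apply hz
  rw [← one_mulVec z, ← cmat_inv_mul A, ← mulVec_mulVec, h, mulVec_zero]

/-- The reparametrization `c k(A z)` of `k`. -/
def Param.act (A : GL (Fin 2) ℝ) (c : ℝˣ) (k : Param n d) : Param n d :=
  ⟨fun i => (k.1 i).act A c, fun z hz => by
    obtain ⟨i, hi⟩ := k.2 _ (cmat_mulVec_ne_zero A hz)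
    exact ⟨i, by rw [BinForm.cval_act]; exact mul_ne_zero (by exact_mod_cast c.ne_zero) hi⟩⟩

theorem Param.toPoly_act (A : GL (Fin 2) ℝ) (c : ℝˣ) (k : Param n d) (i) :
    ((k.act A c).1 i).toPoly = C (c : ℝ) * subst A (k.1 i).toPoly :=
  BinForm.toPoly_act _ _ _

theorem Param.cpoly_act (A : GL (Fin 2) ℝ) (c : ℝˣ) (k : Param n d) (i) :
    (k.act A c).cpoly i = C ((c : ℝ) : ℂ) * subst (cmat A) (k.cpoly i) := by
  have := congrArg cx (k.toPoly_act A c i)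
  rw [cx, cx, map_mul, map_C] at this
  exact this.trans (congrArg _ (cx_subst _ _))

theorem Param.ext_toPoly {k l : Param n d} (h : ∀ i, (k.1 i).toPoly = (l.1 i).toPoly) : k = l := by
  have h1 : k.1 = l.1 := by
    funext i
    exact toPoly_injective (h i)
  exact Subtype.ext h1

theorem Param.reparam_iff {k l : Param n d} : k.Reparam l ↔ ∃ A c, l = k.act A c := by
  constructor
  · rintro ⟨A, c, h⟩
    refine ⟨A, c, Param.ext_toPoly fun i => MvPolynomial.funext fun z => ?_⟩
    rw [Param.toPoly_act, map_mul, eval_C, eval_subst]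
    exact congrFun (h z) i
  · rintro ⟨A, c, rfl⟩
    refine ⟨A, c, fun z => funext fun i => ?_⟩
    rw [Param.rvec_apply, Param.toPoly_act, map_mul, eval_C, eval_subst]
    rfl

theorem Param.mk_eq_iff {k l : Param n d} :
    (Quotient.mk (curveSetoid n d) k : Curve n d) = Quotient.mk (curveSetoid n d) l ↔
      ∃ A c, l = k.act A c :=
  Quotient.eq.trans Param.reparam_iff

theorem Param.parametrizes_act (A : GL (Fin 2) ℝ) (c : ℝˣ) (k : Param n d) :
    (k.act A c).Parametrizes (Quotient.mk (curveSetoid n d) k) :=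
  (Param.mk_eq_iff.mpr ⟨A, c, rfl⟩).symm

theorem Param.IsKnot.act {l : Param n e} (he : e ≠ 0) (hl : l.IsKnot) (A : GL (Fin 2) ℝ)
    (c : ℝˣ) : (l.act A c).IsKnot := by
  rw [Param.isKnot_iff _ he] at hl ⊢
  intro g a hg hg0 ha hP
  refine hl (subst (cmat A⁻¹) g) a (isHomogeneous_subst _ hg) ?_ ha ?_
  · intro h
    apply hg0
    rw [← subst_one g, ← cmat_inv_mul A, ← subst_subst, h, map_zero]
  · intro i j
    have h1 := map_dvd (subst (cmat A⁻¹)) (hP i j)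
    have hc : IsUnit (C ((c : ℝ) : ℂ) : MvPolynomial (Fin 2) ℂ) :=
      (isUnit_iff_ne_zero.mpr (by exact_mod_cast c.ne_zero)).map C
    rw [← hc.dvd_mul_left]
    convert h1 using 1
    simp only [l.cpoly_act, map_sub, map_mul, subst_C, subst_subst, cmat_mul_inv, subst_one]
    ring

theorem cross_mulVec_ne_zero (A : GL (Fin 2) ℝ) {z z' : Fin 2 → ℂ}
    (h : z 1 * z' 0 - z 0 * z' 1 ≠ 0) :
    (cmat A *ᵥ z) 1 * (cmat A *ᵥ z') 0 - (cmat A *ᵥ z) 0 * (cmat A *ᵥ z') 1 ≠ 0 := by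
  have h1 : (cmat A *ᵥ z) 1 * (cmat A *ᵥ z') 0 - (cmat A *ᵥ z) 0 * (cmat A *ᵥ z') 1 =
      (cmat A).det * (z 1 * z' 0 - z 0 * z' 1) := by
    simp only [mulVec, dotProduct, Fin.sum_univ_two, det_fin_two]
    ring
  rw [h1]
  refine mul_ne_zero ?_ h
  intro h0
  have := congrArg det (cmat_mul_inv A)
  rw [det_mul, h0, zero_mul, det_one] at this
  exact zero_ne_one this

/-- The plane is linear and the conic quadratic in l. So when l is scaled by c, w and r take the
factor c and q takes none. -/
theorem Projects.act {k : Param 4 d} {l : Param 3 e} {p : Fin 5 → ℝ} {q : BinForm 2}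
    {w : BinForm (e - 2)} {r : BinForm (e + 2)} (h : Projects k l p q w r) (A : GL (Fin 2) ℝ)
    (c : ℝˣ) : Projects (k.act A c) (l.act A c) p (q.act A 1) (w.act A (c : ℝ)) (r.act A (c : ℝ)) where
  sphere := h.sphere
  p_ne := h.p_ne
  plane := by
    have := congrArg (subst (A : Matrix (Fin 2) (Fin 2) ℝ)) h.plane
    simp only [map_sum, map_mul, subst_C] at this
    simp only [Param.toPoly_act, BinForm.toPoly_act, C_1, one_mul, mul_assoc, ← this,
      Finset.mul_sum]
    exact Finset.sum_congr rfl fun i _ => by ring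
  conic := by
    have := congrArg (subst (A : Matrix (Fin 2) (Fin 2) ℝ)) h.conic
    simp only [map_sum, map_mul, map_pow] at this
    simp only [Param.toPoly_act, BinForm.toPoly_act, mul_pow, ← Finset.mul_sum, this]
    ring
  zero := by
    simp only [Param.toPoly_act, BinForm.toPoly_act, h.zero, map_mul, subst_C]
    ring
  succ i := by
    simp only [Param.toPoly_act, BinForm.toPoly_act, h.succ, map_sub, map_mul, subst_C, C_1]
    ring
  coprime z hz := by
    rintro ⟨h1, h2⟩
    rw [BinForm.cval_act] at h1 h2
    refine h.coprime _ (cmat_mulVec_ne_zero A hz) ⟨?_, ?_⟩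
    · exact (mul_eq_zero.mp h1).resolve_left (by simp)
    · exact (mul_eq_zero.mp h2).resolve_left (by exact_mod_cast c.ne_zero)
  roots := by
    obtain ⟨z, z', hz, hz', hzz, hq, hq'⟩ := h.roots
    have key : ∀ x : Fin 2 → ℂ, q.cval x = 0 → (q.act A 1).cval (cmat A⁻¹ *ᵥ x) = 0 := by
      intro x hx
      rw [BinForm.cval_act]
      change _ * q.cval (cmat A *ᵥ _) = 0
      rw [mulVec_mulVec, cmat_mul_inv, one_mulVec, hx, mul_zero]
    exact ⟨_, _, cmat_mulVec_ne_zero A⁻¹ hz, cmat_mulVec_ne_zero A⁻¹ hz',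
      cross_mulVec_ne_zero A⁻¹ hzz, key z hq, key z' hq'⟩

/-! ### Uniqueness -/

/-- Eliminating w and w' gives q r' = q' r. As q is coprime to r, it divides q', which has the same
degree. -/
theorem exists_smul_of_mul_eq {q q' : BinForm 2} {w w' : BinForm (e - 2)} {r r' : BinForm (e + 2)}
    (hw : w.toPoly ≠ 0) (hw' : w'.toPoly ≠ 0)
    (hco : ∀ z : Fin 2 → ℂ, z ≠ 0 → ¬ (q.cval z = 0 ∧ r.cval z = 0))
    (h1 : w.toPoly * q.toPoly = w'.toPoly * q'.toPoly)
    (h2 : w.toPoly * r.toPoly = w'.toPoly * r'.toPoly) :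
    ∃ c : ℝ, c ≠ 0 ∧ q' = c • q ∧ r' = c • r := by
  have hq : q.cpoly ≠ 0 := cpoly_ne_zero_of_coprime hco
  have hqR : q.toPoly ≠ 0 := fun h => hq (by rw [BinForm.cpoly, h]; exact map_zero _)
  have h3 : q.toPoly * r'.toPoly = q'.toPoly * r.toPoly := by
    apply mul_left_cancel₀ (mul_ne_zero hw hw')
    linear_combination w'.toPoly * r'.toPoly * h1 - w'.toPoly * q'.toPoly * h2
  have hrel : IsRelPrime q.cpoly r.cpoly :=
    isRelPrime_of_no_common_root q.isHomogeneous_cpoly hq fun z hz h4 h5 =>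
      hco z hz ⟨by rw [BinForm.cval_eq, h4], by rw [BinForm.cval_eq, h5]⟩
  have hdvd : q.toPoly ∣ q'.toPoly := by
    apply dvd_of_cx_dvd_cx
    refine hrel.dvd_of_dvd_mul_right ?_
    have := congrArg cx h3
    simp only [cx, map_mul] at this
    exact ⟨_, this.symm⟩
  obtain ⟨c, hc⟩ := exists_C_mul_of_dvd q.isHomogeneous_toPoly hqR q'.isHomogeneous_toPoly hdvd
  have hc0 : c ≠ 0 := by
    rintro rfl
    rw [hc, C_0, zero_mul, mul_zero] at h1
    exact mul_ne_zero hw hqR h1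
  refine ⟨c, hc0, toPoly_injective ?_, toPoly_injective ?_⟩
  · rw [hc, toPoly_smul]
  · rw [toPoly_smul]
    apply mul_left_cancel₀ hqR
    rw [h3, hc]; ring

theorem cx_toPoly_ne_zero {f : BinForm d} : f.cpoly ≠ 0 ↔ f.toPoly ≠ 0 := by
  rw [BinForm.cpoly, ne_eq, map_eq_zero_iff _ cx_injective]

namespace Projects

variable {k k' : Param 4 d} {l : Param 3 e} {p : Fin 5 → ℝ} {q q' : BinForm 2}
  {w w' : BinForm (e - 2)} {r r' : BinForm (e + 2)}

theorem mk_eq (h : Projects k l p q w r) (h' : Projects k' l p q' w' r') :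
    (Quotient.mk (curveSetoid 4 d) k : Curve 4 d) = Quotient.mk (curveSetoid 4 d) k' := by
  obtain ⟨c, hc, hq, hr⟩ := exists_smul_of_mul_eq (cx_toPoly_ne_zero.mp h.w_ne_zero)
    (cx_toPoly_ne_zero.mp h'.w_ne_zero) h.coprime
    (by rw [← h.plane, ← h'.plane]) (by rw [← h.conic, ← h'.conic])
  rw [Param.mk_eq_iff]
  refine ⟨1, Units.mk0 c hc, Param.ext_toPoly fun j => ?_⟩
  rw [Param.toPoly_act, Units.val_one, subst_one, Units.val_mk0]
  refine Fin.cases ?_ (fun i => ?_) j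
  · rw [h.zero, h'.zero, hr, toPoly_smul]; ring
  · rw [h.succ, h'.succ, hr, hq, toPoly_smul, toPoly_smul]; ring

/-- The products p_i r are unchanged, hence so is k. This permits the normalization p_0 = 1. -/
theorem smul_point (h : Projects k l p q w r) {t : ℝ} (ht : t ≠ 0) :
    Projects k l (t • p) q (t • w) (t⁻¹ • r) where
  sphere := by
    simp only [Pi.smul_apply, smul_eq_mul, mul_pow, ← Finset.mul_sum, h.sphere]
  p_ne := mul_ne_zero ht h.p_ne
  plane := by
    simp only [Pi.smul_apply, smul_eq_mul, C_mul, mul_assoc, ← Finset.mul_sum, h.plane, toPoly_smul]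
  conic := by
    rw [h.conic, toPoly_smul, toPoly_smul]
    have : C t * C t⁻¹ = (1 : MvPolynomial (Fin 2) ℝ) := by rw [← C_mul, mul_inv_cancel₀ ht, C_1]
    linear_combination -w.toPoly * r.toPoly * this
  zero := by
    rw [h.zero, toPoly_smul, ← mul_assoc, ← C_mul]
    congr 2
    simp only [Pi.smul_apply, smul_eq_mul]
    field_simp
  succ i := by
    rw [h.succ, toPoly_smul, ← mul_assoc, ← C_mul]
    congr 3
    simp only [Pi.smul_apply, smul_eq_mul]
    field_simp
  coprime z hz := by
    rintro ⟨h1, h2⟩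
    refine h.coprime z hz ⟨h1, ?_⟩
    rw [BinForm.cval_eq, BinForm.cpoly, toPoly_smul, cx, map_mul, map_mul, map_C, eval_C] at h2
    rw [BinForm.cval_eq]
    exact (mul_eq_zero.mp h2).resolve_left (by simpa using ht)
  roots := h.roots

/-- The double point and the projection are determined by the curve. -/
theorem unique (h : Projects k l p q w r) (he : e ≠ 0) (hl : l.IsKnot) {v : Fin 4 → ℝ}
    {q' : BinForm 2} (hq' : q' ≠ 0) {f : Fin 4 → BinForm e}
    (hf : ∀ i, (k.1 i.succ).toPoly - C (v i) * (k.1 0).toPoly = q'.toPoly * (f i).toPoly) :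
    (∀ i, p i.succ = p 0 * v i) ∧ ∃ s : ℝ, s ≠ 0 ∧ ∀ i, f i = s • l.1 i := by
  obtain ⟨z, z', hz, hz', hzz, hqz, hqz'⟩ := h.roots
  have hn := h.isNode he hl hz hz' hzz hqz hqz'
  let u : Fin 5 → ℝ := Fin.cons 1 v
  have hu : (fun i => (u i : ℂ)) ≠ 0 := fun h0 => by
    have := congrFun h0 0
    simp [u] at this
  have hq0 : q'.cpoly ≠ 0 := by rwa [cx_toPoly_ne_zero, ne_eq, toPoly_eq_zero]
  -- The hypothesis says that k is proportional to (1, v) modulo q'. As q is the only pinch of k, q'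
  -- is a multiple of q and (1, v) represents p.
  have hP : Pinch k.cpoly q'.cpoly fun i => (u i : ℂ) := by
    refine pinch_of_dvd_sub fun j => ?_
    refine Fin.cases ?_ (fun i => ?_) j
    · simp [u]
    · have := congrArg cx (hf i)
      simp only [cx, map_sub, map_mul, map_C] at this
      exact ⟨_, this⟩
  obtain ⟨c, hc⟩ := hn.unique _ _ q'.isHomogeneous_cpoly hq0 hu hP
  obtain ⟨t, ht, htz⟩ := hP.exists_smul hu hz (by rw [hc]; simp [mul_comm])
  have hv : ∀ i, p i.succ = p 0 * v i := by
    intro i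
    rw [h.cvec_root hqz] at htz
    have h0 := congrFun htz 0
    have h1 := congrFun htz i.succ
    simp only [u, Pi.smul_apply, smul_eq_mul, Fin.cons_zero, Fin.cons_succ, Complex.ofReal_one,
      mul_one] at h0 h1
    have hr : -(r.cval z / 2) ≠ 0 := neg_ne_zero.mpr (div_ne_zero (h.r_ne_zero hz hqz) two_ne_zero)
    have : (p i.succ : ℂ) = p 0 * v i := by
      apply mul_left_cancel₀ hr
      rw [h1, ← h0]; ring
    exact_mod_cast this
  refine ⟨hv, ?_⟩
  obtain ⟨b, hb, hqb⟩ := h.q_eq hz hz' hzz hqz hqz'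
  have hqR : q.toPoly ≠ 0 := cx_toPoly_ne_zero.mp h.q_ne_zero
  have hdvd : q.toPoly ∣ q'.toPoly := by
    apply dvd_of_cx_dvd_cx
    refine ⟨C (c / b), ?_⟩
    change q'.cpoly = q.cpoly * _
    have : C b * C (c / b) = (C c : MvPolynomial (Fin 2) ℂ) := by rw [← C_mul, mul_div_cancel₀ _ hb]
    rw [hc, hqb, ← this]
    ring
  obtain ⟨s, hs⟩ := exists_C_mul_of_dvd q.isHomogeneous_toPoly hqR q'.isHomogeneous_toPoly hdvd
  have hs0 : s ≠ 0 := by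
    rintro rfl
    rw [C_0, zero_mul, toPoly_eq_zero] at hs
    exact hq' hs
  refine ⟨s⁻¹, inv_ne_zero hs0, fun i => toPoly_injective ?_⟩
  apply mul_left_cancel₀ (mul_ne_zero (a := C s) (by simpa using hs0) hqR)
  rw [← hs, ← hf, toPoly_smul, h.succ, h.zero]
  have h1 : C (p i.succ / 2) = C (p 0 / 2) * (C (v i) : MvPolynomial (Fin 2) ℝ) := by
    rw [hv, ← C_mul]; congr 1; ring
  have h2 : C s * C s⁻¹ = (1 : MvPolynomial (Fin 2) ℝ) := by rw [← C_mul, mul_inv_cancel₀ hs0, C_1]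
  rw [h1, map_neg, hs]
  linear_combination -q.toPoly * (l.1 i).toPoly * h2

end Projects

/-! ### Mirror images -/

theorem toPoly_neg (f : BinForm d) : (-f).toPoly = -f.toPoly := by
  rw [← neg_one_smul ℝ f, toPoly_smul]; simp

/-- The mirror image of a parametrization. -/
def Param.mirror (k : Param 4 d) : Param 4 d :=
  ⟨fun i => if i = 0 then -k.1 i else k.1 i, fun z hz => by
    obtain ⟨i, hi⟩ := k.2 z hz
    refine ⟨i, ?_⟩
    beta_reduce
    split_ifs with h0
    · rw [BinForm.cval, toPoly_neg, map_neg, neg_ne_zero]; exact hi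
    · exact hi⟩

theorem Param.mirror_zero (k : Param 4 d) : (k.mirror.1 0).toPoly = -(k.1 0).toPoly :=
  toPoly_neg _

theorem Param.mirror_succ (k : Param 4 d) (i : Fin 4) : k.mirror.1 i.succ = k.1 i.succ := rfl

theorem Param.mirror_mirror (k : Param 4 d) : k.mirror.mirror = k := by
  refine Subtype.ext (funext fun i => ?_)
  simp only [Param.mirror]
  split_ifs <;> simp

theorem Param.mirror_act (A : GL (Fin 2) ℝ) (c : ℝˣ) (k : Param 4 d) :
    (k.act A c).mirror = k.mirror.act A c := by
  refine Param.ext_toPoly fun j => ?_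
  refine Fin.cases ?_ (fun i => ?_) j
  · rw [Param.mirror_zero, Param.toPoly_act, Param.toPoly_act, Param.mirror_zero, map_neg, mul_neg]
  · rw [Param.mirror_succ, Param.toPoly_act, Param.toPoly_act, Param.mirror_succ]

theorem Param.rvec_mirror (k : Param 4 d) (z : Fin 2 → ℝ) :
    k.mirror.rvec z = reflection (k.rvec z) := by
  funext j
  refine Fin.cases ?_ (fun i => ?_) j
  · rw [Param.rvec_apply, Param.mirror_zero, map_neg]; rfl
  · rw [Param.rvec_apply, Param.mirror_succ]; rfl

theorem reflection_zero (p : Fin 5 → ℝ) : reflection p 0 = -p 0 := rfl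

theorem reflection_succ (p : Fin 5 → ℝ) (i : Fin 4) : reflection p i.succ = p i.succ := rfl

/-- Besides the equation for k_0, the coordinate p_0 enters only squared, so its sign can be changed
with the same l, q, w, r. -/
theorem Projects.mirror {k : Param 4 d} {l : Param 3 e} {p : Fin 5 → ℝ} {q : BinForm 2}
    {w : BinForm (e - 2)} {r : BinForm (e + 2)} (h : Projects k l p q w r) :
    Projects k.mirror l (reflection p) q w r where
  sphere := by
    simp only [reflection_zero, reflection_succ, neg_sq, h.sphere]
  p_ne := neg_ne_zero.mpr h.p_ne
  plane := by simp only [reflection_succ, h.plane]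
  conic := h.conic
  zero := by
    rw [Param.mirror_zero, h.zero, reflection_zero, ← neg_mul, ← map_neg]; congr 2; ring
  succ i := by rw [Param.mirror_succ, h.succ, reflection_succ]
  coprime := h.coprime
  roots := h.roots

end RationalKnot
end

noncomputable section

namespace RationalKnot

open MvPolynomial Matrix
open scoped LinearAlgebra.Projectivization

variable {n d e : ℕ}

/-! ### Real roots of quadratic forms -/

theorem exists_root_of_isHomogeneous_one {f : MvPolynomial (Fin 2) ℝ} (hf : f.IsHomogeneous 1) :
    ∃ z : Fin 2 → ℝ, z ≠ 0 ∧ eval z f = 0 := by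
  rw [← toPoly_ofPoly hf]
  set b := ofPoly 1 f
  have hev : ∀ z : Fin 2 → ℝ, eval z b.toPoly = b 0 * z 1 + b 1 * z 0 := by
    intro z
    simp [BinForm.toPoly, Fin.sum_univ_two]
  by_cases hb : b = 0
  · exact ⟨![1, 0], fun h => by simpa using congrFun h 0, by rw [hev]; simp [hb]⟩
  · refine ⟨![-b 0, b 1], fun h => hb ?_, by rw [hev]; simp; ring⟩
    ext i
    fin_cases i
    · simpa using congrFun h 0
    · simpa using congrFun h 1

theorem BinForm.cval_ofReal (f : BinForm d) (x : Fin 2 → ℝ) :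
    f.cval (fun j => (x j : ℂ)) = (f.rval x : ℂ) := by
  rw [BinForm.cval_eq]; exact eval_cx_ofReal _ _

theorem BinForm.cval_conj (f : BinForm d) (z : Fin 2 → ℂ) :
    f.cval (fun j => starRingEnd ℂ (z j)) = starRingEnd ℂ (f.cval z) := by
  rw [BinForm.cval_eq, BinForm.cval_eq]; exact eval_cx_conj _ _

theorem BinForm.cval_smul (f : BinForm d) (c : ℂ) (z : Fin 2 → ℂ) :
    f.cval (c • z) = c ^ d * f.cval z := by
  rw [BinForm.cval_eq, BinForm.cval_eq, eval_smul_of_isHomogeneous f.isHomogeneous_cpoly]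

theorem ofReal_ne_zero {ι : Type*} {x : ι → ℝ} (hx : x ≠ 0) : (fun j => (x j : ℂ)) ≠ 0 :=
  fun h => hx (funext fun j => by simpa using congrFun h j)

theorem exists_real_root_of_cval_eq_zero {q : BinForm d} {z : Fin 2 → ℂ} (hz : z ≠ 0)
    (hq : q.cval z = 0) {x : Fin 2 → ℝ} {c : ℂ} (hx : z = c • fun j => (x j : ℂ)) :
    x ≠ 0 ∧ q.rval x = 0 := by
  have hc : c ≠ 0 := by
    rintro rfl
    exact hz (by rw [hx, zero_smul])
  refine ⟨?_, ?_⟩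
  · rintro rfl
    apply hz
    rw [hx]
    funext j
    simp
  · rw [hx, BinForm.cval_smul, BinForm.cval_ofReal] at hq
    exact_mod_cast (mul_eq_zero.mp hq).resolve_left (pow_ne_zero d hc)

/-- A real quadratic form without real roots has two different complex roots. -/
theorem exists_roots_of_no_real_root {q : BinForm 2} (h : ∀ x : Fin 2 → ℝ, x ≠ 0 → q.rval x ≠ 0) :
    ∃ z z' : Fin 2 → ℂ, z ≠ 0 ∧ z' ≠ 0 ∧ z 1 * z' 0 - z 0 * z' 1 ≠ 0 ∧
      q.cval z = 0 ∧ q.cval z' = 0 := by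
  obtain ⟨z, hz, hqz⟩ := exists_root q.isHomogeneous_cpoly
  rw [← BinForm.cval_eq] at hqz
  refine ⟨z, fun j => starRingEnd ℂ (z j), hz, ?_, ?_, hqz, ?_⟩
  · intro h0
    apply hz
    funext j
    simpa using congrFun h0 j
  · intro hc
    obtain ⟨c, hc⟩ := exists_smul_of_cross_eq_zero (x := fun j => starRingEnd ℂ (z j)) hz hc
    obtain ⟨a, x, ha, hx, hzx⟩ := exists_real_of_conj_smul hz (c := c) fun i => congrFun hc i
    obtain ⟨h1, h2⟩ := exists_real_root_of_cval_eq_zero hz hqz hzx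
    exact h x h1 h2
  · rw [BinForm.cval_conj, hqz, map_zero]

theorem exists_eq_lin_mul_lin_of_real_root {q : BinForm 2} {x : Fin 2 → ℝ} (hx : x ≠ 0)
    (hqx : q.rval x = 0) : ∃ (t : ℝ) (x' : Fin 2 → ℝ), x' ≠ 0 ∧
      q.toPoly = C t * (lin x * lin x') := by
  obtain ⟨f, hf, hqf⟩ := exists_eq_lin_mul q.isHomogeneous_toPoly hx hqx
  obtain ⟨x', hx', hfx'⟩ := exists_root_of_isHomogeneous_one hf
  obtain ⟨f', hf', hff'⟩ := exists_eq_lin_mul hf hx' hfx'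
  obtain ⟨t, rfl⟩ := eq_C_of_isHomogeneous_zero hf'
  exact ⟨t, x', hx', by rw [hqf, hff']; ring⟩

/-! ### Real points of intersection -/

theorem Param.rvec_smul (l : Param n e) (c : ℝ) (z : Fin 2 → ℝ) :
    l.rvec (c • z) = c ^ e • l.rvec z := by
  funext i
  exact eval_smul_of_isHomogeneous (l.1 i).isHomogeneous_toPoly c z

theorem Param.rvec_ne_zero (l : Param n e) {x : Fin 2 → ℝ} (hx : x ≠ 0) : l.rvec x ≠ 0 := by
  intro h
  refine l.cvec_ne_zero (ofReal_ne_zero hx) ?_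
  funext i
  rw [l.cvec_ofReal, h]
  simp

/-- Σ l_i² = w r is nonzero at every real parameter. So w has no real root, and a real point of the
curve lies on the plane only at a root of q. -/
theorem mem_realIntersection_iff {l : Param 3 e} {X : Plane} {q : BinForm 2} {w : BinForm (e - 2)}
    {r : BinForm (e + 2)}
    (hplane : ∑ i, C (X.normal i) * (l.1 i).toPoly = w.toPoly * q.toPoly)
    (hconic : ∑ i, (l.1 i).toPoly ^ 2 = w.toPoly * r.toPoly) (y : ℙ ℝ (Fin 4 → ℝ)) :
    y ∈ l.realIntersection X ↔
      ∃ (z : Fin 2 → ℝ) (hz : z ≠ 0), q.rval z = 0 ∧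
        y = Projectivization.mk ℝ (l.rvec z) (l.rvec_ne_zero hz) := by
  have key : ∀ z : Fin 2 → ℝ, z ≠ 0 → (∑ i, X.normal i * l.rvec z i = 0 ↔ q.rval z = 0) := by
    intro z hz
    have h1 := congrArg (eval z) hplane
    have h2 := congrArg (eval z) hconic
    simp only [map_sum, map_mul, map_pow, eval_C] at h1 h2
    have hw : eval z w.toPoly ≠ 0 := by
      intro hw
      rw [hw, zero_mul] at h2
      exact l.sum_sq_ne_zero hz h2
    change ∑ i, X.normal i * eval z (l.1 i).toPoly = 0 ↔ eval z q.toPoly = 0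
    rw [h1, mul_eq_zero]
    tauto
  constructor
  · rintro ⟨hX, z, hz, c, hc⟩
    have hc0 : c ≠ 0 := by
      rintro rfl
      exact y.rep_nonzero (by rw [hc, zero_smul])
    refine ⟨z, hz, (key z hz).mp ?_, ?_⟩
    · unfold Plane.Contains at hX
      rw [hc] at hX
      have : c * ∑ i, X.normal i * l.rvec z i = 0 := by
        rw [← hX, Finset.mul_sum]
        refine Finset.sum_congr rfl fun i _ => ?_
        rw [Pi.smul_apply, smul_eq_mul]; ring
      exact (mul_eq_zero.mp this).resolve_left hc0
    · rw [← y.mk_rep, Projectivization.mk_eq_mk_iff']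
      exact ⟨c, hc.symm⟩
  · rintro ⟨z, hz, hq, rfl⟩
    obtain ⟨a, ha⟩ := Projectivization.exists_smul_eq_mk_rep ℝ (l.rvec z) (l.rvec_ne_zero hz)
    refine ⟨?_, z, hz, a, by rw [← ha]; rfl⟩
    unfold Plane.Contains
    rw [← ha]
    have := (key z hz).mpr hq
    calc ∑ i, X.normal i * (a • l.rvec z) i = (a : ℝ) * ∑ i, X.normal i * l.rvec z i := by
          rw [Finset.mul_sum]
          refine Finset.sum_congr rfl fun i _ => ?_
          rw [Pi.smul_apply, Units.smul_def, smul_eq_mul]; ring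
      _ = 0 := by rw [this, mul_zero]

theorem realIntersection_eq_empty {l : Param 3 e} {X : Plane} {q : BinForm 2} {w : BinForm (e - 2)}
    {r : BinForm (e + 2)}
    (hplane : ∑ i, C (X.normal i) * (l.1 i).toPoly = w.toPoly * q.toPoly)
    (hconic : ∑ i, (l.1 i).toPoly ^ 2 = w.toPoly * r.toPoly)
    (hq : ∀ x : Fin 2 → ℝ, x ≠ 0 → q.rval x ≠ 0) : l.realIntersection X = ∅ := by
  rw [Set.eq_empty_iff_forall_notMem]
  intro y hy
  obtain ⟨z, hz, hqz, -⟩ := (mem_realIntersection_iff hplane hconic y).mp hy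
  exact hq z hz hqz

theorem realIntersection_eq_pair {l : Param 3 e} {X : Plane} {q : BinForm 2} {w : BinForm (e - 2)}
    {r : BinForm (e + 2)}
    (hplane : ∑ i, C (X.normal i) * (l.1 i).toPoly = w.toPoly * q.toPoly)
    (hconic : ∑ i, (l.1 i).toPoly ^ 2 = w.toPoly * r.toPoly) {x x' : Fin 2 → ℝ} (hx : x ≠ 0)
    (hx' : x' ≠ 0) {t : ℝ} (ht : t ≠ 0) (hq : q.toPoly = C t * (lin x * lin x')) :
    l.realIntersection X = {Projectivization.mk ℝ (l.rvec x) (l.rvec_ne_zero hx),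
      Projectivization.mk ℝ (l.rvec x') (l.rvec_ne_zero hx')} := by
  have hev : ∀ z, q.rval z = t * ((x 1 * z 0 - x 0 * z 1) * (x' 1 * z 0 - x' 0 * z 1)) := by
    intro z
    rw [BinForm.rval, hq]
    simp
  have hmk : ∀ {x z : Fin 2 → ℝ} (hx : x ≠ 0) (hz : z ≠ 0), x 1 * z 0 - x 0 * z 1 = 0 →
      Projectivization.mk ℝ (l.rvec z) (l.rvec_ne_zero hz) =
        Projectivization.mk ℝ (l.rvec x) (l.rvec_ne_zero hx) := by
    intro x z hx hz h
    obtain ⟨c, rfl⟩ := exists_smul_of_cross_eq_zero hx h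
    rw [Projectivization.mk_eq_mk_iff']
    exact ⟨c ^ e, (l.rvec_smul c x).symm⟩
  ext y
  rw [mem_realIntersection_iff hplane hconic, Set.mem_insert_iff, Set.mem_singleton_iff]
  constructor
  · rintro ⟨z, hz, hqz, rfl⟩
    rw [hev] at hqz
    rcases mul_eq_zero.mp ((mul_eq_zero.mp hqz).resolve_left ht) with h | h
    · exact .inl (hmk hx hz h)
    · exact .inr (hmk hx' hz h)
  · rintro (rfl | rfl)
    · exact ⟨x, hx, by rw [hev]; ring, rfl⟩
    · exact ⟨x', hx', by rw [hev]; ring, rfl⟩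

/-- Without real roots, q has two conjugate ones. With one real root the other is real too, and a
double root would give exactly one real point of intersection. -/
theorem roots_of_encard {l : Param 3 e} {X : Plane} {q : BinForm 2} {w : BinForm (e - 2)}
    {r : BinForm (e + 2)}
    (hplane : ∑ i, C (X.normal i) * (l.1 i).toPoly = w.toPoly * q.toPoly)
    (hconic : ∑ i, (l.1 i).toPoly ^ 2 = w.toPoly * r.toPoly) (hq : q.toPoly ≠ 0)
    (hcard : (l.realIntersection X).encard ≠ 1) :
    ∃ z z' : Fin 2 → ℂ, z ≠ 0 ∧ z' ≠ 0 ∧ z 1 * z' 0 - z 0 * z' 1 ≠ 0 ∧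
      q.cval z = 0 ∧ q.cval z' = 0 := by
  by_cases h : ∀ x : Fin 2 → ℝ, x ≠ 0 → q.rval x ≠ 0
  · exact exists_roots_of_no_real_root h
  · push Not at h
    obtain ⟨x, hx, hqx⟩ := h
    obtain ⟨t, x', hx', hqt⟩ := exists_eq_lin_mul_lin_of_real_root hx hqx
    have ht : t ≠ 0 := by
      rintro rfl
      exact hq (by rw [hqt]; simp)
    refine ⟨_, _, ofReal_ne_zero hx, ofReal_ne_zero hx', ?_, ?_, ?_⟩
    · intro hc
      have hc' : x 1 * x' 0 - x 0 * x' 1 = 0 := by exact_mod_cast hc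
      obtain ⟨c, rfl⟩ := exists_smul_of_cross_eq_zero hx hc'
      apply hcard
      rw [realIntersection_eq_pair hplane hconic hx hx' ht hqt]
      have : Projectivization.mk ℝ (l.rvec (c • x)) (l.rvec_ne_zero hx') =
          Projectivization.mk ℝ (l.rvec x) (l.rvec_ne_zero hx) := by
        rw [Projectivization.mk_eq_mk_iff']
        exact ⟨c ^ e, (l.rvec_smul c x).symm⟩
      rw [this, Set.pair_eq_singleton, Set.encard_singleton]
    · rw [BinForm.cval_ofReal, hqx, Complex.ofReal_zero]
    · rw [BinForm.cval_ofReal, BinForm.rval, hqt]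
      simp [mul_comm]

/-! ### From pairs to nodal curves -/

/-- A common root of the new coordinates would be a root of r, as p_0 ≠ 0, and then of q, as the l_i
have no common root. The last clause keeps the coefficients explicit, for a later proof of
continuity. -/
theorem exists_projects {l : Param 3 e} {p : Fin 5 → ℝ} {q : BinForm 2} {w : BinForm (e - 2)}
    {r : BinForm (e + 2)} (hd : d = e + 2)
    (sphere : ∑ i : Fin 4, p i.succ ^ 2 = p 0 ^ 2) (p_ne : p 0 ≠ 0)
    (plane : ∑ i, C (p (Fin.succ i)) * (l.1 i).toPoly = w.toPoly * q.toPoly)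
    (conic : ∑ i, (l.1 i).toPoly ^ 2 = w.toPoly * r.toPoly)
    (coprime : ∀ z : Fin 2 → ℂ, z ≠ 0 → ¬ (q.cval z = 0 ∧ r.cval z = 0))
    (roots : ∃ z z' : Fin 2 → ℂ, z ≠ 0 ∧ z' ≠ 0 ∧ z 1 * z' 0 - z 0 * z' 1 ≠ 0 ∧
      q.cval z = 0 ∧ q.cval z' = 0) :
    ∃ k : Param 4 d, Projects k l p q w r ∧ (∀ j, k.1 j = Fin.cases (ofPoly d (C (-(p 0 / 2)) *
      r.toPoly)) (fun i => ofPoly d (q.toPoly * (l.1 i).toPoly - C (p i.succ / 2) * r.toPoly)) j) := by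
  subst hd
  have h0 : (C (-(p 0 / 2)) * r.toPoly).IsHomogeneous (e + 2) := r.isHomogeneous_toPoly.C_mul _
  have h1 : ∀ i : Fin 4, (q.toPoly * (l.1 i).toPoly - C (p i.succ / 2) * r.toPoly).IsHomogeneous
      (e + 2) := by
    intro i
    have := q.isHomogeneous_toPoly.mul (l.1 i).isHomogeneous_toPoly
    rw [add_comm 2] at this
    exact this.sub (r.isHomogeneous_toPoly.C_mul _)
  let f : Fin 5 → BinForm (e + 2) := Fin.cases (ofPoly (e + 2) (C (-(p 0 / 2)) * r.toPoly))
    fun i => ofPoly (e + 2) (q.toPoly * (l.1 i).toPoly - C (p i.succ / 2) * r.toPoly)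
  have hf0 : (f 0).toPoly = C (-(p 0 / 2)) * r.toPoly := toPoly_ofPoly h0
  have hf1 : ∀ i : Fin 4, (f i.succ).toPoly = q.toPoly * (l.1 i).toPoly - C (p i.succ / 2) * r.toPoly :=
    fun i => toPoly_ofPoly (h1 i)
  have hne : ∀ z : Fin 2 → ℂ, z ≠ 0 → ∃ i, (f i).cval z ≠ 0 := by
    intro z hz
    by_contra! h
    have h2 := h 0
    rw [BinForm.cval_eq, BinForm.cpoly, hf0, cx, map_mul, map_mul, map_C, eval_C] at h2
    have hr : eval z r.cpoly = 0 := (mul_eq_zero.mp h2).resolve_left (by simpa using p_ne)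
    obtain ⟨i, hi⟩ := Function.ne_iff.mp (l.cvec_ne_zero hz)
    have h3 := h i.succ
    rw [BinForm.cval_eq, BinForm.cpoly, hf1] at h3
    simp only [cx, map_sub, map_mul] at h3 hr
    rw [hr, mul_zero, sub_zero] at h3
    refine coprime z hz ⟨?_, by rw [BinForm.cval_eq]; exact hr⟩
    rw [BinForm.cval_eq]
    refine (mul_eq_zero.mp h3).resolve_right ?_
    rw [l.cvec_apply] at hi
    exact hi
  exact ⟨⟨f, hne⟩, ⟨sphere, p_ne, plane, conic, hf0, hf1, coprime, roots⟩, fun j => rfl⟩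

theorem Param.MeetsConic.act {l : Param 3 e} {X : Plane} (h : l.MeetsConic X) (A : GL (Fin 2) ℝ)
    (c : ℝˣ) : (l.act A c).MeetsConic X := by
  obtain ⟨w, q, r, h1, h2, h3⟩ := h
  refine ⟨w.act A (c : ℝ), q.act A 1, r.act A (c : ℝ), ?_, ?_, ?_⟩
  · have := congrArg (subst (A : Matrix (Fin 2) (Fin 2) ℝ)) h1
    simp only [map_sum, map_mul, subst_C] at this
    simp only [Param.toPoly_act, BinForm.toPoly_act, C_1, one_mul, mul_assoc, ← this,
      Finset.mul_sum]
    exact Finset.sum_congr rfl fun i _ => by ring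
  · have := congrArg (subst (A : Matrix (Fin 2) (Fin 2) ℝ)) h2
    simp only [map_sum, map_mul, map_pow] at this
    simp only [Param.toPoly_act, BinForm.toPoly_act, mul_pow, ← Finset.mul_sum, this]
    ring
  · rintro z hz ⟨h4, h5⟩
    rw [BinForm.cval_act] at h4 h5
    refine h3 _ (cmat_mulVec_ne_zero A hz) ⟨?_, ?_⟩
    · exact (mul_eq_zero.mp h4).resolve_left (by simp)
    · exact (mul_eq_zero.mp h5).resolve_left (by exact_mod_cast c.ne_zero)

theorem exists_normal_eq_smul {v : Fin 4 → ℝ} (hv : v ≠ 0) :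
    ∃ a : ℝ, a ≠ 0 ∧ Plane.normal (Projectivization.mk ℝ v hv) = a • v := by
  obtain ⟨a, ha⟩ := Projectivization.exists_smul_eq_mk_rep ℝ v hv
  exact ⟨a, a.ne_zero, ha.symm⟩

/-- Every pair comes from a nodal curve. -/
theorem exists_projects_of_mem {P : Curve 3 e × Plane} (he : e ≠ 0) (hd : d = e + 2)
    (hP : P ∈ conicPairSpace e 0 ∪ conicPairSpace e 2) {l : Param 3 e} (hl : l.Parametrizes P.1)
    {p : Fin 5 → ℝ} (sphere : ∑ i : Fin 4, p i.succ ^ 2 = p 0 ^ 2) (p_ne : p 0 ≠ 0)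
    (hp : (fun i => p (Fin.succ i)) ≠ 0) (hX : P.2 = Projectivization.mk ℝ _ hp) :
    l.IsKnot ∧ ∃ (k : Param 4 d) (q : BinForm 2) (w : BinForm (e - 2)) (r : BinForm (e + 2)),
      Projects k l p q w r := by
  obtain ⟨l₁, hl₁, hknot, hcard⟩ : ∃ l₁ : Param 3 e, l₁.Parametrizes P.1 ∧ l₁.IsKnot ∧
      (l₁.realIntersection P.2).encard ≠ 1 := by
    rcases hP with ⟨⟨l₁, h1, h2, h3⟩, -⟩ | ⟨⟨l₁, h1, h2, h3⟩, -⟩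
    · exact ⟨l₁, h1, h2, by rw [h3]; simp⟩
    · exact ⟨l₁, h1, h2, by rw [h3]; norm_num⟩
  obtain ⟨l₂, hl₂, hconic⟩ : ∃ l₂ : Param 3 e, l₂.Parametrizes P.1 ∧ l₂.MeetsConic P.2 := by
    rcases hP with ⟨-, h⟩ | ⟨-, h⟩ <;> exact h
  -- The knot and conic conditions are witnessed by possibly different parametrizations; bring them
  -- to a common one.
  obtain ⟨A, c, rfl⟩ := Param.mk_eq_iff.mp (hl₂.trans hl₁.symm)
  obtain ⟨w, q, r, h1, h2, h3⟩ := hconic.act A c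
  have hq : q.toPoly ≠ 0 := cx_toPoly_ne_zero.mp (cpoly_ne_zero_of_coprime h3)
  have hroots := roots_of_encard h1 h2 hq hcard
  obtain ⟨a, ha, hn⟩ := exists_normal_eq_smul hp
  rw [hX] at h1
  rw [hn] at h1
  -- The chosen normal vector of the plane is a times the tail of p; the factor is absorbed by w and
  -- compensated in r.
  have hpl : ∑ i, C (p (Fin.succ i)) * ((l₂.act A c).1 i).toPoly = (a⁻¹ • w).toPoly * q.toPoly := by
    rw [toPoly_smul, mul_assoc, ← h1, Finset.mul_sum]
    refine Finset.sum_congr rfl fun i _ => ?_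
    rw [← mul_assoc, ← C_mul, Pi.smul_apply, smul_eq_mul, inv_mul_cancel_left₀ ha]
  have hco : ∑ i, ((l₂.act A c).1 i).toPoly ^ 2 = (a⁻¹ • w).toPoly * (a • r).toPoly := by
    rw [h2, toPoly_smul, toPoly_smul]
    have : C a⁻¹ * C a = (1 : MvPolynomial (Fin 2) ℝ) := by rw [← C_mul, inv_mul_cancel₀ ha, C_1]
    linear_combination -w.toPoly * r.toPoly * this
  obtain ⟨k, hk, -⟩ := exists_projects (d := d) hd sphere p_ne hpl hco (by
    rintro z hz ⟨h4, h5⟩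
    refine h3 z hz ⟨h4, ?_⟩
    rw [BinForm.cval_eq, BinForm.cpoly, toPoly_smul, cx, map_mul, map_mul, map_C, eval_C] at h5
    rw [BinForm.cval_eq]
    exact (mul_eq_zero.mp h5).resolve_left (by simpa using ha)) hroots
  obtain ⟨B, b, rfl⟩ := Param.mk_eq_iff.mp (hl₁.trans hl.symm)
  exact ⟨hknot.act he B b, _, _, _, _, hk.act B b⟩

/-! ### From nodal curves to pairs -/

theorem Projects.tail_ne_zero {k : Param 4 d} {l : Param 3 e} {p : Fin 5 → ℝ} {q : BinForm 2}
    {w : BinForm (e - 2)} {r : BinForm (e + 2)} (h : Projects k l p q w r) :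
    (fun i => p (Fin.succ i)) ≠ 0 := by
  intro h0
  have h1 := h.sphere
  have h2 : ∀ i : Fin 4, p i.succ = 0 := fun i => congrFun h0 i
  simp only [h2, ne_eq, OfNat.ofNat_ne_zero, not_false_eq_true, zero_pow, Finset.sum_const_zero] at h1
  exact h.p_ne (pow_eq_zero_iff two_ne_zero |>.mp h1.symm)

/-- Real points of intersection correspond to real roots of q. One real root entails a second, and
the two points differ because q has simple roots and l is injective. -/
theorem Projects.mem_conicPairSpace {k : Param 4 d} {l : Param 3 e} {p : Fin 5 → ℝ} {q : BinForm 2}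
    {w : BinForm (e - 2)} {r : BinForm (e + 2)} (h : Projects k l p q w r) (hl : l.IsKnot) :
    ((∀ x : Fin 2 → ℝ, x ≠ 0 → q.rval x ≠ 0) →
      ((Quotient.mk (curveSetoid 3 e) l : Curve 3 e),
        (Projectivization.mk ℝ _ h.tail_ne_zero : Plane)) ∈ conicPairSpace e 0) ∧
    ((∃ x : Fin 2 → ℝ, x ≠ 0 ∧ q.rval x = 0) →
      ((Quotient.mk (curveSetoid 3 e) l : Curve 3 e),
        (Projectivization.mk ℝ _ h.tail_ne_zero : Plane)) ∈ conicPairSpace e 2) := by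
  set X : Plane := Projectivization.mk ℝ _ h.tail_ne_zero with hX
  obtain ⟨a, ha, hn⟩ := exists_normal_eq_smul h.tail_ne_zero
  rw [← hX] at hn
  have hpl : ∑ i, C (X.normal i) * (l.1 i).toPoly = (a • w).toPoly * q.toPoly := by
    rw [toPoly_smul, mul_assoc, ← h.plane, Finset.mul_sum]
    refine Finset.sum_congr rfl fun i _ => ?_
    rw [hn, ← mul_assoc, ← C_mul, Pi.smul_apply, smul_eq_mul]
  have hco : ∑ i, (l.1 i).toPoly ^ 2 = (a • w).toPoly * (a⁻¹ • r).toPoly := by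
    rw [h.conic, toPoly_smul, toPoly_smul]
    have : C a * C a⁻¹ = (1 : MvPolynomial (Fin 2) ℝ) := by rw [← C_mul, mul_inv_cancel₀ ha, C_1]
    linear_combination -w.toPoly * r.toPoly * this
  have hmeets : l.MeetsConic X := by
    refine ⟨_, _, _, hpl, hco, ?_⟩
    rintro z hz ⟨h4, h5⟩
    refine h.coprime z hz ⟨h4, ?_⟩
    rw [BinForm.cval_eq, BinForm.cpoly, toPoly_smul, cx, map_mul, map_mul, map_C, eval_C] at h5
    rw [BinForm.cval_eq]
    exact (mul_eq_zero.mp h5).resolve_left (by simpa using ha)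
  constructor
  · intro hq
    refine ⟨⟨l, rfl, hl, ?_⟩, l, rfl, hmeets⟩
    change (l.realIntersection X).encard = _
    rw [realIntersection_eq_empty hpl hco hq]
    simp
  · rintro ⟨x, hx, hqx⟩
    refine ⟨⟨l, rfl, hl, ?_⟩, l, rfl, hmeets⟩
    obtain ⟨t, x', hx', hqt⟩ := exists_eq_lin_mul_lin_of_real_root hx hqx
    have ht : t ≠ 0 := by
      rintro rfl
      exact cx_toPoly_ne_zero.mp h.q_ne_zero (by rw [hqt]; simp)
    change (l.realIntersection X).encard = _
    rw [realIntersection_eq_pair hpl hco hx hx' ht hqt, Set.encard_pair]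
    · norm_num
    · intro heq
      have hxx : x 1 * x' 0 - x 0 * x' 1 = 0 := by
        rw [eq_comm, Projectivization.mk_eq_mk_iff'] at heq
        obtain ⟨c, hc⟩ := heq
        have := hl.1 ((l.cmap_mk_eq_iff (ofReal_ne_zero hx) (ofReal_ne_zero hx')).mpr ⟨c, by
          funext i
          rw [Pi.smul_apply, l.cvec_ofReal, l.cvec_ofReal, ← hc]
          simp⟩)
        rw [mk_eq_mk_iff_cross] at this
        exact_mod_cast this
      obtain ⟨c, rfl⟩ := exists_smul_of_cross_eq_zero hx hxx
      obtain ⟨z, z', hz, hz', hzz, hqz, hqz'⟩ := h.roots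
      have hc : c ≠ 0 := by
        rintro rfl
        exact hx' (zero_smul _ _)
      -- If the real factors were proportional, q would be a multiple of a square and have only one
      -- root.
      have key : ∀ y : Fin 2 → ℂ, q.cval y = 0 → x 1 * y 0 - x 0 * y 1 = 0 := by
        intro y hy
        have h1 := congrArg (fun f => eval y (cx f)) hqt
        rw [lin_smul] at h1
        rw [BinForm.cval_eq] at hy
        have hy' : eval y (MvPolynomial.map (algebraMap ℝ ℂ) q.toPoly) = 0 := hy
        simp only [cx, lin, map_mul, map_sub, map_C, map_X, eval_C, eval_X, hy'] at h1
        have h2 : ((t : ℂ) * c) * (x 1 * y 0 - x 0 * y 1) ^ 2 = 0 := by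
          simp only [Complex.coe_algebraMap] at h1
          linear_combination -h1
        exact pow_eq_zero_iff two_ne_zero |>.mp ((mul_eq_zero.mp h2).resolve_left
          (mul_ne_zero (by exact_mod_cast ht) (by exact_mod_cast hc)))
      exact hzz (cross_eq_zero_trans (ofReal_ne_zero hx) (key z hqz) (key z' hqz'))

/-- The only pair identified by k is the pair of roots of q. -/
theorem Projects.isSolitary_iff {k : Param 4 d} {l : Param 3 e} {p : Fin 5 → ℝ} {q : BinForm 2}
    {w : BinForm (e - 2)} {r : BinForm (e + 2)} (h : Projects k l p q w r) (he : e ≠ 0)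
    (hl : l.IsKnot) : k.IsSolitary ↔ ∀ x : Fin 2 → ℝ, x ≠ 0 → q.rval x ≠ 0 := by
  constructor
  · intro hk x hx hqx
    obtain ⟨z, z', hz, hz', hzz, hqz, hqz'⟩ := h.roots
    have hqx' : q.cval (fun j => (x j : ℂ)) = 0 := by rw [BinForm.cval_ofReal, hqx]; simp
    obtain ⟨y, hy, hxy, hqy⟩ : ∃ y : Fin 2 → ℂ, y ≠ 0 ∧ (x 1 : ℂ) * y 0 - x 0 * y 1 ≠ 0 ∧
        q.cval y = 0 := by
      by_cases h1 : (x 1 : ℂ) * z 0 - x 0 * z 1 = 0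
      · exact ⟨z', hz', fun h2 => hzz (cross_eq_zero_trans (ofReal_ne_zero hx) h1 h2), hqz'⟩
      · exact ⟨z, hz, h1, hqz⟩
    refine (hk (.mk ℂ _ (ofReal_ne_zero hx)) (.mk ℂ y hy) ?_ ?_).1 ?_
    · rwa [ne_eq, mk_eq_mk_iff_cross]
    · rw [k.cmap_mk_eq_iff]
      exact h.cvec_root_eq_smul (ofReal_ne_zero hx) hqx' hqy
    · obtain ⟨a, ha⟩ := Projectivization.exists_smul_eq_mk_rep ℂ _ (ofReal_ne_zero hx)
      exact ⟨x, a, ha.symm⟩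
  · intro hq P Q hPQ hmap
    obtain ⟨z, z', hz, hz', hzz, hqz, hqz'⟩ := h.roots
    have hn := h.isNode he hl hz hz' hzz hqz hqz'
    obtain ⟨c, hc, hqc⟩ := h.q_eq hz hz' hzz hqz hqz'
    have hP := P.rep_nonzero
    have hQ := Q.rep_nonzero
    rw [← P.mk_rep, ← Q.mk_rep] at hmap hPQ
    rw [k.cmap_mk_eq_iff] at hmap
    rw [ne_eq, mk_eq_mk_iff_cross] at hPQ
    obtain ⟨s, hs⟩ := hmap
    have hpin := k.pinch_of_cvec_eq_smul hP hQ hPQ (one_smul _ _).symm hs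
    obtain ⟨c', hc'⟩ := hn.unique _ _ ((isHomogeneous_lin _).mul (isHomogeneous_lin _))
      (mul_ne_zero (lin_ne_zero hP) (lin_ne_zero hQ)) (k.cvec_ne_zero hP) hpin
    have hroot : q.cval P.rep = 0 ∧ q.cval Q.rep = 0 := by
      rcases cross_eq_zero_of_lin_mul_lin hP hQ hzz hc' with ⟨h1, h2⟩ | ⟨h1, h2⟩
      · rw [BinForm.cval_eq, BinForm.cval_eq, hqc]
        simp only [map_mul, eval_lin]
        constructor
        · linear_combination (-eval P.rep (C c) * (z' 1 * P.rep 0 - z' 0 * P.rep 1)) * h1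
        · linear_combination (-eval Q.rep (C c) * (z 1 * Q.rep 0 - z 0 * Q.rep 1)) * h2
      · rw [BinForm.cval_eq, BinForm.cval_eq, hqc]
        simp only [map_mul, eval_lin]
        constructor
        · linear_combination (-eval P.rep (C c) * (z 1 * P.rep 0 - z 0 * P.rep 1)) * h1
        · linear_combination (-eval Q.rep (C c) * (z' 1 * Q.rep 0 - z' 0 * Q.rep 1)) * h2
    constructor
    · rintro ⟨x, b, hx⟩
      obtain ⟨h1, h2⟩ := exists_real_root_of_cval_eq_zero hP hroot.1 hx
      exact hq x h1 h2
    · rintro ⟨x, b, hx⟩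
      obtain ⟨h1, h2⟩ := exists_real_root_of_cval_eq_zero hQ hroot.2 hx
      exact hq x h1 h2

theorem Projects.stereo_eq {k : Param 4 d} {l : Param 3 e} {p : Fin 5 → ℝ} {q : BinForm 2}
    {w : BinForm (e - 2)} {r : BinForm (e + 2)} (h : Projects k l p q w r) (z : Fin 2 → ℂ) :
    stereo p (k.cvec z) = ((p 0 : ℂ) * q.cval z) • l.cvec z := by
  funext i
  have := congrArg (eval z) (h.project i)
  simp only [map_sub, map_mul, eval_C, ← k.cvec_apply, ← l.cvec_apply, ← BinForm.cval_eq] at this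
  simp only [stereo, Pi.smul_apply, smul_eq_mul]
  linear_combination this

theorem Projects.isStereographicProjection {k : Param 4 d} {l : Param 3 e} {p : Fin 5 → ℝ}
    {q : BinForm 2} {w : BinForm (e - 2)} {r : BinForm (e + 2)} (h : Projects k l p q w r)
    {K : Curve 4 d} {P : Curve 3 e × Plane} (hk : k.Parametrizes K) (hl : l.Parametrizes P.1)
    (hX : P.2 = Projectivization.mk ℝ _ h.tail_ne_zero) : IsStereographicProjection K P := by
  refine ⟨k, l, p, hk, hl, h.isDoublePoint, fun z hz => ?_, fun y => ?_⟩
  · rw [h.stereo_eq] at hz ⊢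
    refine ⟨((p 0 : ℂ) * q.cval z)⁻¹, ?_⟩
    rw [smul_smul, inv_mul_cancel₀, one_smul]
    intro h0
    exact hz (by rw [h0, zero_smul])
  · obtain ⟨a, ha, hn⟩ := exists_normal_eq_smul h.tail_ne_zero
    unfold Plane.Contains
    rw [hX, hn]
    have : ∑ i, (a • fun i : Fin 4 => p i.succ) i * y i = a * ∑ i : Fin 4, p i.succ * y i := by
      rw [Finset.mul_sum]
      refine Finset.sum_congr rfl fun i _ => ?_
      rw [Pi.smul_apply, smul_eq_mul]; ring
    rw [this, mul_eq_zero]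
    tauto

end RationalKnot
end

noncomputable section

namespace RationalKnot

open MvPolynomial Matrix Topology Filter
open scoped LinearAlgebra.Projectivization

/-! ### Topological preliminaries -/

section Topology

/-- The quotient by a free involution is a covering map if an equivariant map to a normed space
separates the two points of each orbit. -/
theorem isCoveringMap_of_involution {E B V : Type*} [TopologicalSpace E] [TopologicalSpace B]
    [NormedAddCommGroup V] [NormedSpace ℝ V] {φ : E → B} (hφ : IsQuotientMap φ) {τ : E → E}
    (hτ : Continuous τ) (hττ : ∀ x, τ (τ x) = x) (hfib : ∀ x y, φ x = φ y ↔ x = y ∨ x = τ y)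
    {ν : E → V} (hν : Continuous ν) (hντ : ∀ x, ν (τ x) = -ν x) (hν0 : ∀ x, ν x ≠ 0) :
    IsCoveringMap φ := by
  -- The group of order two acts through τ, so that the criterion for quotients by properly
  -- discontinuous actions applies.
  let act : MulAction ℤˣ E :=
    { smul := fun u x => if u = 1 then x else τ x
      one_smul := fun x => if_pos rfl
      mul_smul := fun u v x => by
        change (if u * v = 1 then x else τ x) =
          if u = 1 then (if v = 1 then x else τ x) else τ (if v = 1 then x else τ x)
        rcases Int.units_eq_one_or u with rfl | rfl <;> rcases Int.units_eq_one_or v with rfl | rfl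
        · simp
        · simp
        · simp
        · simp [hττ] }
  have hneg : ∀ x : E, (-1 : ℤˣ) • x = τ x := fun x => if_neg (by decide)
  have hone : ∀ x : E, (1 : ℤˣ) • x = x := fun x => one_smul _ x
  have hcov : IsQuotientCoveringMap φ ℤˣ := by
    refine (isQuotientCoveringMap_iff φ ℤˣ).mpr ⟨hφ, ⟨fun u => ?_⟩, @fun x y => ?_,
      fun x => ⟨{y | ‖ν y - ν x‖ < ‖ν x‖}, ?_, fun u hu => ?_⟩⟩
    · rcases Int.units_eq_one_or u with rfl | rfl
      · simpa only [hone] using continuous_id'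
      · simpa only [hneg] using hτ
    · rw [hfib, MulAction.mem_orbit_iff]
      constructor
      · rintro (rfl | rfl)
        · exact ⟨1, hone _⟩
        · exact ⟨-1, hneg _⟩
      · rintro ⟨u, rfl⟩
        rcases Int.units_eq_one_or u with rfl | rfl
        · exact .inl (hone _)
        · exact .inr (hneg _)
    · refine (isOpen_lt (by fun_prop) continuous_const).mem_nhds ?_
      simpa using hν0 x
    · rcases Int.units_eq_one_or u with rfl | rfl
      · rfl
      · exfalso
        obtain ⟨_, ⟨y, hy, rfl⟩, hy'⟩ := hu
        simp only [hneg, Set.mem_ofPred_eq, hντ] at hy hy'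
        -- If y and τ y were both in the neighbourhood of x, adding the two estimates would give 2‖ν
        -- x‖ < 2‖ν x‖.
        have h1 : ‖(ν y - ν x) + (-ν y - ν x)‖ < ‖ν x‖ + ‖ν x‖ :=
          (norm_add_le _ _).trans_lt (add_lt_add hy hy')
        have h2 : (ν y - ν x) + (-ν y - ν x) = (-2 : ℝ) • ν x := by
          rw [neg_smul, two_smul]; abel
        rw [h2, norm_smul] at h1
        norm_num at h1
        linarith
  exact hcov.isCoveringMap

/-- Base change of a proper map. -/
theorem isProperMap_pullback {X M Y : Type*} [TopologicalSpace X] [TopologicalSpace M]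
    [TopologicalSpace Y] {m : M → Y} (hm : IsProperMap m) {f : X → Y} (hf : Continuous f) :
    IsProperMap fun z : {z : X × M // f z.1 = m z.2} => z.1.1 := by
  rw [isProperMap_iff_ultrafilter]
  refine ⟨by fun_prop, fun 𝒰 x hx => ?_⟩
  have h1 : Tendsto (fun z : {z : X × M // f z.1 = m z.2} => m z.1.2) 𝒰 (𝓝 (f x)) := by
    have : (fun z : {z : X × M // f z.1 = m z.2} => m z.1.2) =
        f ∘ fun z : {z : X × M // f z.1 = m z.2} => z.1.1 := by
      funext z
      exact z.2.symm
    rw [this]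
    exact (hf.tendsto x).comp hx
  have h2 : Tendsto m (𝒰.map fun z => z.1.2 : Ultrafilter M) (𝓝 (f x)) := h1
  obtain ⟨a, ha, ha'⟩ := hm.ultrafilter_le_nhds_of_tendsto h2
  refine ⟨⟨(x, a), ha.symm⟩, rfl, ?_⟩
  rw [nhds_subtype_eq_comap, nhds_prod_eq, ← map_le_iff_le_comap]
  exact Filter.Tendsto.prodMk hx ha'

/-- A continuous map without zero divisors which is homogeneous in the second variable is proper
if the first variable is restricted to the unit sphere. -/
theorem isProperMap_of_no_zero_divisors {V W U : Type*} [NormedAddCommGroup V] [NormedSpace ℝ V]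
    [FiniteDimensional ℝ V] [NormedAddCommGroup W] [NormedSpace ℝ W] [FiniteDimensional ℝ W]
    [NormedAddCommGroup U] [NormedSpace ℝ U] [FiniteDimensional ℝ U] (B : V → W → U)
    (hB : Continuous fun x : V × W => B x.1 x.2) (hsmul : ∀ a (t : ℝ) b, B a (t • b) = t • B a b)
    (h0 : ∀ a b, a ≠ 0 → b ≠ 0 → B a b ≠ 0) :
    IsProperMap fun x : Metric.sphere (0 : V) 1 × W => B x.1 x.2 := by
  have : ProperSpace V := FiniteDimensional.proper ℝ V
  have : ProperSpace W := FiniteDimensional.proper ℝ W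
  have : ProperSpace U := FiniteDimensional.proper ℝ U
  have hcont : Continuous fun x : Metric.sphere (0 : V) 1 × W => B x.1 x.2 :=
    hB.comp (continuous_subtype_val.prodMap continuous_id)
  -- By compactness B is bounded below on pairs of unit vectors. Homogeneity turns this into c‖b‖ ≤
  -- ‖B a b‖, so preimages of bounded sets are bounded.
  obtain ⟨c, hc, hcB⟩ : ∃ c > 0, ∀ x ∈ Metric.sphere (0 : V) 1 ×ˢ Metric.sphere (0 : W) 1,
      c ≤ ‖B x.1 x.2‖ := by
    refine ((isCompact_sphere (0 : V) 1).prod (isCompact_sphere (0 : W) 1)).exists_forall_le'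
      (hB.norm.continuousOn) ?_
    rintro ⟨a, b⟩ ⟨ha, hb⟩
    refine norm_pos_iff.mpr (h0 a b ?_ ?_)
    · exact ne_zero_of_mem_unit_sphere ⟨a, ha⟩
    · exact ne_zero_of_mem_unit_sphere ⟨b, hb⟩
  have hbound : ∀ a ∈ Metric.sphere (0 : V) 1, ∀ b, c * ‖b‖ ≤ ‖B a b‖ := by
    intro a ha b
    by_cases hb : b = 0
    · simp [hb]
    · have hb' : 0 < ‖b‖ := norm_pos_iff.mpr hb
      have h1 := hcB (a, ‖b‖⁻¹ • b) ⟨ha, by simp [norm_smul, hb'.ne']⟩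
      simp only [hsmul, norm_smul, norm_inv, norm_norm] at h1
      rw [inv_mul_eq_div, le_div_iff₀ hb'] at h1
      exact h1
  rw [isProperMap_iff_isCompact_preimage]
  refine ⟨hcont, fun K hK => ?_⟩
  obtain ⟨R, hR⟩ := hK.isBounded.exists_norm_le
  have : CompactSpace (Metric.sphere (0 : V) 1) :=
    isCompact_iff_compactSpace.mp (isCompact_sphere _ _)
  refine (isCompact_univ.prod (isCompact_closedBall (0 : W) (R / c))).of_isClosed_subset
    (hK.isClosed.preimage hcont) ?_
  rintro ⟨a, b⟩ hab
  refine ⟨trivial, ?_⟩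
  rw [mem_closedBall_zero_iff, le_div_iff₀ hc, mul_comm]
  exact (hbound a a.2 b).trans (hR _ hab)

end Topology

/-! ### Continuity of operations on forms -/

variable {n d e : ℕ}

/-- The polynomial of a form, as a linear map. -/
def toPolyₗ (d : ℕ) : BinForm d →ₗ[ℝ] MvPolynomial (Fin 2) ℝ where
  toFun := BinForm.toPoly
  map_add' := toPoly_add
  map_smul' c f := by rw [toPoly_smul, smul_eq_C_mul]; rfl

theorem continuous_ofPoly_toPoly (d d' : ℕ) : Continuous fun f : BinForm d => ofPoly d' f.toPoly :=
  ((ofPoly d').comp (toPolyₗ d)).continuous_of_finiteDimensional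

theorem BinForm.continuous_act (A : Matrix (Fin 2) (Fin 2) ℝ) (c : ℝ) :
    Continuous fun f : BinForm d => f.act A c := by
  have := ((ofPoly d).comp ((c • (subst A).toLinearMap).comp (toPolyₗ d))).continuous_of_finiteDimensional
  convert this using 2 with f
  simp [BinForm.act, toPolyₗ, smul_eq_C_mul]

/-- The product of two forms, as a form of degree `c`. -/
def mulForm {a b : ℕ} (c : ℕ) (f : BinForm a) (g : BinForm b) : BinForm c :=
  ofPoly c (f.toPoly * g.toPoly)

theorem toPoly_mulForm {a b c : ℕ} (h : a + b = c) (f : BinForm a) (g : BinForm b) :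
    (mulForm c f g).toPoly = f.toPoly * g.toPoly := by
  subst h
  exact toPoly_ofPoly (f.isHomogeneous_toPoly.mul g.isHomogeneous_toPoly)

theorem continuous_mulForm {a b : ℕ} (c : ℕ) :
    Continuous fun x : BinForm a × BinForm b => mulForm c x.1 x.2 := by
  have : (fun x : BinForm a × BinForm b => mulForm c x.1 x.2) = fun x =>
      ∑ i : Fin (a + 1), ∑ j : Fin (b + 1),
      (x.1 i * x.2 j) • ofPoly c (monomial (expo a i + expo b j) 1) := by
    funext x
    rw [mulForm, BinForm.toPoly_eq, BinForm.toPoly_eq, Finset.sum_mul_sum, map_sum]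
    refine Finset.sum_congr rfl fun i _ => ?_
    rw [map_sum]
    refine Finset.sum_congr rfl fun j _ => ?_
    rw [monomial_mul, ← map_smul, smul_monomial, smul_eq_mul, mul_one]
  rw [this]
  fun_prop

theorem mulForm_smul {a b c : ℕ} (f : BinForm a) (t : ℝ) (g : BinForm b) :
    mulForm c f (t • g) = t • mulForm c f g := by
  rw [mulForm, mulForm, toPoly_smul, ← map_smul, smul_eq_C_mul]
  congr 1
  ring

theorem mulForm_ne_zero {a b c : ℕ} (h : a + b = c) {f : BinForm a} {g : BinForm b} (hf : f ≠ 0)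
    (hg : g ≠ 0) : mulForm c f g ≠ 0 := by
  rw [ne_eq, ← toPoly_eq_zero, toPoly_mulForm h, mul_eq_zero, toPoly_eq_zero, toPoly_eq_zero]
  tauto

/-! ### The quotient maps to curves and planes -/

theorem Param.continuous_val : Continuous fun k : Param n d => k.1 := continuous_subtype_val

theorem Param.continuous_mk {X : Type*} [TopologicalSpace X] {f : X → Fin (n + 1) → BinForm d}
    (hf : Continuous f) (h : ∀ x, ∀ z : Fin 2 → ℂ, z ≠ 0 → ∃ i, (f x i).cval z ≠ 0) :
    Continuous fun x => (⟨f x, h x⟩ : Param n d) :=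
  Continuous.subtype_mk hf h

theorem Param.continuous_act (A : GL (Fin 2) ℝ) (c : ℝˣ) :
    Continuous fun k : Param n d => k.act A c := by
  refine Param.continuous_mk ?_ _
  refine continuous_pi fun i => ?_
  exact (BinForm.continuous_act (A : Matrix (Fin 2) (Fin 2) ℝ) (c : ℝ)).comp
    ((continuous_apply i).comp Param.continuous_val)

/-- The curve of a parametrization. -/
def curveMk (n d : ℕ) (k : Param n d) : Curve n d := Quotient.mk (curveSetoid n d) k

theorem curveMk_eq_iff {k l : Param n d} : curveMk n d k = curveMk n d l ↔ ∃ A c, l = k.act A c :=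
  Param.mk_eq_iff

theorem isQuotientMap_curveMk : IsQuotientMap (curveMk n d) := isQuotientMap_quotient_mk'

/-- The saturation of an open set is a union of its preimages under the continuous
reparametrizations. Openness matters because open quotient maps, unlike general ones, restrict to
quotient maps over arbitrary subspaces. -/
theorem isOpenQuotientMap_curveMk (n d : ℕ) : IsOpenQuotientMap (curveMk n d) where
  surjective := Quotient.mk_surjective
  continuous := continuous_quotient_mk'
  isOpenMap U hU := by
    refine isQuotientMap_curveMk.isOpen_preimage.mp ?_
    have : curveMk n d ⁻¹' (curveMk n d '' U) =
        ⋃ (A : GL (Fin 2) ℝ) (c : ℝˣ), (fun k : Param n d => k.act A c) ⁻¹' U := by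
      ext k
      simp only [Set.mem_preimage, Set.mem_image, Set.mem_iUnion]
      constructor
      · rintro ⟨l, hl, h⟩
        obtain ⟨A, c, rfl⟩ := curveMk_eq_iff.mp (h.symm : curveMk n d k = curveMk n d l)
        exact ⟨A, c, hl⟩
      · rintro ⟨A, c, h⟩
        exact ⟨_, h, (curveMk_eq_iff.mpr ⟨A, c, rfl⟩ : curveMk n d k = _).symm⟩
    rw [this]
    exact isOpen_iUnion fun A => isOpen_iUnion fun c => hU.preimage (Param.continuous_act A c)

/-- The plane with a given normal vector. -/
def planeMk (v : {v : Fin 4 → ℝ // v ≠ 0}) : Plane := Projectivization.mk ℝ v.1 v.2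

theorem planeMk_eq_iff {v u : {v : Fin 4 → ℝ // v ≠ 0}} :
    planeMk v = planeMk u ↔ ∃ a : ℝˣ, a • u.1 = v.1 :=
  Projectivization.mk_eq_mk_iff ℝ _ _ _ _

theorem isQuotientMap_planeMk : IsQuotientMap planeMk := isQuotientMap_quotient_mk'

theorem isOpenQuotientMap_planeMk : IsOpenQuotientMap planeMk where
  surjective := Quotient.mk_surjective
  continuous := continuous_quotient_mk'
  isOpenMap U hU := by
    refine isQuotientMap_planeMk.isOpen_preimage.mp ?_
    let f : ℝˣ → {v : Fin 4 → ℝ // v ≠ 0} → {v : Fin 4 → ℝ // v ≠ 0} := fun a v =>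
      ⟨a • v.1, (smul_ne_zero_iff_ne a).mpr v.2⟩
    have hf : ∀ a, Continuous (f a) := fun a => by
      refine Continuous.subtype_mk ?_ _
      exact (continuous_const_smul a).comp continuous_subtype_val
    have : planeMk ⁻¹' (planeMk '' U) =
        ⋃ a : ℝˣ, f a ⁻¹' U := by
      ext v
      simp only [Set.mem_preimage, Set.mem_image, Set.mem_iUnion]
      constructor
      · rintro ⟨u, hu, h⟩
        obtain ⟨a, ha⟩ := planeMk_eq_iff.mp (h : planeMk u = planeMk v)
        refine ⟨a, ?_⟩
        have : f a v = u := Subtype.ext ha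
        rwa [this]
      · rintro ⟨a, h⟩
        exact ⟨_, h, (planeMk_eq_iff.mpr ⟨a, rfl⟩ : planeMk (f a v) = planeMk v)⟩
    rw [this]
    exact isOpen_iUnion fun a => hU.preimage (hf a)

theorem Param.continuous_mirror : Continuous (Param.mirror (d := d)) := by
  refine Param.continuous_mk ?_ _
  refine continuous_pi fun i => ?_
  split_ifs
  · exact ((continuous_apply i).comp Param.continuous_val).neg
  · exact (continuous_apply i).comp Param.continuous_val

/-- The mirror image of a curve. -/
def Curve.mirror (K : Curve 4 d) : Curve 4 d :=
  Quotient.map (sa := curveSetoid 4 d) (sb := curveSetoid 4 d) Param.mirror (fun k l h => by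
    obtain ⟨A, c, rfl⟩ := Param.reparam_iff.mp h
    exact Param.reparam_iff.mpr ⟨A, c, Param.mirror_act A c k⟩) K

theorem Curve.mirror_curveMk (k : Param 4 d) : (curveMk 4 d k).mirror = curveMk 4 d k.mirror := rfl

theorem Curve.continuous_mirror : Continuous (Curve.mirror (d := d)) := by
  rw [(isOpenQuotientMap_curveMk 4 d).isQuotientMap.continuous_iff]
  exact (isOpenQuotientMap_curveMk 4 d).continuous.comp Param.continuous_mirror

theorem Curve.mirror_mirror (K : Curve 4 d) : K.mirror.mirror = K := by
  obtain ⟨k, rfl⟩ := (isOpenQuotientMap_curveMk 4 d).surjective K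
  rw [Curve.mirror_curveMk, Curve.mirror_curveMk, Param.mirror_mirror]

end RationalKnot
end

noncomputable section

namespace RationalKnot

open MvPolynomial Matrix Topology Filter
open scoped LinearAlgebra.Projectivization

variable {n d e : ℕ}

/-! ### The projection of a nodal curve -/

/-- The point of projective 4-space with affine coordinates `v`. -/
def affinePoint (v : Fin 4 → ℝ) : Fin 5 → ℝ := Fin.cons 1 v

theorem affinePoint_zero (v : Fin 4 → ℝ) : affinePoint v 0 = 1 := rfl

theorem affinePoint_succ (v : Fin 4 → ℝ) (i : Fin 4) : affinePoint v i.succ = v i := rfl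

/-- The curve `K` has a double point with affine coordinates `v`, from which it is projected to the
knot `P.1`, and the plane `P.2` is the intersection of its tangent hyperplane with `x₀ = 0`. -/
def IsProjection (K : Curve 4 d) (P : Curve 3 e × Plane) (v : Fin 4 → ℝ) : Prop :=
  ∃ (k : Param 4 d) (l : Param 3 e) (q : BinForm 2) (w : BinForm (e - 2)) (r : BinForm (e + 2))
    (hv : v ≠ 0), Projects k l (affinePoint v) q w r ∧ l.IsKnot ∧ curveMk 4 d k = K ∧
      P = (curveMk 3 e l, planeMk ⟨v, hv⟩)

theorem Projects.isProjection {k : Param 4 d} {l : Param 3 e} {p : Fin 5 → ℝ} {q : BinForm 2}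
    {w : BinForm (e - 2)} {r : BinForm (e + 2)} (h : Projects k l p q w r) (hl : l.IsKnot) :
    IsProjection (curveMk 4 d k) (curveMk 3 e l, planeMk ⟨_, h.tail_ne_zero⟩)
      fun i => (p 0)⁻¹ * p i.succ := by
  have hp : (p 0)⁻¹ • p = affinePoint fun i => (p 0)⁻¹ * p i.succ := by
    funext j
    refine Fin.cases ?_ (fun i => rfl) j
    exact inv_mul_cancel₀ h.p_ne
  have h' := h.smul_point (inv_ne_zero h.p_ne)
  rw [hp] at h'
  refine ⟨k, l, _, _, _, h'.tail_ne_zero, h', hl, rfl, Prod.ext rfl ?_⟩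
  exact planeMk_eq_iff.mpr ⟨Units.mk0 _ h.p_ne, funext fun i => mul_inv_cancel_left₀ h.p_ne _⟩

theorem exists_isProjection (he : 2 ≤ e) (hd : d = e + 2) {K : Curve 4 d}
    (hK : K ∈ generalNodalSphereCurves d) :
    ∃ (P : Curve 3 e × Plane) (v : Fin 4 → ℝ), IsProjection K P v := by
  obtain ⟨k, rfl, hs, hk, hns⟩ := hK
  obtain ⟨z, z', hn, -⟩ := (hasExactlyOneDoublePoint_iff k (by omega)).mp hk
  obtain ⟨l, p, q, w, r, h, -⟩ := hn.exists_projects he hd hs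
  exact ⟨_, _, h.isProjection (h.isKnot_of_noFourSecant (by omega) hns)⟩

theorem generalNodalSphereCurves_eq (he : 2 ≤ e) (he6 : e < 6) (hd : d = e + 2) :
    generalNodalSphereCurves d = nodalSphereCurves d := by
  ext K
  constructor
  · rintro ⟨k, hkK, hs, hk, -⟩
    exact ⟨k, hkK, hs, hk⟩
  · rintro ⟨k, hkK, hs, hk⟩
    obtain ⟨z, z', hn, -⟩ := (hasExactlyOneDoublePoint_iff k (by omega)).mp hk
    obtain ⟨l, p, q, w, r, h, -⟩ := hn.exists_projects he hd hs
    exact ⟨k, hkK, hs, hk, h.noFourSecant (by omega) (h.isKnot_of_lt he he6 (by omega) hk)⟩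

namespace IsProjection

variable {K K' : Curve 4 d} {P P' : Curve 3 e × Plane} {v v' : Fin 4 → ℝ}

theorem mem_conicPairSpace (h : IsProjection K P v) :
    P ∈ conicPairSpace e 0 ∪ conicPairSpace e 2 := by
  obtain ⟨k, l, q, w, r, hv, h, hl, rfl, rfl⟩ := h
  by_cases hq : ∀ x : Fin 2 → ℝ, x ≠ 0 → q.rval x ≠ 0
  · exact .inl ((h.mem_conicPairSpace hl).1 hq)
  · push Not at hq
    exact .inr ((h.mem_conicPairSpace hl).2 hq)

theorem isSolitary (h : IsProjection K P v) (he : e ≠ 0) :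
    (K.IsSolitary → P ∈ conicPairSpace e 0) ∧ (¬ K.IsSolitary → P ∈ conicPairSpace e 2) := by
  obtain ⟨k, l, q, w, r, hv, h, hl, rfl, rfl⟩ := h
  constructor
  · rintro ⟨k', hk', hs⟩
    obtain ⟨A, c, rfl⟩ := Param.mk_eq_iff.mp hk'.symm
    have hq := ((h.act A c).isSolitary_iff he (hl.act he A c)).mp hs
    have := ((h.act A c).mem_conicPairSpace (hl.act he A c)).1 hq
    rwa [show (Quotient.mk (curveSetoid 3 e) (l.act A c) : Curve 3 e) = curveMk 3 e l from
      Param.parametrizes_act A c l] at this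
  · intro hs
    have hk : ¬ k.IsSolitary := fun hk => hs ⟨k, rfl, hk⟩
    rw [h.isSolitary_iff he hl] at hk
    push Not at hk
    exact (h.mem_conicPairSpace hl).2 hk

theorem mem_generalNodalSphereCurves (h : IsProjection K P v) (he : e ≠ 0) (hd : d ≠ 0) :
    K ∈ generalNodalSphereCurves d := by
  obtain ⟨k, l, q, w, r, hv, h, hl, rfl, rfl⟩ := h
  exact ⟨k, rfl, h.inSphere, h.hasExactlyOneDoublePoint he hd hl, h.noFourSecant he hl⟩

theorem isStereographicProjection (h : IsProjection K P v) : IsStereographicProjection K P := by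
  obtain ⟨k, l, q, w, r, hv, h, hl, rfl, rfl⟩ := h
  exact h.isStereographicProjection rfl rfl rfl

/-- The norm is the supremum norm. The bound confines the double point to a compact ball, along
which projection is proper. -/
theorem norm_le_one (h : IsProjection K P v) : ‖v‖ ≤ 1 := by
  obtain ⟨k, l, q, w, r, hv, h, hl, rfl, rfl⟩ := h
  rw [pi_norm_le_iff_of_nonneg zero_le_one]
  intro i
  have h1 := h.sphere
  simp only [affinePoint_zero, affinePoint_succ, one_pow] at h1
  have h2 := Finset.single_le_sum (f := fun i => v i ^ 2) (fun i _ => sq_nonneg _)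
    (Finset.mem_univ i)
  rw [h1] at h2
  exact (sq_le_one_iff_abs_le_one _).mp h2

theorem mirror (h : IsProjection K P v) : IsProjection K.mirror P (-v) := by
  obtain ⟨k, l, q, w, r, hv, h, hl, rfl, rfl⟩ := h
  convert h.mirror.isProjection hl using 1
  · rfl
  · rfl
  · funext i
    simp [reflection_zero, reflection_succ, affinePoint_zero, affinePoint_succ]

theorem exists_projects (h : IsProjection K P v) (he : e ≠ 0) {k : Param 4 d}
    (hk : curveMk 4 d k = K) : ∃ (l : Param 3 e) (q : BinForm 2) (w : BinForm (e - 2))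
      (r : BinForm (e + 2)) (hv : v ≠ 0), Projects k l (affinePoint v) q w r ∧ l.IsKnot ∧
      P = (curveMk 3 e l, planeMk ⟨v, hv⟩) := by
  obtain ⟨k', l, q, w, r, hv, h, hl, rfl, rfl⟩ := h
  obtain ⟨A, c, rfl⟩ := curveMk_eq_iff.mp hk.symm
  exact ⟨_, _, _, _, hv, h.act A c, hl.act he A c,
    Prod.ext (curveMk_eq_iff.mpr ⟨A, c, rfl⟩) rfl⟩

/-- A projection of a parametrization of `K` is determined by `K`. -/
theorem eq_of_projection (h : IsProjection K P v) (he : e ≠ 0) {k : Param 4 d}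
    (hk : curveMk 4 d k = K) {q' : BinForm 2} (hq' : q' ≠ 0) {f : Fin 4 → BinForm e}
    (hf : ∀ i, (k.1 i.succ).toPoly - C (v' i) * (k.1 0).toPoly = q'.toPoly * (f i).toPoly) :
    ∃ (hv : v' ≠ 0) (hf : ∀ z : Fin 2 → ℂ, z ≠ 0 → ∃ i, (f i).cval z ≠ 0),
      v' = v ∧ (curveMk 3 e ⟨f, hf⟩, planeMk ⟨v', hv⟩) = P := by
  obtain ⟨l, q, w, r, hv, hl', hl, rfl⟩ := h.exists_projects he hk
  obtain ⟨h1, s, hs, h2⟩ := hl'.unique he hl hq' hf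
  obtain rfl : v' = v := by
    funext i
    have := h1 i
    rw [affinePoint_zero, affinePoint_succ, one_mul] at this
    exact this.symm
  obtain rfl : f = (l.act 1 (Units.mk0 s hs)).1 := by
    funext i
    apply toPoly_injective
    rw [h2, toPoly_smul, Param.toPoly_act, Units.val_one, subst_one, Units.val_mk0]
  exact ⟨hv, (l.act 1 (Units.mk0 s hs)).2, rfl,
    Prod.ext (curveMk_eq_iff.mpr ⟨1, Units.mk0 s hs, rfl⟩).symm rfl⟩

theorem unique (h : IsProjection K P v) (h' : IsProjection K P' v') (he : e ≠ 0) :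
    v' = v ∧ P' = P := by
  obtain ⟨k, l, q, w, r, hv, h', hl, hk, rfl⟩ := h'
  obtain ⟨_, _, h1, h2⟩ := h.eq_of_projection he hk (q' := q) (f := l.1) (v' := v')
    (fun hq => cx_toPoly_ne_zero.mp h'.q_ne_zero (toPoly_eq_zero.mpr hq))
    (fun i => by
      rw [h'.succ, h'.zero, affinePoint_succ, affinePoint_zero, div_eq_mul_one_div, C_mul, C_neg]
      ring)
  exact ⟨h1, h2⟩

theorem curve_eq (h : IsProjection K P v) (h' : IsProjection K' P v) : K = K' := by
  obtain ⟨k, l, q, w, r, hv, h, hl, rfl, rfl⟩ := h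
  obtain ⟨k', l', q', w', r', hv', h', hl', rfl, hP⟩ := h'
  obtain ⟨A, c, rfl⟩ := curveMk_eq_iff.mp (congrArg Prod.fst hP)
  rw [curveMk_eq_iff.mpr ⟨A, c, rfl⟩]
  exact (h.act A c).mk_eq h'

/-- Equal planes give v' = a v up to exchange of roles, and both vectors have Euclidean length one,
so a² = 1. The point v then determines the curve, and -v its mirror image. -/
theorem curve_eq_or (h : IsProjection K P v) (h' : IsProjection K' P v') :
    K = K' ∨ K = K'.mirror := by
  suffices v = v' ∨ v = -v' by
    rcases this with rfl | rfl
    · exact .inl (h.curve_eq h')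
    · exact .inr (h.curve_eq h'.mirror)
  obtain ⟨k, l, q, w, r, hv, h, hl, rfl, rfl⟩ := h
  obtain ⟨k', l', q', w', r', hv', h', hl', rfl, hP⟩ := h'
  obtain ⟨a, rfl⟩ := planeMk_eq_iff.mp (congrArg Prod.snd hP)
  have h1 := h.sphere
  have h2 := h'.sphere
  simp only [affinePoint_zero, affinePoint_succ, one_pow, Pi.smul_apply, Units.smul_def,
    smul_eq_mul, mul_pow, ← Finset.mul_sum] at h1 h2
  rw [h2, mul_one] at h1
  rcases sq_eq_one_iff.mp h1 with ha | ha
  · left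
    funext i
    simp [Units.smul_def, ha]
  · right
    funext i
    simp [Units.smul_def, ha]

end IsProjection

/-- The positive root selects one of the two points of the sphere, continuously in v. -/
theorem exists_point_of_normal {v : Fin 4 → ℝ} (hv : v ≠ 0) :
    0 < √(∑ i, v i ^ 2) ∧
      ∑ i : Fin 4, (Fin.cons √(∑ i, v i ^ 2) v : Fin 5 → ℝ) i.succ ^ 2 =
        (Fin.cons √(∑ i, v i ^ 2) v : Fin 5 → ℝ) 0 ^ 2 := by
  obtain ⟨i, hi⟩ := Function.ne_iff.mp hv
  have h0 : 0 < ∑ i, v i ^ 2 :=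
    Finset.sum_pos' (fun i _ => sq_nonneg _) ⟨i, Finset.mem_univ i, sq_pos_of_ne_zero hi⟩
  refine ⟨Real.sqrt_pos.mpr h0, ?_⟩
  simp only [Fin.cons_succ, Fin.cons_zero, Real.sq_sqrt h0.le]

end RationalKnot
end

noncomputable section

namespace RationalKnot

open MvPolynomial Matrix Topology Filter
open scoped LinearAlgebra.Projectivization

variable {n d e : ℕ}

/-! ### Continuity of the projection -/

theorem continuous_mulForm_comp {X : Type*} [TopologicalSpace X] {a b : ℕ} (c : ℕ)
    {f : X → BinForm a} {g : X → BinForm b} (hf : Continuous f) (hg : Continuous g) :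
    Continuous fun x => mulForm c (f x) (g x) := by
  have h1 := hf.prodMk hg
  have h2 := (continuous_mulForm (a := a) (b := b) c).comp h1
  simpa only [Function.comp_def] using h2

theorem isProperMap_mulForm {a b c : ℕ} (h : a + b = c) (m : ℕ) :
    IsProperMap fun x : Metric.sphere (0 : BinForm a) 1 × (Fin m → BinForm b) =>
      fun i => mulForm c x.1.1 (x.2 i) := by
  have hcont : Continuous fun x : BinForm a × (Fin m → BinForm b) =>
      fun i => mulForm c x.1 (x.2 i) := by
    refine continuous_pi fun i => ?_
    have h1 : Continuous fun x : BinForm a × (Fin m → BinForm b) => x.2 i := by fun_prop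
    exact continuous_mulForm_comp c continuous_fst h1
  refine isProperMap_of_no_zero_divisors (V := BinForm a) (W := Fin m → BinForm b)
    (U := Fin m → BinForm c) (fun f g => fun i => mulForm c f (g i)) hcont
    (fun f t g => funext fun i => mulForm_smul f t (g i)) ?_
  intro f g hf hg
  obtain ⟨i, hi⟩ := Function.ne_iff.mp hg
  exact Function.ne_iff.mpr ⟨i, mulForm_ne_zero h hf hi⟩

/-- The differences of the parametrization and the multiples of its first coordinate. -/
def centralForms (x : (curveMk 4 d ⁻¹' generalNodalSphereCurves d) ×
    Metric.closedBall (0 : Fin 4 → ℝ) 1) : Fin 4 → BinForm d :=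
  fun i => x.1.1.1 i.succ - x.2.1 i • x.1.1.1 0

theorem continuous_centralForms : Continuous (centralForms (d := d)) := by
  refine continuous_pi fun i => ?_
  have h : ∀ j, Continuous fun x : (curveMk 4 d ⁻¹' generalNodalSphereCurves d) ×
      Metric.closedBall (0 : Fin 4 → ℝ) 1 => x.1.1.1 j := fun j =>
    (continuous_apply j).comp
      (Param.continuous_val.comp (continuous_subtype_val.comp continuous_fst))
  exact (h _).sub (((continuous_apply i).comp (continuous_subtype_val.comp continuous_snd)).smul
    (h 0))

/-- Parametrizations of nodal curves with a double point and a projection from it. -/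
def ProjectedParam (d e : ℕ) : Type :=
  {z : ((curveMk 4 d ⁻¹' generalNodalSphereCurves d) × Metric.closedBall (0 : Fin 4 → ℝ) 1) ×
    (Metric.sphere (0 : BinForm 2) 1 × (Fin 4 → BinForm e)) //
      centralForms z.1 = fun i => mulForm d z.2.1.1 (z.2.2 i)}

instance (d e : ℕ) : TopologicalSpace (ProjectedParam d e) :=
  inferInstanceAs (TopologicalSpace (Subtype _))

namespace ProjectedParam

/-- The nodal curve. -/
def curve (z : ProjectedParam d e) : generalNodalSphereCurves d :=
  ⟨curveMk 4 d z.1.1.1.1, z.1.1.1.2⟩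

theorem ne_zero (z : ProjectedParam d e) : z.1.2.1.1 ≠ 0 := ne_zero_of_mem_unit_sphere z.1.2.1

theorem eq_mul (hd : d = e + 2) (z : ProjectedParam d e) (i : Fin 4) :
    (z.1.1.1.1.1 i.succ).toPoly - C (z.1.1.2.1 i) * (z.1.1.1.1.1 0).toPoly =
      z.1.2.1.1.toPoly * (z.1.2.2 i).toPoly := by
  rw [← toPoly_mulForm (show 2 + e = d by omega)]
  have := congrArg (toPolyₗ d) (congrFun z.2 i)
  simp only [centralForms, map_sub, map_smul] at this
  rw [smul_eq_C_mul] at this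
  exact this

/-- Forgetting the factors is a base change of a proper multiplication map, and forgetting the
double point is a projection along a compact ball. The composite is a closed surjection onto the
parametrizations, followed by an open quotient map. -/
theorem isQuotientMap_curve (he : 2 ≤ e) (hd : d = e + 2) :
    IsQuotientMap (curve (d := d) (e := e)) := by
  have : CompactSpace (Metric.closedBall (0 : Fin 4 → ℝ) 1) :=
    isCompact_iff_compactSpace.mp (isCompact_closedBall _ _)
  have h1 : IsProperMap fun z : ProjectedParam d e => z.1.1 :=
    isProperMap_pullback (isProperMap_mulForm (show 2 + e = d by omega) 4)
      continuous_centralForms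
  have h2 : IsProperMap (Prod.fst : (curveMk 4 d ⁻¹' generalNodalSphereCurves d) ×
    Metric.closedBall (0 : Fin 4 → ℝ) 1 → _) := isProperMap_fst_of_compactSpace
  have h3 := h2.comp h1
  have h4 : IsOpenQuotientMap ((generalNodalSphereCurves d).restrictPreimage (curveMk 4 d)) :=
    (isOpenQuotientMap_curveMk 4 d).restrictPreimage _
  refine h4.isQuotientMap.comp (h3.isClosedMap.isQuotientMap h3.continuous ?_)
  rintro ⟨k, hk⟩
  obtain ⟨P, v, h⟩ := exists_isProjection he hd hk
  have hv1 := h.norm_le_one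
  obtain ⟨l, q, w, r, hv, h, hl, -⟩ := h.exists_projects (by omega) rfl
  have hq : q ≠ 0 := fun hq => cx_toPoly_ne_zero.mp h.q_ne_zero (toPoly_eq_zero.mpr hq)
  -- Normalize q to norm one and move its norm into l.
  refine ⟨⟨((⟨k, hk⟩, ⟨v, by simpa using hv1⟩), (⟨‖q‖⁻¹ • q, ?_⟩, fun i => ‖q‖ • l.1 i)), ?_⟩, rfl⟩
  · simp [norm_smul, hq]
  · funext i
    apply toPoly_injective
    rw [toPoly_mulForm (by omega), toPoly_smul, toPoly_smul]
    have h5 : C ‖q‖⁻¹ * C ‖q‖ = (1 : MvPolynomial (Fin 2) ℝ) := by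
      rw [← C_mul, inv_mul_cancel₀ (norm_ne_zero_iff.mpr hq), C_1]
    have h6 : (k.1 i.succ - v i • k.1 0).toPoly =
        (k.1 i.succ).toPoly - C (v i) * (k.1 0).toPoly := by
      rw [← toPoly_smul]
      exact map_sub (toPolyₗ d) _ _
    change (k.1 i.succ - v i • k.1 0).toPoly = _
    rw [h6, h.succ, h.zero, affinePoint_succ, affinePoint_zero, div_eq_mul_one_div, C_mul, C_neg]
    linear_combination (-q.toPoly * (l.1 i).toPoly) * h5

end ProjectedParam

/-- On `ProjectedParam` the double point and the projected forms are coordinates. By uniqueness of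
the projection they compute ν and φ, so both are continuous after a quotient map. -/
theorem continuous_of_isProjection (he : 2 ≤ e) (hd : d = e + 2)
    {φ : generalNodalSphereCurves d → Curve 3 e × Plane}
    {ν : generalNodalSphereCurves d → Fin 4 → ℝ} (h : ∀ K, IsProjection K.1 (φ K) (ν K)) :
    Continuous φ ∧ Continuous ν := by
  have hq := ProjectedParam.isQuotientMap_curve he hd
  have key := fun z : ProjectedParam d e =>
    (h z.curve).eq_of_projection (by omega) rfl z.ne_zero (z.eq_mul hd)
  have hcont : Continuous fun z : ProjectedParam d e => z.1 := continuous_subtype_val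
  have hv : Continuous fun z : ProjectedParam d e => z.1.1.2.1 :=
    continuous_subtype_val.comp (continuous_snd.comp (continuous_fst.comp hcont))
  constructor
  · rw [hq.continuous_iff]
    have : φ ∘ ProjectedParam.curve = fun z : ProjectedParam d e =>
        (curveMk 3 e ⟨z.1.2.2, (key z).choose_spec.choose⟩,
          planeMk ⟨z.1.1.2.1, (key z).choose⟩) := by
      funext z
      exact (key z).choose_spec.choose_spec.2.symm
    rw [this]
    refine Continuous.prodMk ?_ ?_
    · exact (isOpenQuotientMap_curveMk 3 e).continuous.comp
        (Param.continuous_mk (continuous_snd.comp (continuous_snd.comp hcont)) _)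
    · exact isOpenQuotientMap_planeMk.continuous.comp (hv.subtype_mk _)
  · rw [hq.continuous_iff]
    convert hv using 1
    funext z
    exact (key z).choose_spec.choose_spec.1.symm

end RationalKnot
end

noncomputable section

namespace RationalKnot

open MvPolynomial Matrix Topology Filter
open scoped LinearAlgebra.Projectivization

variable {n d e : ℕ}

/-! ### The projection is a quotient map -/

/-- The pair of a parametrized curve and the plane with a given normal vector. -/
def pairMk (e : ℕ) : Param 3 e × {v : Fin 4 → ℝ // v ≠ 0} → Curve 3 e × Plane :=
  Prod.map (curveMk 3 e) planeMk

theorem isOpenQuotientMap_pairMk (e : ℕ) : IsOpenQuotientMap (pairMk e) :=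
  (isOpenQuotientMap_curveMk 3 e).prodMap isOpenQuotientMap_planeMk

/-- The pull-backs of the equations of the plane and of the empty quadric. -/
def sectionForms (x : pairMk e ⁻¹' (conicPairSpace e 0 ∪ conicPairSpace e 2)) :
    BinForm e × BinForm (2 * e) :=
  (∑ i, x.1.2.1 i • x.1.1.1 i, ∑ i, mulForm (2 * e) (x.1.1.1 i) (x.1.1.1 i))

theorem continuous_sectionForms : Continuous (sectionForms (e := e)) := by
  have h1 : ∀ i, Continuous fun x : pairMk e ⁻¹' (conicPairSpace e 0 ∪ conicPairSpace e 2) =>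
      x.1.1.1 i := fun i =>
    (continuous_apply i).comp (Param.continuous_val.comp (continuous_fst.comp continuous_subtype_val))
  have h2 : ∀ i, Continuous fun x : pairMk e ⁻¹' (conicPairSpace e 0 ∪ conicPairSpace e 2) =>
      x.1.2.1 i := fun i =>
    (continuous_apply i).comp
      (continuous_subtype_val.comp (continuous_snd.comp continuous_subtype_val))
  refine Continuous.prodMk ?_ ?_
  · exact continuous_finsetSum _ fun i _ => (h2 i).smul (h1 i)
  · exact continuous_finsetSum _ fun i _ => continuous_mulForm_comp _ (h1 i) (h1 i)

theorem isProperMap_mulForm_prod {a b b' c c' : ℕ} (h : a + b = c) (h' : a + b' = c') :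
    IsProperMap fun x : Metric.sphere (0 : BinForm a) 1 × (BinForm b × BinForm b') =>
      (mulForm c x.1.1 x.2.1, mulForm c' x.1.1 x.2.2) := by
  have hcont : Continuous fun x : BinForm a × (BinForm b × BinForm b') =>
      (mulForm c x.1 x.2.1, mulForm c' x.1 x.2.2) :=
    (continuous_mulForm_comp c continuous_fst (continuous_fst.comp continuous_snd)).prodMk
      (continuous_mulForm_comp c' continuous_fst (continuous_snd.comp continuous_snd))
  refine isProperMap_of_no_zero_divisors (V := BinForm a) (W := BinForm b × BinForm b')
    (U := BinForm c × BinForm c') (fun f g => (mulForm c f g.1, mulForm c' f g.2)) hcont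
    (fun f t g => Prod.ext (mulForm_smul f t g.1) (mulForm_smul f t g.2)) ?_
  intro f g hf hg h0
  by_cases hg1 : g.1 = 0
  · have hg2 : g.2 ≠ 0 := fun hg2 => hg (Prod.ext hg1 hg2)
    exact mulForm_ne_zero h' hf hg2 (congrArg Prod.snd h0)
  · exact mulForm_ne_zero h hf hg1 (congrArg Prod.fst h0)

/-- Parametrized pairs in `conicPairSpace e 0 ∪ conicPairSpace e 2`, with the factorizations of the
pull-backs of the equations of the plane and of the conic. -/
def FactoredPair (e : ℕ) : Type :=
  {z : (pairMk e ⁻¹' (conicPairSpace e 0 ∪ conicPairSpace e 2)) ×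
    (Metric.sphere (0 : BinForm (e - 2)) 1 × (BinForm 2 × BinForm (e + 2))) //
      sectionForms z.1 = (mulForm e z.2.1.1 z.2.2.1, mulForm (2 * e) z.2.1.1 z.2.2.2)}

instance (e : ℕ) : TopologicalSpace (FactoredPair e) :=
  inferInstanceAs (TopologicalSpace (Subtype _))

theorem toPoly_sum {ι : Type*} (s : Finset ι) (f : ι → BinForm d) :
    (∑ i ∈ s, f i).toPoly = ∑ i ∈ s, (f i).toPoly :=
  map_sum (toPolyₗ d) f s

namespace FactoredPair

/-- The parametrization of the knot. -/
def knot (z : FactoredPair e) : Param 3 e := z.1.1.1.1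

/-- The normal vector of the plane. -/
def normal (z : FactoredPair e) : Fin 4 → ℝ := z.1.1.1.2.1

/-- The common factor of the two pull-backs. -/
def common (z : FactoredPair e) : BinForm (e - 2) := z.1.2.1.1

/-- The residual factor of the pull-back of the plane. -/
def planeFactor (z : FactoredPair e) : BinForm 2 := z.1.2.2.1

/-- The residual factor of the pull-back of the conic. -/
def conicFactor (z : FactoredPair e) : BinForm (e + 2) := z.1.2.2.2

/-- The pair of a knot and a plane. -/
def pair (z : FactoredPair e) : ↥(conicPairSpace e 0 ∪ conicPairSpace e 2) :=
  ⟨pairMk e z.1.1.1, z.1.1.2⟩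

theorem normal_ne_zero (z : FactoredPair e) : z.normal ≠ 0 := z.1.1.1.2.2

theorem common_ne_zero (z : FactoredPair e) : z.common ≠ 0 := ne_zero_of_mem_unit_sphere z.1.2.1

theorem plane_eq (he : 2 ≤ e) (z : FactoredPair e) :
    ∑ i, C (z.normal i) * (z.knot.1 i).toPoly = z.common.toPoly * z.planeFactor.toPoly := by
  rw [← toPoly_mulForm (show e - 2 + 2 = e by omega)]
  refine Eq.trans ?_ (congrArg BinForm.toPoly (congrArg Prod.fst z.2))
  rw [sectionForms, toPoly_sum]
  simp only [toPoly_smul]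
  rfl

theorem conic_eq (he : 2 ≤ e) (z : FactoredPair e) :
    ∑ i, (z.knot.1 i).toPoly ^ 2 = z.common.toPoly * z.conicFactor.toPoly := by
  rw [← toPoly_mulForm (show e - 2 + (e + 2) = 2 * e by omega)]
  refine Eq.trans ?_ (congrArg BinForm.toPoly (congrArg Prod.snd z.2))
  rw [sectionForms, toPoly_sum]
  refine Finset.sum_congr rfl fun i _ => ?_
  rw [toPoly_mulForm (by omega), sq]
  rfl

/-- A vector in the cone over the sphere with the given normal vector as its last coordinates. -/
def point (z : FactoredPair e) : Fin 5 → ℝ := Fin.cons √(∑ i, z.normal i ^ 2) z.normal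

/-- A factorization in `FactoredPair` is not required to be coprime. It inherits this from the
coprime one provided by the pair, since the two differ by a common scalar on the residual factors.
-/
theorem exists_projects (he : 2 ≤ e) (hd : d = e + 2) (z : FactoredPair e) :
    z.knot.IsKnot ∧ ∃ k : Param 4 d,
      Projects k z.knot z.point z.planeFactor z.common z.conicFactor ∧
      (∀ j, k.1 j = Fin.cases (ofPoly d (C (-(z.point 0 / 2)) * z.conicFactor.toPoly))
        (fun i => ofPoly d (z.planeFactor.toPoly * (z.knot.1 i).toPoly -
          C (z.point i.succ / 2) * z.conicFactor.toPoly)) j) := by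
  obtain ⟨h0, h1⟩ := exists_point_of_normal z.normal_ne_zero
  obtain ⟨hl, k, q, w, r, h⟩ := exists_projects_of_mem (d := d) (by omega) hd z.pair.2
    (l := z.knot) (p := z.point) rfl h1 h0.ne' z.normal_ne_zero rfl
  refine ⟨hl, ?_⟩
  obtain ⟨c, hc, hq, hr⟩ := exists_smul_of_mul_eq (cx_toPoly_ne_zero.mp h.w_ne_zero)
    (mt toPoly_eq_zero.mp z.common_ne_zero) h.coprime (by rw [← z.plane_eq he, ← h.plane]; rfl)
    (by rw [← z.conic_eq he, ← h.conic])
  have hval : ∀ {m : ℕ} {f f' : BinForm m} {x : Fin 2 → ℂ}, f' = c • f →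
      (f'.cval x = 0 ↔ f.cval x = 0) := by
    rintro m f _ x rfl
    rw [BinForm.cval_eq, BinForm.cpoly, toPoly_smul, cx, map_mul, map_mul, map_C, eval_C,
      BinForm.cval_eq, mul_eq_zero]
    exact or_iff_right (by simpa using hc)
  refine RationalKnot.exists_projects hd h1 h0.ne' (z.plane_eq he) (z.conic_eq he) ?_ ?_
  · intro x hx
    rw [hval hq, hval hr]
    exact h.coprime x hx
  · obtain ⟨x, x', hx, hx', hxx, h2, h3⟩ := h.roots
    exact ⟨x, x', hx, hx', hxx, (hval hq).mpr h2, (hval hq).mpr h3⟩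

/-- Properness of multiplication by unit forms w makes forgetting the factorization closed; the
conic condition makes it surjective. -/
theorem isQuotientMap_pair (he : 2 ≤ e) : IsQuotientMap (pair (e := e)) := by
  have h1 : IsProperMap fun z : FactoredPair e => z.1.1 :=
    isProperMap_pullback (isProperMap_mulForm_prod (show e - 2 + 2 = e by omega)
      (show e - 2 + (e + 2) = 2 * e by omega)) continuous_sectionForms
  have h2 : IsOpenQuotientMap
      ((conicPairSpace e 0 ∪ conicPairSpace e 2).restrictPreimage (pairMk e)) :=
    (isOpenQuotientMap_pairMk e).restrictPreimage _
  refine h2.isQuotientMap.comp (h1.isClosedMap.isQuotientMap h1.continuous ?_)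
  rintro ⟨⟨l, v, hv⟩, hP⟩
  obtain ⟨h3, h4⟩ := exists_point_of_normal hv
  obtain ⟨hl, k, q, w, r, h⟩ := exists_projects_of_mem (d := e + 2) (by omega) rfl hP
    (l := l) rfl h4 h3.ne' hv rfl
  have hw : w ≠ 0 := fun hw => cx_toPoly_ne_zero.mp h.w_ne_zero (toPoly_eq_zero.mpr hw)
  have hC : C ‖w‖⁻¹ * C ‖w‖ = (1 : MvPolynomial (Fin 2) ℝ) := by
    rw [← C_mul, inv_mul_cancel₀ (norm_ne_zero_iff.mpr hw), C_1]
  refine ⟨⟨(⟨(l, ⟨v, hv⟩), hP⟩, (⟨‖w‖⁻¹ • w, ?_⟩, (‖w‖ • q, ‖w‖ • r))), ?_⟩, rfl⟩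
  · simp [norm_smul, hw]
  · refine Prod.ext (toPoly_injective ?_) (toPoly_injective ?_)
    · rw [toPoly_mulForm (by omega), toPoly_smul, toPoly_smul, sectionForms, toPoly_sum]
      simp only [toPoly_smul]
      have := h.plane
      simp only [Fin.cons_succ] at this
      rw [this]
      linear_combination (-w.toPoly * q.toPoly) * hC
    · rw [toPoly_mulForm (by omega), toPoly_smul, toPoly_smul, sectionForms, toPoly_sum]
      have : ∀ i, (mulForm (2 * e) (l.1 i) (l.1 i)).toPoly = (l.1 i).toPoly ^ 2 := fun i => by
        rw [toPoly_mulForm (by omega), sq]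
      simp only [this, h.conic]
      linear_combination (-w.toPoly * r.toPoly) * hC

/-- The nodal curve which is projected to the knot. -/
def param (he : 2 ≤ e) (hd : d = e + 2) (z : FactoredPair e) : Param 4 d :=
  (z.exists_projects he hd).2.choose

/-- Although `param` is chosen, its coefficients are the explicit ones, continuous in the data and
in the square root giving p_0. -/
theorem continuous_param (he : 2 ≤ e) (hd : d = e + 2) : Continuous (param he hd) := by
  have h1 := fun z : FactoredPair e => (z.exists_projects he hd).2.choose_spec.2
  have hval : Continuous fun z : FactoredPair e => z.1 := continuous_subtype_val
  have hval1 : Continuous fun z : FactoredPair e => z.1.1.1 :=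
    continuous_subtype_val.comp (continuous_fst.comp hval)
  have hl : ∀ i, Continuous fun z : FactoredPair e => z.knot.1 i := fun i =>
    (continuous_apply i).comp (Param.continuous_val.comp (continuous_fst.comp hval1))
  have hv : Continuous fun z : FactoredPair e => z.normal :=
    continuous_subtype_val.comp (continuous_snd.comp hval1)
  have hq : Continuous fun z : FactoredPair e => z.planeFactor :=
    continuous_fst.comp (continuous_snd.comp (continuous_snd.comp hval))
  have hr : Continuous fun z : FactoredPair e => ofPoly d z.conicFactor.toPoly :=
    (continuous_ofPoly_toPoly (e + 2) d).comp
      (continuous_snd.comp (continuous_snd.comp (continuous_snd.comp hval)))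
  refine Continuous.subtype_mk (f := fun z => (param he hd z).1) ?_ fun z => (param he hd z).2
  refine continuous_pi fun j => ?_
  refine Fin.cases ?_ (fun i => ?_) j
  · have : (fun z : FactoredPair e => (param he hd z).1 0) = fun z =>
        (-(√(∑ i, z.normal i ^ 2) / 2)) • ofPoly d z.conicFactor.toPoly := by
      funext z
      rw [← map_smul, smul_eq_C_mul]
      exact h1 z 0
    rw [this]
    fun_prop
  · have : (fun z : FactoredPair e => (param he hd z).1 i.succ) = fun z =>
        mulForm d z.planeFactor (z.knot.1 i) - (z.normal i / 2) • ofPoly d z.conicFactor.toPoly := by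
      funext z
      rw [← map_smul, smul_eq_C_mul, mulForm, ← map_sub]
      exact h1 z i.succ
    rw [this]
    exact (continuous_mulForm_comp d hq (hl i)).sub
      ((((continuous_apply i).comp hv).div_const 2).smul hr)

theorem exists_isProjection (he : 2 ≤ e) (hd : d = e + 2) (z : FactoredPair e) :
    ∃ v, IsProjection (curveMk 4 d (param he hd z)) z.pair.1 v :=
  ⟨_, (z.exists_projects he hd).2.choose_spec.1.isProjection (z.exists_projects he hd).1⟩

end FactoredPair

/-- The inverse construction lifts the quotient map `FactoredPair.pair` continuously through φ, so φ
is itself a quotient map. No global section of φ is needed. -/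
theorem isQuotientMap_of_isProjection (he : 2 ≤ e) (hd : d = e + 2)
    {φ : generalNodalSphereCurves d → ↥(conicPairSpace e 0 ∪ conicPairSpace e 2)}
    {ν : generalNodalSphereCurves d → Fin 4 → ℝ} (h : ∀ K, IsProjection K.1 (φ K).1 (ν K)) :
    IsQuotientMap φ := by
  have hcont : Continuous φ :=
    (continuous_of_isProjection he hd (φ := fun K => (φ K).1) h).1.subtype_mk fun K => (φ K).2
  let ψ : FactoredPair e → generalNodalSphereCurves d := fun z =>
    ⟨curveMk 4 d (z.param he hd), by
      obtain ⟨v, hv⟩ := z.exists_isProjection he hd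
      exact hv.mem_generalNodalSphereCurves (by omega) (by omega)⟩
  have hψ : Continuous ψ :=
    ((isOpenQuotientMap_curveMk 4 d).continuous.comp
      (FactoredPair.continuous_param he hd)).subtype_mk _
  refine IsQuotientMap.of_comp hψ hcont ?_
  have : φ ∘ ψ = FactoredPair.pair := by
    funext z
    obtain ⟨v, hv⟩ := z.exists_isProjection he hd
    exact Subtype.ext (hv.unique (h (ψ z)) (by omega)).2
  rw [this]
  exact FactoredPair.isQuotientMap_pair he

/-! ### The covering -/

/-- The mirror image, as an involution of the space of nodal curves. -/
def mirrorNodal (he : 2 ≤ e) (hd : d = e + 2) (K : generalNodalSphereCurves d) :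
    generalNodalSphereCurves d :=
  ⟨K.1.mirror, by
    obtain ⟨P, v, h⟩ := exists_isProjection he hd K.2
    exact h.mirror.mem_generalNodalSphereCurves (by omega) (by omega)⟩

theorem exists_isCoveringMap (he : 2 ≤ e) (hd : d = e + 2) :
    ∃ φ : generalNodalSphereCurves d → ↥(conicPairSpace e 0 ∪ conicPairSpace e 2),
      IsCoveringMap φ ∧
      (∀ x, (φ ⁻¹' {x}).encard = 2) ∧
      (∀ K, IsStereographicProjection K.1 (φ K).1) ∧
      (∀ K, K.1.IsSolitary → (φ K).1 ∈ conicPairSpace e 0) ∧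
      (∀ K, ¬ K.1.IsSolitary → (φ K).1 ∈ conicPairSpace e 2) ∧
      (∀ K K', K ≠ K' → φ K = φ K' → IsMirrorImage K.1 K'.1) := by
  have he0 : e ≠ 0 := by omega
  choose P ν h using fun K : generalNodalSphereCurves d =>
    exists_isProjection (e := e) he hd K.2
  let φ : generalNodalSphereCurves d → ↥(conicPairSpace e 0 ∪ conicPairSpace e 2) := fun K =>
    ⟨P K, (h K).mem_conicPairSpace⟩
  have hφ : IsQuotientMap φ := isQuotientMap_of_isProjection he hd (φ := φ) h
  let τ := mirrorNodal (d := d) he hd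
  have hτ : Continuous τ := (Curve.continuous_mirror.comp continuous_subtype_val).subtype_mk _
  have hφτ : ∀ K, φ (τ K) = φ K := fun K =>
    Subtype.ext ((h K).mirror.unique (h (τ K)) he0).2
  have hντ : ∀ K, ν (τ K) = -ν K := fun K => ((h K).mirror.unique (h (τ K)) he0).1
  have hν0 : ∀ K, ν K ≠ 0 := fun K => by
    obtain ⟨k, l, q, w, r, hv, -⟩ := h K
    exact hv
  -- The reflection moves the double point from v to -v, and v ≠ 0. Hence every fibre has two
  -- elements.
  have hne : ∀ K, K ≠ τ K := fun K hK => hν0 K (self_eq_neg.mp ((congrArg ν hK).trans (hντ K)))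
  have hfib : ∀ K K', φ K = φ K' ↔ K = K' ∨ K = τ K' := by
    intro K K'
    constructor
    · intro hK
      have hP : P K = P K' := congrArg Subtype.val hK
      rcases (h K).curve_eq_or (hP ▸ h K') with h1 | h1
      · exact .inl (Subtype.ext h1)
      · exact .inr (Subtype.ext h1)
    · rintro (rfl | rfl)
      · rfl
      · exact hφτ K'
  refine ⟨φ, isCoveringMap_of_involution hφ hτ (fun K => Subtype.ext K.1.mirror_mirror) hfib
    (continuous_of_isProjection he hd h).2 hντ hν0, fun x => ?_,
    fun K => (h K).isStereographicProjection, fun K => ((h K).isSolitary he0).1,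
    fun K => ((h K).isSolitary he0).2, fun K K' hK hKK' => ?_⟩
  · obtain ⟨K, rfl⟩ := hφ.surjective x
    have : φ ⁻¹' {φ K} = {K, τ K} := by
      ext K'
      exact hfib K' K
    rw [this, Set.encard_pair (hne K)]
  · rcases (hfib K' K).mp hKK'.symm with h1 | h1
    · exact absurd h1.symm hK
    · obtain ⟨k, hk⟩ := (isOpenQuotientMap_curveMk 4 d).surjective K.1
      refine ⟨k, k.mirror, hk, ?_, k.rvec_mirror⟩
      rw [h1]
      change curveMk 4 d k.mirror = K.1.mirror
      rw [← hk]
      rfl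

end RationalKnot

end

theorem mainTheorem3 (d : ℕ) (hd : 4 ≤ d) :
    (∃ φ : ↥(generalNodalSphereCurves d) →
        ↥(conicPairSpace (d - 2) 0 ∪ conicPairSpace (d - 2) 2),
      IsCoveringMap φ ∧
      (∀ x, (φ ⁻¹' {x}).encard = 2) ∧
      (∀ K, IsStereographicProjection K.1 (φ K).1) ∧
      (∀ K, K.1.IsSolitary → (φ K).1 ∈ conicPairSpace (d - 2) 0) ∧
      (∀ K, ¬ K.1.IsSolitary → (φ K).1 ∈ conicPairSpace (d - 2) 2) ∧
      (∀ K K', K ≠ K' → φ K = φ K' → IsMirrorImage K.1 K'.1)) ∧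
    (d < 8 → generalNodalSphereCurves d = nodalSphereCurves d) := by
  obtain ⟨e, rfl⟩ : ∃ e, d = e + 2 := ⟨d - 2, by omega⟩
  exact ⟨exists_isCoveringMap (by omega) rfl,
    fun hd8 => generalNodalSphereCurves_eq (e := e) (by omega) (by omega) rfl⟩
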